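/- **Setting.** A tail copula is a function $R:[0,\infty]^2\setminus\{(\infty,\infty)\}\to[0,\infty)$ of the form $R(x,y)=\lim_{t\to\infty}t\,P(1-F_1(X)<x/t,\;1-F_2(Y)<y/t)$, where $(X,Y)$ is a random vector with marginal distribution functions $F_1,F_2$ whose joint distribution function lies in the max-domain of attraction of a bivariate distribution with nondegenerate margins. It generates a measure, also denoted $R$, with $R([0,x]\times[0,y])=R(x,y)$. Let $\Theta\subset\mathbb R^d$ be open, let $\{R_\theta:\theta\in\Theta\}$ be a family of tail copulas, let $\theta_0\in\Theta$, $0<\delta<T<\infty$ and $\gamma_1,\gamma_2\in\mathbb R$. Assume: * (B2 at $\theta_0$) the partial derivatives $R_{(1)}=\partial_xR_{\theta_0}$, $R_{(2)}=\partial_yR_{\theta_0}$ and $\dot R=\bigl(\partial_{\theta_1}R_\theta,\dots,\partial_{\theta_d}R_\theta\bigr)^\top\big|_{\theta=\theta_0}$ exist and are continuous in $(x,y)\in(0,\infty)^2$; * (B4 at $\theta_0$) for all $\theta$ in some neighbourhood $N\subset\Theta$ of $\theta_0$, $R_\theta=R^{(c)}_\theta+R^{(s)}_\theta$, where $R^{(s)}_\theta([0,\infty)^2)=0$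 and $R^{(c)}_\theta$ has a positive Lebesgue density $r_\theta$ on $(0,\infty)^2$; the derivatives $\partial_xr_{\theta_0},\partial_yr_{\theta_0}$ exist and are continuous on $(0,\infty)^2$; the derivatives $\partial_{\theta_i}r_\theta(x,y)$ exist for $(x,y,\theta)\in(0,\infty)^2\times N$ and, as functions of $(x,y,\theta)$, are continuous at every point $(x,y,\theta_0)$ with $(x,y)\in(0,\infty)^2$. For $j=1,2$ and $x>0$ put $f_j(x)=x(x^{\gamma_j}-1)/\gamma_j$, $g_j(x)=-x^{\gamma_j+1}$, $h_j(x)=x(1-x^{\gamma_j})/\gamma_j^2+(x\log x)/\gamma_j$, where for $\gamma_j=0$ one reads $f_j(x)=x\log x$ and $h_j(x)=-(x\log^2x)/2$. With $r=r_{\theta_0}$, let $\mathbf q=(q_1,\dots,q_{6+d})^\top$ be given by $$q_1=f_1'(x)+f_1(x)\,\partial_x\log r,\quad q_2=g_1'(x)+g_1(x)\,\partial_x\log r,\quad q_3=h_1'(x)+h_1(x)\,\partial_x\log r,$$ $$q_4=f_2'(y)+f_2(y)\,\partial_y\log r,\quad q_5=g_2'(y)+g_2(y)\,\partial_y\log r,\quad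 q_6=h_2'(y)+h_2(y)\,\partial_y\log r,$$ $$q_{6+i}=\partial_{\theta_i}\log r_\theta(x,y)\big|_{\theta=\theta_0},\qquad i=1,\dots,d,$$ and assume that the matrices $$\mathbf I(t)=\int_\delta^T\!\!\int_t^T\mathbf q(s',t')\,\mathbf q^\top(s',t')\,dR_{\theta_0}(s',t'),\qquad t\in[\delta,T),$$ are invertible. On a probability space let $V$ be a zero-mean Gaussian process on $[\delta,T]^2$ with covariance $E[V(x,y)V(x',y')]=R_{\theta_0}(x\wedge x',y\wedge y')$, let $A_1,A_2,B_1,B_2,\Gamma_1,\Gamma_2,\zeta_1,\dots,\zeta_d$ be arbitrary real random variables, and let $$\widehat\eta(x,y)=V+R_{(1)}\bigl[f_1(x)A_1+g_1(x)B_1+h_1(x)\Gamma_1\bigr]+R_{(2)}\bigl[f_2(y)A_2+g_2(y)B_2+h_2(y)\Gamma_2\bigr]+\dot R^\top\zeta ,\qquad (x,y)\in[\delta,T]^2,$$ $$\widehat\eta([\delta,x]\times[\delta,y])=\widehat\eta(x,y)-\widehat\eta(\delta,y)-\widehat\eta(x,\delta)+\widehat\eta(\delta,\delta).$$ **Statement.**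 For every $t\in[\delta,T)$ the stochastic integral $\int_\delta^T\!\int_t^T\mathbf q\,d\widehat\eta$ exists as the limit in probability of Riemann–Stieltjes sums over tagged grids as the mesh tends to zero, and these random vectors have a version that is jointly measurable in $(t,\omega)$. For every such version, the outer integral below converges absolutely almost surely, for each $(x,y)\in[\delta,T]\times[\delta,T)$, and the process $$W_R([\delta,x]\times[\delta,y])=\widehat\eta([\delta,x]\times[\delta,y])-\int_\delta^x\!\!\int_\delta^y\mathbf q^\top(s,t)\Bigl(\mathbf I^{-1}(t)\int_\delta^T\!\!\int_t^T\mathbf q(s',t')\,d\widehat\eta(s',t')\Bigr)dR_{\theta_0}(s,t)$$ is a Wiener process with time $R_{\theta_0}$ on $[\delta,T]\times[\delta,T)$: it is a zero-mean Gaussian process with $$E\bigl[W_R([\delta,x]\times[\delta,y])\,W_R([\delta,x']\times[\delta,y'])\bigr]=R_{\theta_0}\bigl([\delta,x\wedge x']\times[\delta,y\wedge y']\bigr).$$ -/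

import Mathlib

open Set Filter Topology MeasureTheory ProbabilityTheory
open scoped ENNReal Matrix

noncomputable section

namespace TailGoF

/-! ### Tail copulas and the measures they generate -/

/-- The bivariate distribution `F` lies in the max-domain of attraction of the bivariate
distribution `G`, which has nondegenerate margins. -/
def InMaxDomainOfAttraction (F G : Measure (ℝ × ℝ)) : Prop :=
  (∀ c : ℝ, G.map Prod.fst ≠ Measure.dirac c) ∧
  (∀ c : ℝ, G.map Prod.snd ≠ Measure.dirac c) ∧
  ∃ a₁ a₂ b₁ b₂ : ℕ → ℝ, (∀ n, 0 < a₁ n ∧ 0 < a₂ n) ∧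
    ∀ p : ℝ × ℝ, ContinuousAt (fun p' : ℝ × ℝ => G.real (Iic p')) p →
      Tendsto (fun n : ℕ => F.real (Iic (a₁ n * p.1 + b₁ n, a₂ n * p.2 + b₂ n)) ^ n)
        atTop (𝓝 (G.real (Iic p)))

/-- `R` is a tail copula, as a `[0,∞)`-valued function on `[0,∞]² ∖ {(∞,∞)}` (its value at
`(∞,∞)` is irrelevant): for some random vector `(X,Y)` whose d.f. is in a max-domain of attraction,
`R(x,y) = lim t P(1 - F₁(X) < x/t, 1 - F₂(Y) < y/t)` as `t → ∞`. -/
def IsTailCopula (R : ℝ≥0∞ → ℝ≥0∞ → ℝ≥0∞) : Prop :=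
  ∃ F G : Measure (ℝ × ℝ), IsProbabilityMeasure F ∧ IsProbabilityMeasure G ∧
    InMaxDomainOfAttraction F G ∧
    ∀ x y : ℝ≥0∞, (x, y) ≠ (⊤, ⊤) → R x y ≠ ⊤ ∧
      Tendsto (fun t : ℝ => ENNReal.ofReal t *
          F {p : ℝ × ℝ |
            ENNReal.ofReal (1 - (F.map Prod.fst).real (Iic p.1)) < x / ENNReal.ofReal t ∧
            ENNReal.ofReal (1 - (F.map Prod.snd).real (Iic p.2)) < y / ENNReal.ofReal t})
        atTop (𝓝 (R x y))

/-- `μ` is the measure on `[0,∞]² ∖ {(∞,∞)}` generated by `R`. -/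
def IsTailMeasure (R : ℝ≥0∞ → ℝ≥0∞ → ℝ≥0∞) (μ : Measure (ℝ≥0∞ × ℝ≥0∞)) : Prop :=
  μ {(⊤, ⊤)} = 0 ∧
  ∀ x y : ℝ≥0∞, (x, y) ≠ (⊤, ⊤) → μ (Iic x ×ˢ Iic y) = R x y

/-- The part of a measure on `[0,∞]²` that lives on `[0,∞)²`, as a measure on `ℝ²`. -/
def planar (μ : Measure (ℝ≥0∞ × ℝ≥0∞)) : Measure (ℝ × ℝ) :=
  (μ.restrict (Iio ⊤ ×ˢ Iio ⊤)).map (fun p => (p.1.toReal, p.2.toReal))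

/-- The real-valued function `(x,y) ↦ R(x,y)` on `[0,∞)²`. -/
def tailFun (R : ℝ≥0∞ → ℝ≥0∞ → ℝ≥0∞) (x y : ℝ) : ℝ :=
  (R (ENNReal.ofReal x) (ENNReal.ofReal y)).toReal

/-- `μ = μᶜ + μˢ`, where `μˢ` vanishes on `[0,∞)²` and `μᶜ` is absolutely continuous with
respect to Lebesgue measure on `(0,∞)²`, with positive density `r`. -/
def HasPositiveTailDensity (μ : Measure (ℝ≥0∞ × ℝ≥0∞)) (r : ℝ → ℝ → ℝ) : Prop :=
  (∀ x > 0, ∀ y > 0, 0 < r x y) ∧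
  AEMeasurable (fun p : ℝ × ℝ => r p.1 p.2) (volume.restrict (Ioi 0 ×ˢ Ioi 0)) ∧
  ∃ μc μs : Measure (ℝ≥0∞ × ℝ≥0∞), μ = μc + μs ∧ μs (Iio ⊤ ×ˢ Iio ⊤) = 0 ∧
    μc = ((volume.restrict (Ioi 0 ×ˢ Ioi 0)).withDensity
        (fun p : ℝ × ℝ => ENNReal.ofReal (r p.1 p.2))).map
      (fun p => (ENNReal.ofReal p.1, ENNReal.ofReal p.2))

/-! ### Partial derivatives and the regularity assumptions -/

/-- Partial derivative in `x`. -/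
def dX (F : ℝ → ℝ → ℝ) (x y : ℝ) : ℝ := deriv (fun s => F s y) x

/-- Partial derivative in `y`. -/
def dY (F : ℝ → ℝ → ℝ) (x y : ℝ) : ℝ := deriv (fun s => F x s) y

/-- Partial derivative in the `i`-th component of the parameter, at `θ`. -/
def dTheta {d : ℕ} (F : (Fin d → ℝ) → ℝ → ℝ → ℝ) (θ : Fin d → ℝ) (i : Fin d) (x y : ℝ) : ℝ :=
  deriv (fun s => F (Function.update θ i s) x y) (θ i)

/-- The first-order partial derivatives of `F` in `x` and `y` exist on `(0,∞)²` and are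
continuous there. -/
def C1InXY (F : ℝ → ℝ → ℝ) : Prop :=
  (∀ x > 0, ∀ y > 0, DifferentiableAt ℝ (fun s => F s y) x ∧
    DifferentiableAt ℝ (fun s => F x s) y) ∧
  ContinuousOn (fun p : ℝ × ℝ => dX F p.1 p.2) (Ioi 0 ×ˢ Ioi 0) ∧
  ContinuousOn (fun p : ℝ × ℝ => dY F p.1 p.2) (Ioi 0 ×ˢ Ioi 0)

/-- Assumption B2, restricted to `θ = θ₀`. -/
def AssumptionB2 {d : ℕ} (R : (Fin d → ℝ) → ℝ≥0∞ → ℝ≥0∞ → ℝ≥0∞) (θ₀ : Fin d → ℝ) : Prop :=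
  C1InXY (tailFun (R θ₀)) ∧
  ∀ i : Fin d,
    (∀ x > 0, ∀ y > 0,
      DifferentiableAt ℝ (fun s => tailFun (R (Function.update θ₀ i s)) x y) (θ₀ i)) ∧
    ContinuousOn (fun p : ℝ × ℝ => dTheta (fun θ => tailFun (R θ)) θ₀ i p.1 p.2)
      (Ioi 0 ×ˢ Ioi 0)

/-- Assumption B4, restricted to `θ = θ₀`: the measures `R_θ` have densities `r_θ` for `θ` in
a neighbourhood of `θ₀`, `r_{θ₀}` has continuous partial derivatives in `x` and `y`, and the
partial derivatives of `r_θ` in the components of `θ` exist near `θ₀` and are continuous,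
as functions of `(x,y,θ)`, at all points with `θ = θ₀`. -/
def AssumptionB4 {d : ℕ} (Θ : Set (Fin d → ℝ))
    (μ : (Fin d → ℝ) → Measure (ℝ≥0∞ × ℝ≥0∞)) (r : (Fin d → ℝ) → ℝ → ℝ → ℝ)
    (θ₀ : Fin d → ℝ) : Prop :=
  C1InXY (r θ₀) ∧
  ∃ N ∈ 𝓝 θ₀, N ⊆ Θ ∧
    (∀ θ ∈ N, HasPositiveTailDensity (μ θ) (r θ)) ∧
    ∀ i : Fin d,
      (∀ θ ∈ N, ∀ x > 0, ∀ y > 0,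
        DifferentiableAt ℝ (fun s => r (Function.update θ i s) x y) (θ i)) ∧
      ∀ x > 0, ∀ y > 0,
        ContinuousAt (fun p : ℝ × ℝ × (Fin d → ℝ) => dTheta r p.2.2 i p.1 p.2.1) (x, y, θ₀)

/-! ### The functions `f`, `g`, `h` and the score functions -/

/-- The function `f_j` for extreme value index `γ`. -/
def fFun (γ x : ℝ) : ℝ :=
  if γ = 0 then x * Real.log x else x * (x ^ γ - 1) / γ

/-- The function `g_j` for extreme value index `γ`. -/
def gFun (γ x : ℝ) : ℝ := -x ^ (γ + 1)

/-- The function `h_j` for extreme value index `γ`. -/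
def hFun (γ x : ℝ) : ℝ :=
  if γ = 0 then -(x * Real.log x ^ 2) / 2
  else x * (1 - x ^ γ) / γ ^ 2 + x * Real.log x / γ

/-- The score functions `q₁, …, q₆` (index `Sum.inl`) and `q₇, …, q_{6+d}` (index `Sum.inr`). -/
def q {d : ℕ} (r : (Fin d → ℝ) → ℝ → ℝ → ℝ) (θ₀ : Fin d → ℝ) (γ : Fin 2 → ℝ) :
    Fin 6 ⊕ Fin d → ℝ → ℝ → ℝ :=
  let logr : (Fin d → ℝ) → ℝ → ℝ → ℝ := fun θ x y => Real.log (r θ x y)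
  Sum.elim
    ![fun x y => deriv (fFun (γ 0)) x + fFun (γ 0) x * dX (logr θ₀) x y,
      fun x y => deriv (gFun (γ 0)) x + gFun (γ 0) x * dX (logr θ₀) x y,
      fun x y => deriv (hFun (γ 0)) x + hFun (γ 0) x * dX (logr θ₀) x y,
      fun x y => deriv (fFun (γ 1)) y + fFun (γ 1) y * dY (logr θ₀) x y,
      fun x y => deriv (gFun (γ 1)) y + gFun (γ 1) y * dY (logr θ₀) x y,
      fun x y => deriv (hFun (γ 1)) y + hFun (γ 1) y * dY (logr θ₀) x y]
    (fun i x y => dTheta logr θ₀ i x y)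

/-- The matrix `I(t) = ∫_δ^T ∫_t^T q qᵀ dm`. -/
def infoMatrix {ι : Type*} (q : ι → ℝ → ℝ → ℝ) (m : Measure (ℝ × ℝ)) (δ T t : ℝ) :
    Matrix ι ι ℝ :=
  Matrix.of fun i j => ∫ p in Icc δ T ×ˢ Icc t T, q i p.1 p.2 * q j p.1 p.2 ∂m

/-! ### Processes -/

section Processes

variable {Ω : Type*} [MeasurableSpace Ω]

/-- `X` is, on the index set `S`, a Wiener process with time `τ`: a zero-mean Gaussian process
with covariance `E[X(x,y) X(x',y')] = τ(x ∧ x', y ∧ y')`. -/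
def IsWienerProcessOn (S : Set (ℝ × ℝ)) (τ : ℝ → ℝ → ℝ) (X : ℝ → ℝ → Ω → ℝ)
    (P : Measure Ω) : Prop :=
  IsGaussianProcess (fun (p : S) (ω : Ω) => X p.1.1 p.1.2 ω) P ∧
  (∀ p ∈ S, ∫ ω, X p.1 p.2 ω ∂P = 0) ∧
  ∀ p ∈ S, ∀ p' ∈ S,
    ∫ ω, X p.1 p.2 ω * X p'.1 p'.2 ω ∂P = τ (min p.1 p'.1) (min p.2 p'.2)

/-- The limiting process
`η̂ = V + R₍₁₎ (f₁ A₁ + g₁ B₁ + h₁ Γ₁) + R₍₂₎ (f₂ A₂ + g₂ B₂ + h₂ Γ₂) + Ṙᵀ ζ`. -/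
def etaHat {d : ℕ} (R : (Fin d → ℝ) → ℝ≥0∞ → ℝ≥0∞ → ℝ≥0∞) (θ₀ : Fin d → ℝ) (γ : Fin 2 → ℝ)
    (V : ℝ → ℝ → Ω → ℝ) (A B Γ : Fin 2 → Ω → ℝ) (ζ : Fin d → Ω → ℝ)
    (x y : ℝ) (ω : Ω) : ℝ :=
  V x y ω
    + dX (tailFun (R θ₀)) x y *
      (fFun (γ 0) x * A 0 ω + gFun (γ 0) x * B 0 ω + hFun (γ 0) x * Γ 0 ω)
    + dY (tailFun (R θ₀)) x y *
      (fFun (γ 1) y * A 1 ω + gFun (γ 1) y * B 1 ω + hFun (γ 1) y * Γ 1 ω)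
    + ∑ i, dTheta (fun θ => tailFun (R θ)) θ₀ i x y * ζ i ω

/-- The increment of `ξ` over the rectangle with corners `(a,c)` and `(b,e)`. -/
def rectIncr (ξ : ℝ → ℝ → Ω → ℝ) (a b c e : ℝ) (ω : Ω) : ℝ :=
  ξ b e ω - ξ a e ω - ξ b c ω + ξ a c ω

/-- `Y` is the stochastic integral `∫_a^b ∫_c^e φ dξ`: the limit in probability of the
Riemann–Stieltjes sums of `φ` with respect to the rectangle increments of `ξ`, over all tagged
grids `a = u₀ ≤ … ≤ u_n = b`, `c = v₀ ≤ … ≤ v_m = e`, as the mesh tends to zero. -/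
def IsStochasticIntegral (P : Measure Ω) (φ : ℝ → ℝ → ℝ) (ξ : ℝ → ℝ → Ω → ℝ)
    (a b c e : ℝ) (Y : Ω → ℝ) : Prop :=
  ∀ ε > 0, ∃ ρ > 0, ∀ (n m : ℕ) (u v : ℕ → ℝ) (s t : ℕ → ℕ → ℝ),
    u 0 = a → u n = b → v 0 = c → v m = e →
    (∀ i < n, u i ≤ u (i + 1) ∧ u (i + 1) - u i ≤ ρ) →
    (∀ j < m, v j ≤ v (j + 1) ∧ v (j + 1) - v j ≤ ρ) →
    (∀ i < n, ∀ j < m, s i j ∈ Icc (u i) (u (i + 1)) ∧ t i j ∈ Icc (v j) (v (j + 1))) →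
    P {ω | ε ≤ |(∑ i ∈ Finset.range n, ∑ j ∈ Finset.range m,
        φ (s i j) (t i j) * rectIncr ξ (u i) (u (i + 1)) (v j) (v (j + 1)) ω) - Y ω|}
      ≤ ENNReal.ofReal ε

/-- `J` is a jointly measurable version of the random vector-valued function
`t ↦ ∫_δ^T ∫_t^T q dξ`, `t ∈ [δ,T)`. -/
def IsTailIntegralVersion {ι : Type*} (P : Measure Ω) (q : ι → ℝ → ℝ → ℝ)
    (ξ : ℝ → ℝ → Ω → ℝ) (δ T : ℝ) (J : ℝ → Ω → ι → ℝ) : Prop :=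
  Measurable (fun p : ℝ × Ω => J p.1 p.2) ∧
  ∀ t ∈ Ico δ T, ∀ i, IsStochasticIntegral P (q i) ξ δ T t T (fun ω => J t ω i)

/-- The integrand `qᵀ(s,t) I⁻¹(t) ∫_δ^T ∫_t^T q dξ` of the compensator, where `J` stands for
the inner stochastic integral. -/
def compensatorIntegrand {ι : Type*} [Fintype ι] [DecidableEq ι] (q : ι → ℝ → ℝ → ℝ)
    (m : Measure (ℝ × ℝ)) (δ T : ℝ) (J : ℝ → Ω → ι → ℝ) (ω : Ω) (p : ℝ × ℝ) : ℝ :=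
  (fun i => q i p.1 p.2) ⬝ᵥ ((infoMatrix q m δ T p.2)⁻¹ *ᵥ J p.2 ω)

/-- The transformed process
`W([δ,x]×[δ,y]) = ξ([δ,x]×[δ,y]) - ∫_δ^x ∫_δ^y qᵀ(s,t) (I⁻¹(t) ∫_δ^T ∫_t^T q dξ) dm(s,t)`. -/
def transformed {ι : Type*} [Fintype ι] [DecidableEq ι] (q : ι → ℝ → ℝ → ℝ)
    (m : Measure (ℝ × ℝ)) (δ T : ℝ) (ξ : ℝ → ℝ → Ω → ℝ) (J : ℝ → Ω → ι → ℝ)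
    (x y : ℝ) (ω : Ω) : ℝ :=
  rectIncr ξ δ x δ y ω
    - ∫ p in Icc δ x ×ˢ Icc δ y, compensatorIntegrand q m δ T J ω p ∂m

end Processes

end TailGoF

end

/-!
The process `η̂` is `V` plus a random linear combination of drifts. The scores `q k` are exactly the
densities, with respect to `R_θ₀`, of the rectangle increments of these drifts
(`driftFun_increment`; for the first six this is the fundamental theorem of calculus in one
variable, for the last `d` differentiation under the integral sign). So over every rectangle
`η̂(D) = V(D) + ∑ k, Z k * ∫_D q k dR` with random variables `Z k` about which nothing more than
measurability is known, and the statement is one about the finite measure `ν`, the restriction of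
`R_θ₀` to `[δ,T]²`, which charges no horizontal or vertical line
(`isWienerProcessOn_transformed`).

The increments of `V` extend to a linear isometry `W : L²(ν) → L²(P)` with Gaussian values
(`exists_wienerIntegral`). The Riemann–Stieltjes sums of `q` against `η̂` are `W` of step functions
plus `∑ k, Z k` times their integrals against `q k`; these step functions converge in `L²(ν)`, so
that the stochastic integral over `[δ,T] × [t,T]` exists and equals `W(q 1_{v ≥ t}) + I(t) Z`
(`isStochasticIntegral_limitIntegral`). A jointly measurable version is an almost sure limit of
step functions in `t` (`exists_measurable_version`).

Multiplication by `qᵀ(s,t) I⁻¹(t)` turns the second summand into `qᵀ(s,t) Z`, whose integral over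
`[δ,x] × [δ,y]` is the drift of `η̂` over that rectangle: the drift cancels. A stochastic Fubini
theorem (`stochastic_fubini`) moves the remaining outer integral inside `W`, and the transformed
process at the set `A` is almost surely `W(L 1_A)` (`transformed_ae_eq`), where
`L 1_A (p) = 1_A(p) - ∫_A κ(a,p) dν(a)` and `κ(a,p) = qᵀ(a) I⁻¹(a₂) q(p) 1_{p₂ ≥ a₂}`. This
gives a centred Gaussian process. Finally `∫ κ(a,p) κ(b,p) dν(p)` is
`qᵀ(a) I⁻¹(a₂) I(a₂ ∨ b₂) I⁻¹(b₂) q(b) = κ(a,b) + κ(b,a)` unless `a₂ = b₂`, a null event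
(`integral_transformKernel_mul`), and hence `⟨L 1_A, L 1_B⟩ = ν(A ∩ B)`
(`integral_transformedIndicator_mul`), the covariance of a Wiener process with time `ν`.

The matrices `I(t)` degenerate as `t → T`. For rectangles below the level `y₀ < T` the weight
`qᵀ I⁻¹` is therefore frozen above `y₀` (`weight`), which makes it bounded and changes
nothing on these rectangles; likewise the scores are extended to bounded continuous functions on
the plane by projecting onto the square (`clampSquare`).
-/

noncomputable section

namespace TailGoF

/-! ### The Wiener integral -/

/-- A map with the same Gram matrix as a family spanning a dense subspace extends to an isometry. -/
theorem exists_linearIsometry_of_inner_eq {S H G : Type*} [NormedAddCommGroup H]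
    [InnerProductSpace ℝ H] [NormedAddCommGroup G] [InnerProductSpace ℝ G] [CompleteSpace G]
    (a : S → H) (b : S → G) (hab : ∀ s s', inner ℝ (a s) (a s') = inner ℝ (b s) (b s'))
    (ha : Dense (Submodule.span ℝ (range a) : Set H)) :
    ∃ W : H →ₗᵢ[ℝ] G, ∀ s, W (a s) = b s := by
  set A := Finsupp.linearCombination ℝ a
  set B := Finsupp.linearCombination ℝ b
  have hinner : ∀ x y, inner ℝ (B x) (B y) = inner ℝ (A x) (A y) := by
    intro x y
    simp only [A, B, Finsupp.linearCombination_apply, Finsupp.sum_inner, Finsupp.inner_sum,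
      inner_smul_left, inner_smul_right, hab]
  have hnorm : ∀ x, ‖B x‖ = ‖A x‖ := by
    intro x
    have h1 := real_inner_self_eq_norm_sq (B x)
    have h2 := real_inner_self_eq_norm_sq (A x)
    rw [hinner, h2] at h1
    exact ((sq_eq_sq₀ (norm_nonneg _) (norm_nonneg _)).1 h1).symm
  have hA : DenseRange A := by
    have : range A = (Submodule.span ℝ (range a) : Set H) := by
      rw [← Finsupp.range_linearCombination ℝ (v := a)]; rfl
    rw [DenseRange, this]; exact ha
  have hC : ∃ C, ∀ x, ‖B x‖ ≤ C * ‖A x‖ := ⟨1, fun x => by rw [hnorm, one_mul]⟩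
  have hext : ∀ x, (B.extendOfNorm A) (A x) = B x := LinearMap.extendOfNorm_eq hA hC
  refine ⟨⟨(B.extendOfNorm A).toLinearMap, fun φ => ?_⟩, fun s => ?_⟩
  · refine hA.induction_on (p := fun φ => ‖(B.extendOfNorm A) φ‖ = ‖φ‖) φ ?_ ?_
    · exact isClosed_eq (by fun_prop) (by fun_prop)
    · intro x; rw [hext, hnorm]
  · have := hext (Finsupp.single s 1)
    simpa [A, B] using this

theorem integral_abs_le_norm {α : Type*} [MeasurableSpace α] {P : Measure α}
    [IsProbabilityMeasure P] (f : Lp ℝ 2 P) : ∫ ω, |f ω| ∂P ≤ ‖f‖ := by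
  have h := eLpNorm_le_eLpNorm_of_exponent_le (μ := P) (p := 1) (q := 2) (by norm_num)
    (Lp.aestronglyMeasurable f)
  rw [Lp.norm_def]
  have h2 : ∫ ω, |f ω| ∂P = (eLpNorm f 1 P).toReal := by
    rw [eLpNorm_one_eq_lintegral_enorm, ← integral_norm_eq_lintegral_enorm
      (Lp.aestronglyMeasurable f)]
    simp
  rw [h2]
  exact ENNReal.toReal_mono (Lp.eLpNorm_ne_top f) h

theorem norm_integral_cexp_sub_le {α : Type*} [MeasurableSpace α] {P : Measure α}
    [IsProbabilityMeasure P] (f g : Lp ℝ 2 P) (t : ℝ) :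
    ‖∫ ω, Complex.exp (t * f ω * Complex.I) ∂P - ∫ ω, Complex.exp (t * g ω * Complex.I) ∂P‖
      ≤ |t| * ‖f - g‖ := by
  have hint : ∀ f : Lp ℝ 2 P, Integrable (fun ω => Complex.exp (t * f ω * Complex.I)) P := by
    intro f
    refine Integrable.of_bound (C := 1) ?_ (Eventually.of_forall fun ω => ?_)
    · have := (Lp.aestronglyMeasurable f).aemeasurable
      exact AEMeasurable.aestronglyMeasurable (by fun_prop)
    · have := Complex.norm_exp_ofReal_mul_I (t * f ω)
      push_cast at this
      exact this.le
  rw [← integral_sub (hint f) (hint g)]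
  calc _ ≤ ∫ ω, |t| * |(f - g : Lp ℝ 2 P) ω| ∂P := by
        refine norm_integral_le_of_norm_le ?_ ?_
        · exact ((Lp.memLp (f - g)).integrable (by norm_num)).abs.const_mul _
        · filter_upwards [Lp.coeFn_sub f g] with ω hω
          have e : Complex.exp (t * f ω * Complex.I) - Complex.exp (t * g ω * Complex.I)
              = Complex.exp (((t * g ω : ℝ) : ℂ) * Complex.I) *
                (Complex.exp (Complex.I * ((t * (f ω - g ω) : ℝ) : ℂ)) - 1) := by
            rw [mul_sub, ← Complex.exp_add]
            push_cast
            ring_nf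
          rw [e, norm_mul, Complex.norm_exp_ofReal_mul_I, one_mul, hω]
          refine (Real.norm_exp_I_mul_ofReal_sub_one_le).trans ?_
          rw [Real.norm_eq_abs, abs_mul, Pi.sub_apply]
    _ = |t| * ∫ ω, |(f - g : Lp ℝ 2 P) ω| ∂P := integral_const_mul _ _
    _ ≤ _ := by gcongr; exact integral_abs_le_norm _

/-- An isometry into `L²(P)` that is centred Gaussian on a spanning family of a dense subspace
is centred Gaussian everywhere, because the characteristic functions pass to the limit. -/
theorem isGaussianProcess_of_dense {S H Ω : Type*} [NormedAddCommGroup H]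
    [InnerProductSpace ℝ H] [MeasurableSpace Ω] {P : Measure Ω} [IsProbabilityMeasure P]
    (W : H →ₗᵢ[ℝ] Lp ℝ 2 P) (a : S → H) (ha : Dense (Submodule.span ℝ (range a) : Set H))
    (hG : IsGaussianProcess (fun s ω => W (a s) ω) P) (h0 : ∀ s, ∫ ω, W (a s) ω ∂P = 0) :
    IsGaussianProcess (fun φ ω => W φ ω) P ∧ ∀ φ, ∫ ω, W φ ω ∂P = 0 := by
  classical
  have hae : ∀ φ, AEMeasurable (W φ) P := fun φ => (Lp.aestronglyMeasurable _).aemeasurable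
  have hmem : ∀ φ, MemLp (W φ) 2 P := fun φ => Lp.memLp _
  have hspan : ∀ φ ∈ Submodule.span ℝ (range a),
      HasGaussianLaw (fun ω => W φ ω) P ∧ ∫ ω, W φ ω ∂P = 0 := by
    intro φ hφ
    rw [← Finsupp.range_linearCombination ℝ (v := a)] at hφ
    obtain ⟨x, rfl⟩ := hφ
    have e : (fun ω => W (Finsupp.linearCombination ℝ a x) ω) =ᵐ[P]
        fun ω => ∑ s ∈ x.support, x s * W (a s) ω := by
      rw [Finsupp.linearCombination_apply, Finsupp.sum, map_sum]
      have h1 := Lp.coeFn_finsetSum x.support (fun s => W (x s • a s))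
      have h2 : ∀ s ∈ x.support, ∀ᵐ ω ∂P, W (x s • a s) ω = x s * W (a s) ω := by
        intro s _
        rw [map_smul]
        filter_upwards [Lp.coeFn_smul (x s) (W (a s))] with ω hω
        rw [hω]; rfl
      rw [← Finset.eventually_all] at h2
      filter_upwards [h1, h2] with ω h1 h2
      rw [h1, Finset.sum_apply]
      exact Finset.sum_congr rfl h2
    constructor
    · exact ((hG.smul x).hasGaussianLaw_fun_sum (I := x.support)).congr e.symm
    · rw [integral_congr_ae e, integral_finsetSum]
      · simp [integral_const_mul, h0]
      · intro s _
        exact ((hmem _).integrable (by norm_num)).const_mul _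
  have hchar : ∀ φ, ∀ t : ℝ, charFun (P.map (W φ)) t
      = Complex.exp (-(‖φ‖ ^ 2 * t ^ 2 / 2 : ℝ)) := by
    intro φ t
    have hform : ∀ φ, charFun (P.map (W φ)) t = ∫ ω, Complex.exp (t * W φ ω * Complex.I) ∂P := by
      intro φ
      rw [charFun_apply_real, integral_map (hae φ)]
      exact (by fun_prop)
    refine ha.induction (P := fun φ => charFun (P.map (W φ)) t
      = Complex.exp (-(‖φ‖ ^ 2 * t ^ 2 / 2 : ℝ))) ?_ ?_ φ
    · intro φ hφ
      obtain ⟨h1, h2⟩ := hspan φ hφ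
      have hm := h1.map_eq_gaussianReal
      rw [show P.map (W φ) = P.map (fun ω => W φ ω) from rfl, hm, charFun_gaussianReal, h2]
      have hvar : Var[fun ω => W φ ω; P] = ‖φ‖ ^ 2 := by
        rw [variance_eq_integral (hae φ)]
        rw [h2, ← W.norm_map φ, ← real_inner_self_eq_norm_sq, L2.inner_def]
        refine integral_congr_ae (Eventually.of_forall fun ω => ?_)
        simp [sq]
      rw [hvar, Real.coe_toNNReal _ (sq_nonneg _)]
      push_cast
      congr 1
      ring
    · refine isClosed_eq ?_ (by fun_prop)
      simp_rw [hform]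
      rw [Metric.continuous_iff]
      intro φ ε hε
      refine ⟨ε / (|t| + 1), by positivity, fun ψ hψ => ?_⟩
      rw [dist_eq_norm] at hψ ⊢
      refine (norm_integral_cexp_sub_le _ _ t).trans_lt ?_
      rw [← map_sub, W.norm_map]
      rw [lt_div_iff₀ (by positivity)] at hψ
      nlinarith [norm_nonneg (ψ - φ)]
  -- The variance of `W φ` is `‖φ‖²`, so both sides have the same characteristic function.
  have hmap : ∀ φ, P.map (W φ) = gaussianReal 0 (‖φ‖ ^ 2).toNNReal := by
    intro φ
    have := Measure.isProbabilityMeasure_map (hae φ)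
    refine Measure.ext_of_charFun (funext fun t => ?_)
    rw [hchar, charFun_gaussianReal, Real.coe_toNNReal _ (sq_nonneg _)]
    push_cast
    congr 1
    ring
  have hgauss : ∀ φ, HasGaussianLaw (W φ) P := fun φ => ⟨by rw [hmap]; infer_instance⟩
  refine ⟨⟨fun I => ?_⟩, fun φ => ?_⟩
  · have hXae : AEMeasurable (fun ω => I.restrict (fun φ => W φ ω)) P :=
      aemeasurable_pi_lambda _ fun i => hae i
    rw [hasGaussianLaw_iff_charFunDual_map_eq hXae]
    intro L
    -- A linear functional of finitely many values of `W` is again a value of `W`.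
    have e : L ∘ (fun ω => I.restrict (fun φ => W φ ω))
        =ᵐ[P] W (∑ i : I, L (Pi.single i 1) • (i : H)) := by
      have h1 := Lp.coeFn_finsetSum Finset.univ (fun i : I => W (L (Pi.single i 1) • (i : H)))
      have h2 : ∀ᵐ ω ∂P, ∀ i : I, W (L (Pi.single i 1) • (i : H)) ω
          = L (Pi.single i 1) * W (i : H) ω := by
        rw [eventually_all]
        intro i
        rw [map_smul]
        filter_upwards [Lp.coeFn_smul (L (Pi.single i 1)) (W (i : H))] with ω hω
        rw [hω]; rfl
      rw [map_sum]
      filter_upwards [h1, h2] with ω h1 h2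
      rw [h1, Finset.sum_apply, Finset.sum_congr rfl (fun i _ => h2 i)]
      have hx : (I.restrict (fun φ => W φ ω))
          = ∑ i : I, (W (i : H) ω) • (Pi.single i (1 : ℝ) : I → ℝ) := by
        ext j
        simp [Finset.sum_apply, Pi.single_apply]
      rw [Function.comp_apply, hx, map_sum]
      refine Finset.sum_congr rfl fun i _ => ?_
      rw [map_smul, smul_eq_mul, mul_comm]
    have hL : HasGaussianLaw (L ∘ (fun ω => I.restrict (fun φ => W φ ω))) P :=
      (hgauss _).congr e.symm
    have h3 := hL.charFun_map_eq 1
    rw [charFunDual_eq_charFun_map_one, AEMeasurable.map_map_of_aemeasurable (by fun_prop) hXae, h3]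
    simp [Function.comp_def]
  · have h := (hgauss φ).map_eq_gaussianReal
    have h2 : ∫ x, x ∂(P.map (W φ)) = 0 := by rw [hmap]; simp
    rw [← h2, integral_map (hae φ) (by fun_prop)]

/-- The boxes with corner `(δ,δ)` form a π-system that generates the Borel sets up to null sets of
a measure living on the square. -/
theorem setIntegral_eq_zero_of_boxes {ν : Measure (ℝ × ℝ)} {δ T : ℝ} (hδT : δ ≤ T)
    (hν : ν (Icc δ T ×ˢ Icc δ T)ᶜ = 0) {g : ℝ × ℝ → ℝ} (hg : Integrable g ν)
    (h : ∀ x ∈ Icc δ T, ∀ y ∈ Icc δ T, ∫ p in Icc δ x ×ˢ Icc δ y, g p ∂ν = 0)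
    (s : Set (ℝ × ℝ)) (hs : MeasurableSet s) : ∫ p in s, g p ∂ν = 0 := by
  have hae : ∀ᵐ p ∂ν, p ∈ Icc δ T ×ˢ Icc δ T := hν
  have huniv : ∫ p, g p ∂ν = 0 := by
    rw [← h T ⟨hδT, le_rfl⟩ T ⟨hδT, le_rfl⟩, Measure.restrict_eq_self_of_ae_mem hae]
  have hgen : (Prod.instMeasurableSpace : MeasurableSpace (ℝ × ℝ)) = MeasurableSpace.generateFrom
      (image2 (· ×ˢ ·) (range (Iic : ℝ → Set ℝ)) (range (Iic : ℝ → Set ℝ))) := by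
    have hsp : IsCountablySpanning (range (Iic : ℝ → Set ℝ)) :=
      ⟨fun n => Iic (n : ℝ), fun n => mem_range_self _, by
        rw [eq_univ_iff_forall]; intro x
        obtain ⟨n, hn⟩ := exists_nat_ge x
        exact mem_iUnion.2 ⟨n, hn⟩⟩
    rw [← generateFrom_prod_eq hsp hsp, ← borel_eq_generateFrom_Iic,
      ← (BorelSpace.measurable_eq : (inferInstance : MeasurableSpace ℝ) = borel ℝ)]
  refine MeasurableSpace.induction_on_inter (C := fun s _ => ∫ p in s, g p ∂ν = 0)
    hgen (isPiSystem_Iic.prod isPiSystem_Iic) (by simp) ?_ ?_ ?_ s hs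
  · rintro _ ⟨_, ⟨x, rfl⟩, _, ⟨y, rfl⟩, rfl⟩
    have hempty : (∀ p ∈ Icc δ T ×ˢ Icc δ T, p ∉ Iic x ×ˢ Iic y) →
        ∫ p in Iic x ×ˢ Iic y, g p ∂ν = 0 := by
      intro hq
      rw [← setIntegral_empty (f := g) (μ := ν)]
      refine setIntegral_congr_set ?_
      filter_upwards [hae] with p hp
      exact propext ⟨fun hp' => hq p hp hp', fun hp' => hp'.elim⟩
    by_cases hx : δ ≤ x
    · by_cases hy : δ ≤ y
      · rw [← h (min x T) ⟨le_min hx hδT, min_le_right _ _⟩ (min y T)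
          ⟨le_min hy hδT, min_le_right _ _⟩]
        refine setIntegral_congr_set ?_
        filter_upwards [hae] with p hp
        obtain ⟨⟨h1, h2⟩, h3, h4⟩ := hp
        refine propext ⟨fun hq => ⟨⟨h1, le_min hq.1 h2⟩, h3, le_min hq.2 h4⟩, fun hq =>
          ⟨hq.1.2.trans (min_le_left _ _), hq.2.2.trans (min_le_left _ _)⟩⟩
      · exact hempty fun p hp hq => hy (hp.2.1.trans hq.2)
    · exact hempty fun p hp hq => hx (hp.1.1.trans hq.1)
  · intro t htm ih
    have := integral_add_compl htm hg
    rwa [ih, huniv, zero_add] at this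
  · intro f hd hm ih
    rw [integral_iUnion hm hd hg.integrableOn]
    simp [ih]

/-- The indicator of `[δ,x] × [δ,y]` as an element of `L²(ν)`. -/
def boxLp (ν : Measure (ℝ × ℝ)) [IsFiniteMeasure ν] (δ : ℝ) (p : ℝ × ℝ) : Lp ℝ 2 ν :=
  indicatorConstLp 2 (measurableSet_Icc.prod measurableSet_Icc : MeasurableSet
    (Icc δ p.1 ×ˢ Icc δ p.2)) (measure_ne_top _ _) 1

/-- A function orthogonal to the indicators of all boxes has vanishing integral over every Borel
set. -/
theorem dense_span_boxLp {ν : Measure (ℝ × ℝ)} [IsFiniteMeasure ν] {δ T : ℝ} (hδT : δ ≤ T)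
    (hν : ν (Icc δ T ×ˢ Icc δ T)ᶜ = 0) :
    Dense (Submodule.span ℝ (range fun p : (Icc δ T ×ˢ Icc δ T : Set (ℝ × ℝ)) =>
      boxLp ν δ p) : Set (Lp ℝ 2 ν)) := by
  rw [Submodule.dense_iff_topologicalClosure_eq_top, Submodule.topologicalClosure_eq_top_iff,
    Submodule.eq_bot_iff]
  intro g hg
  rw [Submodule.mem_orthogonal] at hg
  have hint : Integrable g ν := (Lp.memLp g).integrable (by norm_num)
  have h0 : ∀ x ∈ Icc δ T, ∀ y ∈ Icc δ T, ∫ p in Icc δ x ×ˢ Icc δ y, g p ∂ν = 0 := by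
    intro x hx y hy
    have : inner ℝ (boxLp ν δ (x, y)) g = 0 :=
      hg _ (Submodule.subset_span ⟨⟨(x, y), ⟨hx, hy⟩⟩, rfl⟩)
    rwa [boxLp, L2.inner_indicatorConstLp_one] at this
  have := hint.ae_eq_zero_of_forall_setIntegral_eq_zero fun s hs _ =>
    setIntegral_eq_zero_of_boxes hδT hν hint h0 s hs
  exact (Lp.eq_zero_iff_ae_eq_zero).2 this

section

variable {Ω : Type*} [MeasurableSpace Ω]

/-- The increments of a Gaussian sheet with covariance `τ(x ∧ x', y ∧ y')` are isometric to the
indicators of boxes, which gives the Wiener integral `L²(ν) → L²(P)`. -/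
theorem exists_wienerIntegral {ν : Measure (ℝ × ℝ)} [IsFiniteMeasure ν] {δ T : ℝ} (hδT : δ ≤ T)
    (hν : ν (Icc δ T ×ˢ Icc δ T)ᶜ = 0) {τ : ℝ → ℝ → ℝ}
    (hτ : ∀ x ∈ Icc δ T, ∀ y ∈ Icc δ T,
      ν.real (Icc δ x ×ˢ Icc δ y) = τ x y - τ δ y - τ x δ + τ δ δ)
    {P : Measure Ω} [IsProbabilityMeasure P] {V : ℝ → ℝ → Ω → ℝ}
    (hV : IsWienerProcessOn (Icc δ T ×ˢ Icc δ T) τ V P) :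
    ∃ W : Lp ℝ 2 ν →ₗᵢ[ℝ] Lp ℝ 2 P,
      (∀ x ∈ Icc δ T, ∀ y ∈ Icc δ T, W (boxLp ν δ (x, y)) =ᵐ[P] rectIncr V δ x δ y) ∧
      IsGaussianProcess (fun φ ω => W φ ω) P ∧ ∀ φ, ∫ ω, W φ ω ∂P = 0 := by
  classical
  set S : Set (ℝ × ℝ) := Icc δ T ×ˢ Icc δ T with hS
  obtain ⟨hVG, hV0, hVc⟩ := hV
  have hδm : δ ∈ Icc δ T := ⟨le_rfl, hδT⟩
  have hVL : ∀ x ∈ Icc δ T, ∀ y ∈ Icc δ T, MemLp (V x y) 2 P := fun x hx y hy =>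
    (hVG.hasGaussianLaw_eval ⟨(x, y), hx, hy⟩).memLp_two
  have hrL : ∀ p : S, MemLp (rectIncr V δ p.1.1 δ p.1.2) 2 P := by
    rintro ⟨⟨x, y⟩, hx, hy⟩
    exact (((hVL x hx y hy).sub (hVL δ hδm y hy)).sub (hVL x hx δ hδm)).add (hVL δ hδm δ hδm)
  have hrG : IsGaussianProcess (fun (p : S) ω => rectIncr V δ p.1.1 δ p.1.2 ω) P := by
    refine hVG.of_isGaussianProcess ?_
    rintro ⟨⟨x, y⟩, hx, hy⟩
    let p1 : S := ⟨(x, y), hx, hy⟩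
    let p2 : S := ⟨(δ, y), hδm, hy⟩
    let p3 : S := ⟨(x, δ), hx, hδm⟩
    let p4 : S := ⟨(δ, δ), hδm, hδm⟩
    let I : Finset S := {p1, p2, p3, p4}
    refine ⟨I, ContinuousLinearMap.proj (R := ℝ) (φ := fun _ : I => ℝ) ⟨p1, by simp [I]⟩
      - ContinuousLinearMap.proj (R := ℝ) (φ := fun _ : I => ℝ) ⟨p2, by simp [I]⟩
      - ContinuousLinearMap.proj (R := ℝ) (φ := fun _ : I => ℝ) ⟨p3, by simp [I]⟩
      + ContinuousLinearMap.proj (R := ℝ) (φ := fun _ : I => ℝ) ⟨p4, by simp [I]⟩, fun ω => ?_⟩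
    rfl
  have hr0 : ∀ p : S, ∫ ω, rectIncr V δ p.1.1 δ p.1.2 ω ∂P = 0 := by
    rintro ⟨⟨x, y⟩, hx, hy⟩
    have hi : ∀ x ∈ Icc δ T, ∀ y ∈ Icc δ T, Integrable (V x y) P := fun x hx y hy =>
      (hVL x hx y hy).integrable (by norm_num)
    simp only [rectIncr]
    rw [integral_add, integral_sub, integral_sub, hV0 (x, y) ⟨hx, hy⟩, hV0 (δ, y) ⟨hδm, hy⟩,
      hV0 (x, δ) ⟨hx, hδm⟩, hV0 (δ, δ) ⟨hδm, hδm⟩]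
    · simp
    · exact hi _ hx _ hy
    · exact hi _ hδm _ hy
    · exact (hi _ hx _ hy).sub (hi _ hδm _ hy)
    · exact hi _ hx _ hδm
    · exact ((hi _ hx _ hy).sub (hi _ hδm _ hy)).sub (hi _ hx _ hδm)
    · exact hi _ hδm _ hδm
  have hinner : ∀ p p' : S, inner ℝ (boxLp ν δ p) (boxLp ν δ p')
      = inner ℝ (hrL p).toLp (hrL p').toLp := by
    rintro ⟨⟨x, y⟩, hx, hy⟩ ⟨⟨x', y'⟩, hx', hy'⟩
    change x ∈ Icc δ T at hx
    change y ∈ Icc δ T at hy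
    change x' ∈ Icc δ T at hx'
    change y' ∈ Icc δ T at hy'
    have hb : inner ℝ (boxLp ν δ (x, y)) (boxLp ν δ (x', y'))
        = ν.real (Icc δ (min x x') ×ˢ Icc δ (min y y')) := by
      rw [boxLp, boxLp, L2.inner_indicatorConstLp_one,
        setIntegral_congr_ae (g := (Icc δ x' ×ˢ Icc δ y').indicator fun _ => (1 : ℝ))
          (measurableSet_Icc.prod measurableSet_Icc)]
      · rw [setIntegral_indicator (measurableSet_Icc.prod measurableSet_Icc), setIntegral_const,
          prod_inter_prod, Icc_inter_Icc, Icc_inter_Icc]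
        simp
      · filter_upwards [indicatorConstLp_coeFn (p := 2) (μ := ν)
          (hs := measurableSet_Icc.prod measurableSet_Icc)
          (hμs := measure_ne_top ν (Icc δ x' ×ˢ Icc δ y')) (c := (1 : ℝ))] with p hp _
        exact hp
    have hmix : ∀ a b a' b' (h : MemLp (V a b) 2 P) (h' : MemLp (V a' b') 2 P), a ∈ Icc δ T →
        b ∈ Icc δ T → a' ∈ Icc δ T → b' ∈ Icc δ T →
        inner ℝ h.toLp h'.toLp = τ (min a a') (min b b') := by
      intro a b a' b' h h' ha hb ha' hb'
      rw [L2.inner_def, ← hVc (a, b) ⟨ha, hb⟩ (a', b') ⟨ha', hb'⟩]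
      refine integral_congr_ae ?_
      filter_upwards [h.coeFn_toLp, h'.coeFn_toLp] with ω h1 h2
      rw [h1, h2]; simp [mul_comm]
    have hdec : ∀ x (hx : x ∈ Icc δ T) y (hy : y ∈ Icc δ T),
        (hrL ⟨(x, y), hx, hy⟩).toLp = (hVL x hx y hy).toLp - (hVL δ hδm y hy).toLp
          - (hVL x hx δ hδm).toLp + (hVL δ hδm δ hδm).toLp := by
      intro x hx y hy; rfl
    rw [hdec x hx y hy, hdec x' hx' y' hy']
    simp only [inner_add_left, inner_add_right, inner_sub_left, inner_sub_right]
    rw [hb, hτ _ ⟨le_min hx.1 hx'.1, (min_le_left _ _).trans hx.2⟩ _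
      ⟨le_min hy.1 hy'.1, (min_le_left _ _).trans hy.2⟩]
    simp only [hmix, hx, hy, hx', hy', hδm,
      min_eq_left hx'.1, min_eq_left hy'.1, min_eq_right hx.1, min_eq_right hy.1, min_self]
    ring
  have hd := dense_span_boxLp hδT hν
  obtain ⟨W, hW⟩ := exists_linearIsometry_of_inner_eq (fun p : S => boxLp ν δ p)
    (fun p : S => (hrL p).toLp) hinner hd
  have hWae : ∀ p : S, W (boxLp ν δ p) =ᵐ[P] rectIncr V δ p.1.1 δ p.1.2 := fun p => by
    rw [hW p]; exact (hrL p).coeFn_toLp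
  refine ⟨W, fun x hx y hy => hWae ⟨(x, y), hx, hy⟩, ?_⟩
  refine isGaussianProcess_of_dense W (fun p : S => boxLp ν δ p) hd
    (hrG.congr fun p => (hWae p).symm) fun p => ?_
  rw [integral_congr_ae (hWae p), hr0]

/-! ### Riemann–Stieltjes sums -/

theorem memLp_two_of_bound {α : Type*} [MeasurableSpace α] {ν : Measure α} [IsFiniteMeasure ν]
    {f : α → ℝ} (hf : Measurable f) {C : ℝ} (hC : ∀ p, |f p| ≤ C) : MemLp f 2 ν :=
  MemLp.of_bound hf.aestronglyMeasurable C (Eventually.of_forall hC)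

/-- The step function whose integral is a Riemann–Stieltjes sum of `φ` over the grid `u`, `v`
with tags `s`, `t`. -/
def stepFun (φ : ℝ × ℝ → ℝ) (n m : ℕ) (u v : ℕ → ℝ) (s t : ℕ → ℕ → ℝ) (p : ℝ × ℝ) : ℝ :=
  ∑ i ∈ Finset.range n, ∑ j ∈ Finset.range m, φ (s i j, t i j) *
    (Ioc (u i) (u (i + 1)) ×ˢ Ioc (v j) (v (j + 1))).indicator 1 p

theorem measurable_stepFun (φ : ℝ × ℝ → ℝ) (n m : ℕ) (u v : ℕ → ℝ) (s t : ℕ → ℕ → ℝ) :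
    Measurable (stepFun φ n m u v s t) := by
  unfold stepFun
  refine Finset.measurable_sum _ fun i _ => Finset.measurable_sum _ fun j _ => ?_
  exact (measurable_one.indicator (measurableSet_Ioc.prod measurableSet_Ioc)).const_mul _

theorem indicator_Ioc_eq_sub {a b : ℝ} (hab : a ≤ b) (x : ℝ) :
    (Ioc a b).indicator (1 : ℝ → ℝ) x
      = (Iic b).indicator (1 : ℝ → ℝ) x - (Iic a).indicator (1 : ℝ → ℝ) x := by
  simp only [indicator_apply, mem_Ioc, mem_Iic, Pi.one_apply]
  split_ifs <;> grind

theorem sum_indicator_Ioc {n : ℕ} {u : ℕ → ℝ} (hu : ∀ i < n, u i ≤ u (i + 1)) (x : ℝ) :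
    ∑ i ∈ Finset.range n, (Ioc (u i) (u (i + 1))).indicator (1 : ℝ → ℝ) x
      = (Ioc (u 0) (u n)).indicator (1 : ℝ → ℝ) x := by
  have hmono : ∀ k ≤ n, u 0 ≤ u k := by
    intro k hk
    induction k with
    | zero => exact le_rfl
    | succ k ih => exact (ih (by omega)).trans (hu k (by omega))
  rw [indicator_Ioc_eq_sub (hmono n le_rfl), ← Finset.sum_range_sub
    (fun i => (Iic (u i)).indicator (1 : ℝ → ℝ) x)]
  exact Finset.sum_congr rfl fun i hi => indicator_Ioc_eq_sub (hu i (Finset.mem_range.1 hi)) x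

theorem indicator_prod_one (A B : Set ℝ) (p : ℝ × ℝ) :
    (A ×ˢ B).indicator (1 : ℝ × ℝ → ℝ) p
      = A.indicator (1 : ℝ → ℝ) p.1 * B.indicator (1 : ℝ → ℝ) p.2 := by
  by_cases h1 : p.1 ∈ A <;> by_cases h2 : p.2 ∈ B <;> simp [indicator, mem_prod, h1, h2]

/-- Only one cell contains a given point, so the error is the oscillation of `φ` over one cell. -/
theorem abs_stepFun_sub_le {φ : ℝ × ℝ → ℝ} {n m : ℕ} {u v : ℕ → ℝ} {s t : ℕ → ℕ → ℝ} {ρ ε : ℝ}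
    (hε : 0 ≤ ε) (hφ : ∀ p p' : ℝ × ℝ, |p.1 - p'.1| ≤ ρ → |p.2 - p'.2| ≤ ρ → |φ p - φ p'| ≤ ε)
    (hu : ∀ i < n, u i ≤ u (i + 1) ∧ u (i + 1) - u i ≤ ρ)
    (hv : ∀ j < m, v j ≤ v (j + 1) ∧ v (j + 1) - v j ≤ ρ)
    (hst : ∀ i < n, ∀ j < m, s i j ∈ Icc (u i) (u (i + 1)) ∧ t i j ∈ Icc (v j) (v (j + 1)))
    (p : ℝ × ℝ) :
    |stepFun φ n m u v s t p - (Ioc (u 0) (u n) ×ˢ Ioc (v 0) (v m)).indicator φ p| ≤ ε := by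
  have hone : ∑ i ∈ Finset.range n, ∑ j ∈ Finset.range m,
      (Ioc (u i) (u (i + 1)) ×ˢ Ioc (v j) (v (j + 1))).indicator (1 : ℝ × ℝ → ℝ) p
      = (Ioc (u 0) (u n) ×ˢ Ioc (v 0) (v m)).indicator (1 : ℝ × ℝ → ℝ) p := by
    simp only [indicator_prod_one]
    rw [← sum_indicator_Ioc (fun i hi => (hu i hi).1), ← sum_indicator_Ioc (fun i hi => (hv i hi).1),
      Finset.sum_mul_sum]
  have hind : (Ioc (u 0) (u n) ×ˢ Ioc (v 0) (v m)).indicator φ p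
      = φ p * (Ioc (u 0) (u n) ×ˢ Ioc (v 0) (v m)).indicator (1 : ℝ × ℝ → ℝ) p := by
    simp [indicator_apply]
  rw [hind, ← hone, stepFun, Finset.mul_sum, ← Finset.sum_sub_distrib]
  calc _ ≤ ∑ i ∈ Finset.range n, ∑ j ∈ Finset.range m, ε *
        (Ioc (u i) (u (i + 1)) ×ˢ Ioc (v j) (v (j + 1))).indicator (1 : ℝ × ℝ → ℝ) p := by
        refine (Finset.abs_sum_le_sum_abs _ _).trans (Finset.sum_le_sum fun i hi => ?_)
        rw [Finset.mul_sum, ← Finset.sum_sub_distrib]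
        refine (Finset.abs_sum_le_sum_abs _ _).trans (Finset.sum_le_sum fun j hj => ?_)
        rw [Finset.mem_range] at hi hj
        by_cases hp : p ∈ Ioc (u i) (u (i + 1)) ×ˢ Ioc (v j) (v (j + 1))
        · simp only [indicator_of_mem hp, Pi.one_apply, mul_one]
          obtain ⟨⟨h1, h2⟩, h3, h4⟩ := hp
          obtain ⟨⟨h5, h6⟩, h7, h8⟩ := hst i hi j hj
          have := (hu i hi).2
          have := (hv j hj).2
          refine hφ _ _ ?_ ?_ <;> rw [abs_le] <;> constructor <;> dsimp only <;> linarith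
        · simp [indicator_of_notMem hp]
    _ = ε * (Ioc (u 0) (u n) ×ˢ Ioc (v 0) (v m)).indicator (1 : ℝ × ℝ → ℝ) p := by
        rw [← hone, Finset.mul_sum]
        simp only [Finset.mul_sum]
    _ ≤ ε := by
        simp only [indicator_apply]
        split_ifs <;> simp [hε]

theorem grid_mem_Icc {n : ℕ} {u : ℕ → ℝ} (hu : ∀ i < n, u i ≤ u (i + 1)) {k : ℕ} (hk : k ≤ n) :
    u k ∈ Icc (u 0) (u n) := by
  constructor
  · induction k with
    | zero => exact le_rfl
    | succ k ih => exact (ih (by omega)).trans (hu k (by omega))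
  · induction n, hk using Nat.le_induction with
    | base => exact le_rfl
    | succ n hkn ih => exact (ih fun i hi => hu i (by omega)).trans (hu n (by omega))

/-- Tightness of a single random variable. -/
theorem exists_measure_le_of_measurable {P : Measure Ω} [IsFiniteMeasure P] {N : Ω → ℝ}
    (hN : Measurable N) {ε : ℝ≥0∞} (hε : 0 < ε) : ∃ M > 0, P {ω | M ≤ N ω} ≤ ε := by
  have h := tendsto_measure_iInter_atTop (μ := P) (s := fun n : ℕ => {ω | (n : ℝ) ≤ N ω})
    (fun n => (measurableSet_le measurable_const hN).nullMeasurableSet)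
    (fun a b hab ω hω => by
      simp only [mem_ofPred_eq] at hω ⊢
      exact le_trans (by exact_mod_cast hab) hω) ⟨0, measure_ne_top _ _⟩
  have h0 : ⋂ n : ℕ, {ω | (n : ℝ) ≤ N ω} = ∅ := by
    ext ω
    simp only [mem_iInter, mem_ofPred_eq, mem_empty_iff_false, iff_false, not_forall, not_le]
    exact exists_nat_gt _
  rw [h0, measure_empty] at h
  obtain ⟨n, hn, hn'⟩ := ((h.eventually (gt_mem_nhds hε)).and (eventually_gt_atTop 0)).exists
  exact ⟨n, by exact_mod_cast hn', hn.le⟩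

/-- The integral of `ψ` with respect to the sum of `V` and the drift `∑ Zₖ qₖ dν`: the Wiener
integral `W ψ` plus `∑ Zₖ ∫ ψ qₖ dν`. -/
def limitIntegral {ι : Type*} [Fintype ι] {ν : Measure (ℝ × ℝ)} [IsFiniteMeasure ν]
    {P : Measure Ω} (W : Lp ℝ 2 ν →ₗᵢ[ℝ] Lp ℝ 2 P) (q : ι → ℝ × ℝ → ℝ) (Z : ι → Ω → ℝ)
    {ψ : ℝ × ℝ → ℝ} (hψ : MemLp ψ 2 ν) (ω : Ω) : ℝ :=
  W hψ.toLp ω + ∑ k, Z k ω * ∫ p, ψ p * q k p ∂ν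

section

variable {ι : Type*} [Fintype ι] {ν : Measure (ℝ × ℝ)} [IsFiniteMeasure ν] {δ T : ℝ}
    {P : Measure Ω} {V η : ℝ → ℝ → Ω → ℝ}
    {W : Lp ℝ 2 ν →ₗᵢ[ℝ] Lp ℝ 2 P} {q : ι → ℝ × ℝ → ℝ} {Z : ι → Ω → ℝ}

theorem wienerIntegral_cell
    (hW : ∀ x ∈ Icc δ T, ∀ y ∈ Icc δ T, W (boxLp ν δ (x, y)) =ᵐ[P] rectIncr V δ x δ y)
    {a b c e : ℝ} (ha : δ ≤ a) (hab : a ≤ b) (hb : b ≤ T) (hc : δ ≤ c) (hce : c ≤ e) (he : e ≤ T)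
    (h : MemLp ((Ioc a b ×ˢ Ioc c e).indicator (1 : ℝ × ℝ → ℝ)) 2 ν) :
    W h.toLp =ᵐ[P] rectIncr V a b c e := by
  have hdec : h.toLp = boxLp ν δ (b, e) - boxLp ν δ (a, e) - boxLp ν δ (b, c)
      + boxLp ν δ (a, c) := by
    have hbox : ∀ p : ℝ × ℝ, boxLp ν δ p =ᵐ[ν] (Icc δ p.1 ×ˢ Icc δ p.2).indicator fun _ => 1 :=
      fun p => indicatorConstLp_coeFn
    refine Lp.ext ?_
    filter_upwards [h.coeFn_toLp, hbox (b, e), hbox (a, e), hbox (b, c), hbox (a, c),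
      Lp.coeFn_add (boxLp ν δ (b, e) - boxLp ν δ (a, e) - boxLp ν δ (b, c)) (boxLp ν δ (a, c)),
      Lp.coeFn_sub (boxLp ν δ (b, e) - boxLp ν δ (a, e)) (boxLp ν δ (b, c)),
      Lp.coeFn_sub (boxLp ν δ (b, e)) (boxLp ν δ (a, e))] with p h0 h1 h2 h3 h4 h5 h6 h7
    rw [h0, h5, Pi.add_apply, h6, Pi.sub_apply, h7, Pi.sub_apply, h1, h2, h3, h4]
    have key : ∀ {a b : ℝ}, δ ≤ a → a ≤ b → ∀ x, (Ioc a b).indicator (1 : ℝ → ℝ) x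
        = (Icc δ b).indicator (1 : ℝ → ℝ) x - (Icc δ a).indicator (1 : ℝ → ℝ) x := by
      intro a b ha hab x
      simp only [indicator_apply, mem_Ioc, mem_Icc, Pi.one_apply]
      split_ifs <;> grind
    have hfun : (fun _ => (1 : ℝ) : ℝ × ℝ → ℝ) = 1 := rfl
    rw [hfun]
    simp only [indicator_prod_one]
    rw [key ha hab, key hc hce]
    ring
  have hT : δ ≤ T := ha.trans (hab.trans hb)
  rw [hdec, map_add, map_sub, map_sub]
  filter_upwards [hW b ⟨ha.trans hab, hb⟩ e ⟨hc.trans hce, he⟩, hW a ⟨ha, hab.trans hb⟩ e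
    ⟨hc.trans hce, he⟩, hW b ⟨ha.trans hab, hb⟩ c ⟨hc, hce.trans he⟩,
    hW a ⟨ha, hab.trans hb⟩ c ⟨hc, hce.trans he⟩,
    Lp.coeFn_add (W (boxLp ν δ (b, e)) - W (boxLp ν δ (a, e)) - W (boxLp ν δ (b, c)))
      (W (boxLp ν δ (a, c))),
    Lp.coeFn_sub (W (boxLp ν δ (b, e)) - W (boxLp ν δ (a, e))) (W (boxLp ν δ (b, c))),
    Lp.coeFn_sub (W (boxLp ν δ (b, e))) (W (boxLp ν δ (a, e)))] with ω h1 h2 h3 h4 h5 h6 h7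
  rw [h5, Pi.add_apply, h6, Pi.sub_apply, h7, Pi.sub_apply, h1, h2, h3, h4]
  simp only [rectIncr]
  ring

theorem abs_stepFun_le (φ : ℝ × ℝ → ℝ) (n m : ℕ) (u v : ℕ → ℝ) (s t : ℕ → ℕ → ℝ) (p : ℝ × ℝ) :
    |stepFun φ n m u v s t p| ≤ ∑ i ∈ Finset.range n, ∑ j ∈ Finset.range m, |φ (s i j, t i j)| := by
  refine (Finset.abs_sum_le_sum_abs _ _).trans (Finset.sum_le_sum fun i hi => ?_)
  refine (Finset.abs_sum_le_sum_abs _ _).trans (Finset.sum_le_sum fun j hj => ?_)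
  simp only [indicator_apply]
  split_ifs <;> simp

theorem riemannSum_ae_eq
    (hW : ∀ x ∈ Icc δ T, ∀ y ∈ Icc δ T, W (boxLp ν δ (x, y)) =ᵐ[P] rectIncr V δ x δ y)
    (hq : ∀ k, Integrable (q k) ν)
    (hη : ∀ a b c e, δ ≤ a → a ≤ b → b ≤ T → δ ≤ c → c ≤ e → e ≤ T → ∀ ω,
      rectIncr η a b c e ω = rectIncr V a b c e ω
        + ∑ k, Z k ω * ∫ p in Ioc a b ×ˢ Ioc c e, q k p ∂ν)
    (φ : ℝ × ℝ → ℝ) {n m : ℕ} {u v : ℕ → ℝ} (s t : ℕ → ℕ → ℝ)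
    (hu : ∀ i < n, u i ≤ u (i + 1)) (hv : ∀ i < m, v i ≤ v (i + 1))
    (hu0 : δ ≤ u 0) (hun : u n ≤ T) (hv0 : δ ≤ v 0) (hvm : v m ≤ T)
    (hF : MemLp (stepFun φ n m u v s t) 2 ν) :
    ∀ᵐ ω ∂P, ∑ i ∈ Finset.range n, ∑ j ∈ Finset.range m,
        φ (s i j, t i j) * rectIncr η (u i) (u (i + 1)) (v j) (v (j + 1)) ω
      = limitIntegral W q Z hF ω := by
  have hcell : ∀ i j, MemLp ((Ioc (u i) (u (i + 1)) ×ˢ Ioc (v j) (v (j + 1))).indicator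
      (1 : ℝ × ℝ → ℝ)) 2 ν := fun i j =>
    memLp_two_of_bound (measurable_one.indicator (measurableSet_Ioc.prod measurableSet_Ioc)) (C := 1)
      fun p => by simp only [indicator_apply]; split_ifs <;> simp
  have hle : ∀ i < n, δ ≤ u i ∧ u i ≤ u (i + 1) ∧ u (i + 1) ≤ T := fun i hi =>
    ⟨hu0.trans (grid_mem_Icc hu hi.le).1, hu i hi, (grid_mem_Icc hu hi).2.trans hun⟩
  have hle' : ∀ i < m, δ ≤ v i ∧ v i ≤ v (i + 1) ∧ v (i + 1) ≤ T := fun i hi =>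
    ⟨hv0.trans (grid_mem_Icc hv hi.le).1, hv i hi, (grid_mem_Icc hv hi).2.trans hvm⟩
  have hdec : hF.toLp = ∑ i ∈ Finset.range n, ∑ j ∈ Finset.range m,
      φ (s i j, t i j) • (hcell i j).toLp := by
    refine Lp.ext ?_
    have h1 : ∀ i ∈ Finset.range n, ∀ᵐ p ∂ν, (∑ j ∈ Finset.range m,
        φ (s i j, t i j) • (hcell i j).toLp : Lp ℝ 2 ν) p = ∑ j ∈ Finset.range m,
          φ (s i j, t i j) *
          (Ioc (u i) (u (i + 1)) ×ˢ Ioc (v j) (v (j + 1))).indicator (1 : ℝ × ℝ → ℝ) p := by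
      intro i _
      have h2 : ∀ j ∈ Finset.range m, ∀ᵐ p ∂ν, (φ (s i j, t i j) • (hcell i j).toLp : Lp ℝ 2 ν) p
          = φ (s i j, t i j) *
          (Ioc (u i) (u (i + 1)) ×ˢ Ioc (v j) (v (j + 1))).indicator (1 : ℝ × ℝ → ℝ) p := by
        intro j _
        filter_upwards [Lp.coeFn_smul (φ (s i j, t i j)) (hcell i j).toLp, (hcell i j).coeFn_toLp]
          with p h3 h4
        rw [h3, Pi.smul_apply, h4, smul_eq_mul]
      rw [← Finset.eventually_all] at h2
      filter_upwards [h2, Lp.coeFn_finsetSum (Finset.range m)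
        (fun j => φ (s i j, t i j) • (hcell i j).toLp)] with p h2 h3
      rw [h3, Finset.sum_apply]
      exact Finset.sum_congr rfl h2
    rw [← Finset.eventually_all] at h1
    filter_upwards [h1, hF.coeFn_toLp, Lp.coeFn_finsetSum (Finset.range n)
      (fun i => ∑ j ∈ Finset.range m, φ (s i j, t i j) • (hcell i j).toLp)] with p h1 h2 h3
    rw [h2, h3, Finset.sum_apply]
    exact (Finset.sum_congr rfl h1).symm
  have hWF : ∀ᵐ ω ∂P, W hF.toLp ω = ∑ i ∈ Finset.range n, ∑ j ∈ Finset.range m,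
      φ (s i j, t i j) * rectIncr V (u i) (u (i + 1)) (v j) (v (j + 1)) ω := by
    have h1 : ∀ i ∈ Finset.range n, ∀ᵐ ω ∂P, (∑ j ∈ Finset.range m,
        φ (s i j, t i j) • W (hcell i j).toLp : Lp ℝ 2 P) ω = ∑ j ∈ Finset.range m,
          φ (s i j, t i j) * rectIncr V (u i) (u (i + 1)) (v j) (v (j + 1)) ω := by
      intro i hi
      have h2 : ∀ j ∈ Finset.range m, ∀ᵐ ω ∂P, (φ (s i j, t i j) • W (hcell i j).toLp : Lp ℝ 2 P) ω
          = φ (s i j, t i j) * rectIncr V (u i) (u (i + 1)) (v j) (v (j + 1)) ω := by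
        intro j hj
        have hi' := hle i (Finset.mem_range.1 hi)
        have hj' := hle' j (Finset.mem_range.1 hj)
        filter_upwards [Lp.coeFn_smul (φ (s i j, t i j)) (W (hcell i j).toLp),
          wienerIntegral_cell hW hi'.1 hi'.2.1 hi'.2.2 hj'.1 hj'.2.1 hj'.2.2 (hcell i j)]
          with p h3 h4
        rw [h3, Pi.smul_apply, h4, smul_eq_mul]
      rw [← Finset.eventually_all] at h2
      filter_upwards [h2, Lp.coeFn_finsetSum (Finset.range m)
        (fun j => φ (s i j, t i j) • W (hcell i j).toLp)] with p h2 h3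
      rw [h3, Finset.sum_apply]
      exact Finset.sum_congr rfl h2
    rw [← Finset.eventually_all] at h1
    rw [hdec]
    simp only [map_sum, map_smul]
    filter_upwards [h1, Lp.coeFn_finsetSum (Finset.range n)
      (fun i => ∑ j ∈ Finset.range m, φ (s i j, t i j) • W (hcell i j).toLp)] with p h1 h3
    rw [h3, Finset.sum_apply]
    exact Finset.sum_congr rfl h1
  have hint : ∀ k, ∫ p, stepFun φ n m u v s t p * q k p ∂ν
      = ∑ i ∈ Finset.range n, ∑ j ∈ Finset.range m,
        φ (s i j, t i j) * ∫ p in Ioc (u i) (u (i + 1)) ×ˢ Ioc (v j) (v (j + 1)), q k p ∂ν := by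
    intro k
    have e : ∀ p, stepFun φ n m u v s t p * q k p
        = ∑ i ∈ Finset.range n, ∑ j ∈ Finset.range m, φ (s i j, t i j) *
          (Ioc (u i) (u (i + 1)) ×ˢ Ioc (v j) (v (j + 1))).indicator (q k) p := by
      intro p
      simp only [stepFun, Finset.sum_mul]
      refine Finset.sum_congr rfl fun i _ => Finset.sum_congr rfl fun j _ => ?_
      simp only [indicator_apply]
      split_ifs <;> simp
    have hi : ∀ i j, Integrable (fun p => φ (s i j, t i j) *
        (Ioc (u i) (u (i + 1)) ×ˢ Ioc (v j) (v (j + 1))).indicator (q k) p) ν := fun i j =>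
      ((hq k).indicator (measurableSet_Ioc.prod measurableSet_Ioc)).const_mul _
    simp only [e]
    rw [integral_finsetSum _ fun i _ => integrable_finsetSum _ fun j _ => hi i j]
    refine Finset.sum_congr rfl fun i _ => ?_
    rw [integral_finsetSum _ fun j _ => hi i j]
    refine Finset.sum_congr rfl fun j _ => ?_
    rw [integral_const_mul, integral_indicator (measurableSet_Ioc.prod measurableSet_Ioc)]
  filter_upwards [hWF] with ω hω
  rw [limitIntegral, hω]
  simp only [hint, Finset.mul_sum]
  have e : ∀ i ∈ Finset.range n, ∀ j ∈ Finset.range m,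
      φ (s i j, t i j) * rectIncr η (u i) (u (i + 1)) (v j) (v (j + 1)) ω
      = φ (s i j, t i j) * rectIncr V (u i) (u (i + 1)) (v j) (v (j + 1)) ω
        + ∑ k, Z k ω * (φ (s i j, t i j) *
          ∫ p in Ioc (u i) (u (i + 1)) ×ˢ Ioc (v j) (v (j + 1)), q k p ∂ν) := by
    intro i hi j hj
    have hi' := hle i (Finset.mem_range.1 hi)
    have hj' := hle' j (Finset.mem_range.1 hj)
    rw [hη _ _ _ _ hi'.1 hi'.2.1 hi'.2.2 hj'.1 hj'.2.1 hj'.2.2, mul_add, Finset.mul_sum]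
    congr 1
    refine Finset.sum_congr rfl fun k _ => ?_
    ring
  rw [Finset.sum_congr rfl fun i hi => Finset.sum_congr rfl (e i hi)]
  simp only [Finset.sum_add_distrib]
  congr 1
  rw [Finset.sum_congr rfl (fun i _ => Finset.sum_comm), Finset.sum_comm]

end

section

variable {ι : Type*} [Fintype ι] {ν : Measure (ℝ × ℝ)} [IsFiniteMeasure ν] {δ T : ℝ}
    {P : Measure Ω} [IsProbabilityMeasure P] {V η : ℝ → ℝ → Ω → ℝ}
    {W : Lp ℝ 2 ν →ₗᵢ[ℝ] Lp ℝ 2 P} {q : ι → ℝ × ℝ → ℝ} {Z : ι → Ω → ℝ}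

theorem measure_le_abs_le_norm_div (f : Lp ℝ 2 P) {ε : ℝ} (hε : 0 < ε) :
    P {ω | ε ≤ |f ω|} ≤ ENNReal.ofReal (‖f‖ / ε) := by
  have h := mul_meas_ge_le_integral_of_nonneg (μ := P) (f := fun ω => |f ω|)
    (Eventually.of_forall fun ω => abs_nonneg _)
    ((Lp.memLp f).integrable (by norm_num)).abs ε
  have h2 := h.trans (integral_abs_le_norm f)
  rw [← ENNReal.ofReal_toReal (measure_ne_top P {ω | ε ≤ |f ω|})]
  refine ENNReal.ofReal_le_ofReal ?_
  rw [le_div_iff₀ hε, mul_comm]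
  exact h2

/-- The step functions converge uniformly, hence in `L²(ν)`, which controls both the Wiener part and
the coefficients of the random variables `Z k`; the latter are tight. -/
theorem isStochasticIntegral_limitIntegral
    (hν : ν (Icc δ T ×ˢ Icc δ T)ᶜ = 0) (hν1 : ∀ c, ν {p | p.1 = c} = 0)
    (hν2 : ∀ c, ν {p | p.2 = c} = 0)
    (hW : ∀ x ∈ Icc δ T, ∀ y ∈ Icc δ T, W (boxLp ν δ (x, y)) =ᵐ[P] rectIncr V δ x δ y)
    (hq : ∀ k, Continuous (q k)) {C : ℝ} (hC : ∀ k p, |q k p| ≤ C)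
    (hZ : ∀ k, Measurable (Z k))
    (hη : ∀ a b c e, δ ≤ a → a ≤ b → b ≤ T → δ ≤ c → c ≤ e → e ≤ T → ∀ ω,
      rectIncr η a b c e ω = rectIncr V a b c e ω
        + ∑ k, Z k ω * ∫ p in Ioc a b ×ˢ Ioc c e, q k p ∂ν)
    {φ : ℝ × ℝ → ℝ} (hφ : UniformContinuous φ) {t : ℝ} (ht : δ ≤ t)
    (hψ : MemLp ({p : ℝ × ℝ | t ≤ p.2}.indicator φ) 2 ν) :
    IsStochasticIntegral P (fun x y => φ (x, y)) η δ T t T (limitIntegral W q Z hψ) := by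
  intro ε hε
  have hqi : ∀ k, Integrable (q k) ν := fun k =>
    (memLp_two_of_bound (hq k).measurable (hC k)).integrable (by norm_num)
  set N : Ω → ℝ := fun ω => ∑ k, |Z k ω| with hN
  have hNm : Measurable N := Finset.measurable_sum _ fun k _ => (hZ k).abs
  obtain ⟨M, hM, hPM⟩ := exists_measure_le_of_measurable (P := P) hNm
    (ε := ENNReal.ofReal (ε / 2)) (by simpa using hε)
  -- If `|f| ≤ κ`, then `‖f‖ ≤ K κ` in `L²(ν)`, and `|∫ f q k dν| ≤ κ D`.
  set K : ℝ := ((measureUnivNNReal ν : ℝ) ^ (2 : ℝ≥0∞).toReal⁻¹) with hK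
  have hK0 : 0 ≤ K := by positivity
  set D : ℝ := ν.real univ * (|C| + 1) + 1 with hD
  have hD0 : 0 < D := by positivity
  obtain ⟨κ, hκ, hκK, hκD⟩ : ∃ κ > 0, K * κ / (ε / 2) ≤ ε / 2 ∧ κ * D * M ≤ ε / 2 := by
    refine ⟨min (ε / 2 * (ε / 2) / (K + 1)) (ε / 2 / (D * M)), by positivity, ?_, ?_⟩
    · rw [div_le_iff₀ (by positivity)]
      calc _ ≤ K * (ε / 2 * (ε / 2) / (K + 1)) := by gcongr; exact min_le_left _ _
        _ ≤ (K + 1) * (ε / 2 * (ε / 2) / (K + 1)) := by gcongr; linarith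
        _ = _ := by field_simp
    · rw [mul_assoc]
      calc _ ≤ ε / 2 / (D * M) * (D * M) := by gcongr; exact min_le_right _ _
        _ = _ := by field_simp
  obtain ⟨ρ, hρ, hφρ⟩ := Metric.uniformContinuous_iff.1 hφ κ hκ
  refine ⟨ρ / 2, by positivity, ?_⟩
  intro n m u v s tt hu0 hun hv0 hvm hu hv hst
  have hosc : ∀ p p' : ℝ × ℝ, |p.1 - p'.1| ≤ ρ / 2 → |p.2 - p'.2| ≤ ρ / 2 →
      |φ p - φ p'| ≤ κ := by
    intro p p' h1 h2
    have := hφρ (a := p) (b := p') (by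
      rw [Prod.dist_eq, max_lt_iff, Real.dist_eq, Real.dist_eq]
      constructor <;> linarith)
    exact (Real.dist_eq _ _ ▸ this).le
  have hF : MemLp (stepFun φ n m u v s tt) 2 ν :=
    memLp_two_of_bound (measurable_stepFun φ n m u v s tt) (abs_stepFun_le φ n m u v s tt)
  have hsum := riemannSum_ae_eq (W := W) (Z := Z) hW hqi hη φ s tt (fun i hi => (hu i hi).1)
    (fun i hi => (hv i hi).1) hu0.ge hun.le (hv0 ▸ ht) hvm.le hF
  -- The left and lower edges of the grid are not covered by the half-open cells, but they are null sets.
  have hclose : ∀ᵐ p ∂ν, |stepFun φ n m u v s tt p - {p : ℝ × ℝ | t ≤ p.2}.indicator φ p| ≤ κ := by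
    have hS : ∀ᵐ p ∂ν, p ∈ Icc δ T ×ˢ Icc δ T := hν
    have h1 : ∀ᵐ p ∂ν, p.1 ≠ δ := by
      rw [ae_iff]; simpa using hν1 δ
    have h2 : ∀ᵐ p ∂ν, p.2 ≠ t := by
      rw [ae_iff]; simpa using hν2 t
    filter_upwards [hS, h1, h2] with p hp hp1 hp2
    have h := abs_stepFun_sub_le hκ.le hosc hu hv hst p
    rw [hu0, hun, hv0, hvm] at h
    have e : (Ioc δ T ×ˢ Ioc t T).indicator φ p = {p : ℝ × ℝ | t ≤ p.2}.indicator φ p := by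
      by_cases hpt : t ≤ p.2
      · rw [indicator_of_mem (show p ∈ {p : ℝ × ℝ | t ≤ p.2} from hpt), indicator_of_mem]
        exact ⟨⟨lt_of_le_of_ne hp.1.1 (Ne.symm hp1), hp.1.2⟩,
          lt_of_le_of_ne hpt (Ne.symm hp2), hp.2.2⟩
      · rw [indicator_of_notMem (show p ∉ {p : ℝ × ℝ | t ≤ p.2} from hpt), indicator_of_notMem]
        exact fun h => hpt h.2.1.le
    rwa [e] at h
  have hdiff : ∀ᵐ ω ∂P, |(∑ i ∈ Finset.range n, ∑ j ∈ Finset.range m,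
        φ (s i j, tt i j) * rectIncr η (u i) (u (i + 1)) (v j) (v (j + 1)) ω)
        - limitIntegral W q Z hψ ω| ≤ |W (hF.toLp - hψ.toLp) ω| + κ * D * N ω := by
    rw [map_sub]
    filter_upwards [hsum, Lp.coeFn_sub (W hF.toLp) (W hψ.toLp)] with ω h1 h2
    rw [h1, h2, Pi.sub_apply, limitIntegral, limitIntegral]
    have e : W hF.toLp ω + ∑ k, Z k ω * ∫ p, stepFun φ n m u v s tt p * q k p ∂ν
        - (W hψ.toLp ω + ∑ k, Z k ω * ∫ p, {p : ℝ × ℝ | t ≤ p.2}.indicator φ p * q k p ∂ν)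
        = (W hF.toLp ω - W hψ.toLp ω) + ∑ k, Z k ω *
          ∫ p, (stepFun φ n m u v s tt p - {p : ℝ × ℝ | t ≤ p.2}.indicator φ p) * q k p ∂ν := by
      rw [add_sub_add_comm, ← Finset.sum_sub_distrib]
      congr 1
      refine Finset.sum_congr rfl fun k _ => ?_
      rw [← mul_sub, ← integral_sub]
      · simp only [sub_mul]
      · exact hF.integrable_mul (memLp_two_of_bound (hq k).measurable (hC k))
      · exact hψ.integrable_mul (memLp_two_of_bound (hq k).measurable (hC k))
    rw [e]
    refine (abs_add_le _ _).trans (add_le_add le_rfl ?_)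
    refine (Finset.abs_sum_le_sum_abs _ _).trans ?_
    rw [hN, Finset.mul_sum]
    refine Finset.sum_le_sum fun k _ => ?_
    rw [abs_mul, mul_comm]
    refine mul_le_mul_of_nonneg_right ?_ (abs_nonneg _)
    have hb : ∀ᵐ p ∂ν, ‖(stepFun φ n m u v s tt p - {p : ℝ × ℝ | t ≤ p.2}.indicator φ p) * q k p‖
        ≤ κ * |C| := by
      filter_upwards [hclose] with p hp
      rw [norm_mul]
      exact mul_le_mul hp ((hC k p).trans (le_abs_self C)) (norm_nonneg _) hκ.le
    have := norm_integral_le_of_norm_le_const hb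
    rw [Real.norm_eq_abs] at this
    refine this.trans ?_
    rw [hD]
    have h3 : 0 ≤ ν.real univ := measureReal_nonneg
    nlinarith [mul_nonneg hκ.le h3]
  have hnorm : ‖W (hF.toLp - hψ.toLp)‖ ≤ K * κ := by
    rw [W.norm_map]
    refine Lp.norm_le_of_ae_bound hκ.le ?_
    filter_upwards [Lp.coeFn_sub hF.toLp hψ.toLp, hF.coeFn_toLp, hψ.coeFn_toLp, hclose]
      with p h1 h2 h3 h4
    rw [h1, Pi.sub_apply, h2, h3]
    exact h4
  calc _ ≤ P ({ω | ε / 2 ≤ |W (hF.toLp - hψ.toLp) ω|} ∪ {ω | M ≤ N ω}) := by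
        refine measure_mono_ae ?_
        filter_upwards [hdiff] with ω h1 (h2 : ε ≤ _)
        by_contra hcon
        have hcon' : ¬ (ε / 2 ≤ |W (hF.toLp - hψ.toLp) ω| ∨ M ≤ N ω) := hcon
        push Not at hcon'
        have h3 : κ * D * N ω < κ * D * M := by
          have := hcon'.2
          gcongr
        linarith [hcon'.1]
    _ ≤ ENNReal.ofReal (ε / 2) + ENNReal.ofReal (ε / 2) := by
        refine (measure_union_le _ _).trans (add_le_add ?_ hPM)
        refine (measure_le_abs_le_norm_div _ (by positivity)).trans (ENNReal.ofReal_le_ofReal ?_)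
        refine le_trans ?_ hκK
        gcongr
    _ = ENNReal.ofReal ε := by
        rw [← ENNReal.ofReal_add (by positivity) (by positivity), add_halves]

end

theorem IsStochasticIntegral.congr {P : Measure Ω} {φ φ' : ℝ → ℝ → ℝ} {ξ : ℝ → ℝ → Ω → ℝ}
    {a b c e : ℝ} {Y : Ω → ℝ} (h : IsStochasticIntegral P φ ξ a b c e Y)
    (hφ : ∀ x ∈ Icc a b, ∀ y ∈ Icc c e, φ x y = φ' x y) :
    IsStochasticIntegral P φ' ξ a b c e Y := by
  intro ε hε
  obtain ⟨ρ, hρ, H⟩ := h ε hε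
  refine ⟨ρ, hρ, fun n m u v s t hu0 hun hv0 hvm hu hv hst => ?_⟩
  refine le_trans (le_of_eq ?_) (H n m u v s t hu0 hun hv0 hvm hu hv hst)
  have e : ∀ ω, ∑ i ∈ Finset.range n, ∑ j ∈ Finset.range m,
      φ' (s i j) (t i j) * rectIncr ξ (u i) (u (i + 1)) (v j) (v (j + 1)) ω
      = ∑ i ∈ Finset.range n, ∑ j ∈ Finset.range m,
      φ (s i j) (t i j) * rectIncr ξ (u i) (u (i + 1)) (v j) (v (j + 1)) ω := by
    intro ω
    refine Finset.sum_congr rfl fun i hi => Finset.sum_congr rfl fun j hj => ?_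
    rw [Finset.mem_range] at hi hj
    obtain ⟨⟨h1, h2⟩, h3, h4⟩ := hst i hi j hj
    have hi1 := grid_mem_Icc (fun i hi => (hu i hi).1) hi.le
    have hi2 := grid_mem_Icc (fun i hi => (hu i hi).1) hi
    have hj1 := grid_mem_Icc (fun i hi => (hv i hi).1) hj.le
    have hj2 := grid_mem_Icc (fun i hi => (hv i hi).1) hj
    rw [hu0, hun] at hi1 hi2
    rw [hv0, hvm] at hj1 hj2
    rw [hφ _ ⟨hi1.1.trans h1, h2.trans hi2.2⟩ _ ⟨hj1.1.trans h3, h4.trans hj2.2⟩]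
  simp only [e]

theorem IsStochasticIntegral.congr_ae {P : Measure Ω} {φ : ℝ → ℝ → ℝ} {ξ : ℝ → ℝ → Ω → ℝ}
    {a b c e : ℝ} {Y Y' : Ω → ℝ} (h : IsStochasticIntegral P φ ξ a b c e Y)
    (hY : Y =ᵐ[P] Y') : IsStochasticIntegral P φ ξ a b c e Y' := by
  intro ε hε
  obtain ⟨ρ, hρ, H⟩ := h ε hε
  refine ⟨ρ, hρ, fun n m u v s t hu0 hun hv0 hvm hu hv hst => ?_⟩
  refine le_trans (measure_mono_ae ?_) (H n m u v s t hu0 hun hv0 hvm hu hv hst)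
  filter_upwards [hY] with ω hω (h : ε ≤ _)
  rw [← hω] at h
  exact h

theorem exists_grid {a b : ℝ} (hab : a ≤ b) {ρ : ℝ} (hρ : 0 < ρ) :
    ∃ (n : ℕ) (u : ℕ → ℝ), u 0 = a ∧ u n = b ∧ ∀ i < n, u i ≤ u (i + 1) ∧ u (i + 1) - u i ≤ ρ := by
  obtain ⟨n, hn⟩ := exists_nat_gt ((b - a) / ρ)
  have hn0 : (0 : ℝ) < n := lt_of_le_of_lt (by have := sub_nonneg.2 hab; positivity) hn
  refine ⟨n, fun i => a + i * ((b - a) / n), by simp, by field_simp; ring, fun i _ => ?_⟩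
  have h0 : 0 ≤ (b - a) / n := div_nonneg (sub_nonneg.2 hab) hn0.le
  have h1 : (b - a) / n ≤ ρ := by
    rw [div_lt_iff₀ hρ] at hn
    rw [div_le_iff₀ hn0]; linarith
  push_cast
  constructor <;> nlinarith

/-- Limits in probability are unique, as there are grids of arbitrarily small mesh. -/
theorem IsStochasticIntegral.unique {P : Measure Ω} {φ : ℝ → ℝ → ℝ} {ξ : ℝ → ℝ → Ω → ℝ}
    {a b c e : ℝ} (hab : a ≤ b) (hce : c ≤ e) {Y Y' : Ω → ℝ}
    (h : IsStochasticIntegral P φ ξ a b c e Y) (h' : IsStochasticIntegral P φ ξ a b c e Y') :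
    Y =ᵐ[P] Y' := by
  have key : ∀ ε > 0, P {ω | 2 * ε ≤ |Y ω - Y' ω|} ≤ ENNReal.ofReal (2 * ε) := by
    intro ε hε
    obtain ⟨ρ, hρ, H⟩ := h ε hε
    obtain ⟨ρ', hρ', H'⟩ := h' ε hε
    obtain ⟨n, u, hu0, hun, hu⟩ := exists_grid hab (lt_min hρ hρ')
    obtain ⟨m, v, hv0, hvm, hv⟩ := exists_grid hce (lt_min hρ hρ')
    have h1 := H n m u v (fun i _ => u i) (fun _ j => v j) hu0 hun hv0 hvm
      (fun i hi => ⟨(hu i hi).1, (hu i hi).2.trans (min_le_left _ _)⟩)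
      (fun i hi => ⟨(hv i hi).1, (hv i hi).2.trans (min_le_left _ _)⟩)
      (fun i hi j hj => ⟨⟨le_rfl, (hu i hi).1⟩, le_rfl, (hv j hj).1⟩)
    have h2 := H' n m u v (fun i _ => u i) (fun _ j => v j) hu0 hun hv0 hvm
      (fun i hi => ⟨(hu i hi).1, (hu i hi).2.trans (min_le_right _ _)⟩)
      (fun i hi => ⟨(hv i hi).1, (hv i hi).2.trans (min_le_right _ _)⟩)
      (fun i hi j hj => ⟨⟨le_rfl, (hu i hi).1⟩, le_rfl, (hv j hj).1⟩)
    rw [two_mul, ENNReal.ofReal_add hε.le hε.le]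
    refine le_trans (measure_mono ?_) ((measure_union_le _ _).trans (add_le_add h1 h2))
    intro ω hω
    by_contra hcon
    simp only [mem_union, mem_ofPred_eq, not_or, not_le] at hcon hω
    rw [abs_lt, abs_lt] at hcon
    rcases le_abs.1 hω with h | h <;> linarith [hcon.1.1, hcon.1.2, hcon.2.1, hcon.2.2]
  have hzero : ∀ ε > 0, P {ω | ε ≤ |Y ω - Y' ω|} = 0 := by
    intro ε hε
    refine nonpos_iff_eq_zero.1 (ENNReal.le_of_forall_pos_le_add fun κ hκ _ => ?_)
    rw [zero_add]
    have hm : 0 < min ε κ := lt_min hε hκ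
    refine (measure_mono ?_).trans ((key (min ε κ / 2) (by positivity)).trans ?_)
    · intro ω (hω : ε ≤ _)
      have := min_le_left ε (κ : ℝ)
      change 2 * (min ε κ / 2) ≤ _
      linarith
    · rw [← ENNReal.ofReal_coe_nnreal]
      refine ENNReal.ofReal_le_ofReal ?_
      have := min_le_right ε (κ : ℝ)
      linarith
  rw [Filter.EventuallyEq, ae_iff]
  refine measure_mono_null ?_ (measure_iUnion_null fun n : ℕ => hzero (1 / ((n : ℝ) + 1))
    (by positivity))
  intro ω (hω : ¬ Y ω = Y' ω)
  obtain ⟨n, hn⟩ := exists_nat_one_div_lt (abs_pos.2 (sub_ne_zero.2 hω))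
  exact mem_iUnion.2 ⟨n, hn.le⟩

/-! ### Jointly measurable versions -/

theorem ae_tendsto_of_norm_sub_le {P : Measure Ω} [IsProbabilityMeasure P] {X : ℕ → Lp ℝ 2 P}
    {Y : Lp ℝ 2 P} (h : ∀ n, ‖X n - Y‖ ≤ (1 / 2) ^ n) :
    ∀ᵐ ω ∂P, Tendsto (fun n => X n ω) atTop (𝓝 (Y ω)) := by
  have h1 : ∀ n, ∫⁻ ω, ‖(X n - Y : Lp ℝ 2 P) ω‖ₑ ∂P ≤ ENNReal.ofReal ((1 / 2) ^ n) := by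
    intro n
    rw [← ofReal_integral_norm_eq_lintegral_enorm ((Lp.memLp _).integrable (by norm_num))]
    exact ENNReal.ofReal_le_ofReal ((integral_abs_le_norm (X n - Y)).trans (h n))
  have h2 : ∫⁻ ω, ∑' n, ‖(X n - Y : Lp ℝ 2 P) ω‖ₑ ∂P ≠ ⊤ := by
    rw [lintegral_tsum fun n => (Lp.aestronglyMeasurable _).enorm]
    refine ne_top_of_le_ne_top ?_ (ENNReal.tsum_le_tsum h1)
    rw [← ENNReal.ofReal_tsum_of_nonneg (fun n => by positivity)
      (summable_geometric_of_lt_one (by norm_num) (by norm_num))]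
    exact ENNReal.ofReal_ne_top
  have h3 := ae_lt_top' (AEMeasurable.tsum fun n => (Lp.aestronglyMeasurable (X n - Y)).enorm) h2
  have h4 : ∀ᵐ ω ∂P, ∀ n, (X n - Y : Lp ℝ 2 P) ω = X n ω - Y ω :=
    ae_all_iff.2 fun n => Lp.coeFn_sub _ _
  filter_upwards [h3, h4] with ω h5 h6
  have h7 := ENNReal.tendsto_atTop_zero_of_tsum_ne_top h5.ne
  rw [tendsto_iff_edist_tendsto_0]
  simp only [h6] at h7
  simpa [edist_eq_enorm_sub] using h7

/-- A continuous curve in `L²(P)` has a jointly measurable version, obtained as an upper limit of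
step functions that approximate it uniformly at a geometric rate. -/
theorem exists_measurable_version {P : Measure Ω} [IsProbabilityMeasure P] {G : ℝ → Lp ℝ 2 P}
    (hG : Continuous G) (a b : ℝ) :
    ∃ J : ℝ → Ω → ℝ, Measurable (fun p : ℝ × Ω => J p.1 p.2) ∧
      ∀ t ∈ Icc a b, J t =ᵐ[P] G t := by
  -- Rounding down moves `t` by less than `1`, so the approximating points stay in `[a-1,b]`.
  have huc := (isCompact_Icc (a := a - 1) (b := b)).uniformContinuousOn_of_continuous
    hG.continuousOn
  rw [Metric.uniformContinuousOn_iff] at huc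
  have hN : ∀ n : ℕ, ∃ N : ℕ, 0 < N ∧ ∀ t ∈ Icc a b,
      ‖G (⌊t * N⌋ / N) - G t‖ ≤ (1 / 2) ^ n := by
    intro n
    obtain ⟨ρ, hρ, H⟩ := huc ((1 / 2) ^ n) (by positivity)
    obtain ⟨N, hN⟩ := exists_nat_gt (max 1 (1 / ρ))
    have hN1 : (1 : ℝ) < N := (le_max_left _ _).trans_lt hN
    have hN2 : 1 / ρ < N := (le_max_right _ _).trans_lt hN
    have hN0 : (0 : ℝ) < N := by linarith
    refine ⟨N, by exact_mod_cast hN0, fun t ht => ?_⟩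
    have h1 : (⌊t * N⌋ : ℝ) / N ≤ t := by rw [div_le_iff₀ hN0]; exact Int.floor_le _
    have h2 : t - 1 / N < (⌊t * N⌋ : ℝ) / N := by
      rw [lt_div_iff₀ hN0, sub_mul, one_div, inv_mul_cancel₀ hN0.ne']
      exact Int.sub_one_lt_floor _
    have h3 : 1 / (N : ℝ) < ρ := by rwa [one_div_lt hN0 hρ]
    have h4 : 1 / (N : ℝ) ≤ 1 := by rw [div_le_one hN0]; exact hN1.le
    rw [← dist_eq_norm]
    refine (H _ ⟨by linarith [ht.1], h1.trans ht.2⟩ _ ⟨by linarith [ht.1], ht.2⟩ ?_).le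
    rw [Real.dist_eq, abs_lt]
    constructor <;> linarith
  choose N hN0 hN using hN
  refine ⟨fun t ω => limsup (fun n : ℕ => G (⌊t * N n⌋ / N n) ω) atTop, ?_, fun t ht => ?_⟩
  · refine Measurable.limsup fun n => ?_
    have h1 : Measurable (fun p : ℤ × Ω => G (p.1 / N n) p.2) :=
      measurable_from_prod_countable_right fun k => (Lp.stronglyMeasurable (G (k / N n))).measurable
    have h2 : Measurable (fun p : ℝ × Ω => ((⌊p.1 * N n⌋ : ℤ), p.2)) := by
      refine Measurable.prodMk ?_ measurable_snd
      exact Int.measurable_floor.comp (measurable_fst.mul_const _)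
    exact h1.comp h2
  · filter_upwards [ae_tendsto_of_norm_sub_le (fun n => hN n t ht)] with ω hω
    exact hω.limsup_eq

theorem norm_toLp_sub_sq {α : Type*} [MeasurableSpace α] {ν : Measure α} {f g : α → ℝ}
    (hf : MemLp f 2 ν) (hg : MemLp g 2 ν) :
    ‖hf.toLp - hg.toLp‖ ^ 2 = ∫ p, (f p - g p) ^ 2 ∂ν := by
  rw [← real_inner_self_eq_norm_sq, L2.inner_def]
  refine integral_congr_ae ?_
  filter_upwards [Lp.coeFn_sub hf.toLp hg.toLp, hf.coeFn_toLp, hg.coeFn_toLp] with p h1 h2 h3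
  rw [h1, Pi.sub_apply, h2, h3]
  simp [sq]

theorem continuous_toLp {α : Type*} [MeasurableSpace α] {ν : Measure α} [IsFiniteMeasure ν]
    {H : ℝ → α → ℝ} (hm : ∀ t, Measurable (H t)) {C : ℝ} (hC : ∀ t p, |H t p| ≤ C)
    (hc : ∀ t, ∀ᵐ p ∂ν, ContinuousAt (fun s => H s p) t) (hL : ∀ t, MemLp (H t) 2 ν) :
    Continuous fun t => (hL t).toLp := by
  rw [continuous_iff_continuousAt]
  intro t
  rw [ContinuousAt, tendsto_iff_norm_sub_tendsto_zero]
  have h : Tendsto (fun s => ∫ p, (H s p - H t p) ^ 2 ∂ν) (𝓝 t) (𝓝 (∫ p, (H t p - H t p) ^ 2 ∂ν)) := by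
    refine tendsto_integral_filter_of_dominated_convergence (fun _ => (2 * C) ^ 2) ?_ ?_
      (integrable_const _) ?_
    · exact Eventually.of_forall fun s => (((hm s).sub (hm t)).pow_const 2).aestronglyMeasurable
    · refine Eventually.of_forall fun s => Eventually.of_forall fun p => ?_
      rw [Real.norm_eq_abs, abs_pow]
      have := abs_sub (H s p) (H t p)
      have := hC s p
      have := hC t p
      gcongr
      linarith
    · filter_upwards [hc t] with p hp
      exact ((hp.tendsto.sub_const _).pow 2)
  simp only [sub_self, ne_eq, OfNat.ofNat_ne_zero, not_false_eq_true, zero_pow,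
    integral_zero] at h
  have h2 := h.sqrt
  rw [Real.sqrt_zero] at h2
  refine h2.congr fun s => ?_
  rw [← norm_toLp_sub_sq (hL s) (hL t), Real.sqrt_sq (norm_nonneg _)]

theorem continuousAt_indicator_ge {φ : ℝ × ℝ → ℝ} {p : ℝ × ℝ} {t : ℝ} (hp : p.2 ≠ t) :
    ContinuousAt (fun s => {p : ℝ × ℝ | s ≤ p.2}.indicator φ p) t := by
  rcases lt_or_gt_of_ne hp with h | h
  · refine (continuousAt_const (y := (0 : ℝ))).congr ?_
    filter_upwards [lt_mem_nhds h] with s hs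
    exact (indicator_of_notMem (by simpa using hs) _).symm
  · refine (continuousAt_const (y := φ p)).congr ?_
    filter_upwards [gt_mem_nhds h] with s hs
    exact (indicator_of_mem (show p ∈ {p : ℝ × ℝ | s ≤ p.2} from hs.le) _).symm

/-! ### Stochastic Fubini theorem -/

/-- If `D a` is a version of the Wiener integral of the kernel `k a`, then integrating `D` in the
parameter gives the Wiener integral of the integrated kernel. Both sides have the same integrals
over events, because the adjoint of `W` turns these into integrals to which Fubini applies. -/
theorem stochastic_fubini {α β : Type*} [MeasurableSpace α] [MeasurableSpace β] {ν : Measure β}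
    [IsFiniteMeasure ν] {P : Measure Ω} [IsProbabilityMeasure P] (W : Lp ℝ 2 ν →ₗᵢ[ℝ] Lp ℝ 2 P)
    {ρ : Measure α} [IsFiniteMeasure ρ] {k : α → β → ℝ}
    (hk : Measurable fun z : α × β => k z.1 z.2) {C : ℝ} (hC : ∀ a p, |k a p| ≤ C)
    (hkL : ∀ a, MemLp (k a) 2 ν) (hK : MemLp (fun p => ∫ a, k a p ∂ρ) 2 ν)
    {D : α → Ω → ℝ} (hD : Measurable fun z : α × Ω => D z.1 z.2)
    (hDk : ∀ᵐ a ∂ρ, D a =ᵐ[P] W (hkL a).toLp) :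
    (∀ᵐ ω ∂P, Integrable (fun a => D a ω) ρ) ∧
      (fun ω => ∫ a, D a ω ∂ρ) =ᵐ[P] W hK.toLp := by
  have hDint : Integrable (fun z : α × Ω => D z.1 z.2) (ρ.prod P) := by
    rw [integrable_prod_iff hD.aestronglyMeasurable]
    constructor
    · filter_upwards [hDk] with a ha
      exact (((Lp.memLp (W (hkL a).toLp)).integrable (by norm_num))).congr ha.symm
    · refine Integrable.of_bound (C := (measureUnivNNReal ν : ℝ) ^ (2 : ℝ≥0∞).toReal⁻¹ * |C|)
        (hD.norm.aestronglyMeasurable.integral_prod_right') ?_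
      filter_upwards [hDk] with a ha
      have h1 : ∫ ω, ‖D a ω‖ ∂P = ∫ ω, |W (hkL a).toLp ω| ∂P :=
        integral_congr_ae (ha.mono fun ω hω => by simp only [hω, Real.norm_eq_abs])
      rw [h1, Real.norm_of_nonneg (integral_nonneg fun _ => abs_nonneg _)]
      refine (integral_abs_le_norm _).trans ?_
      rw [W.norm_map]
      refine Lp.norm_le_of_ae_bound (abs_nonneg C) ?_
      filter_upwards [(hkL a).coeFn_toLp] with p hp
      rw [hp]
      exact (hC a p).trans (le_abs_self C)
  have hXint : Integrable (fun ω => ∫ a, D a ω ∂ρ) P := hDint.integral_prod_right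
  refine ⟨hDint.prod_left_ae, ?_⟩
  refine hXint.ae_eq_of_forall_setIntegral_eq _ _ ((Lp.memLp _).integrable (by norm_num))
    fun B hB _ => ?_
  -- Over the event `B`, the integral of `W φ` is the inner product of `φ` with `W* 1_B`.
  set g : Lp ℝ 2 ν := W.toContinuousLinearMap.adjoint
    (indicatorConstLp 2 hB (measure_ne_top P B) (1 : ℝ)) with hg
  have hadj : ∀ φ : Lp ℝ 2 ν, ∫ ω in B, W φ ω ∂P = inner ℝ g φ := by
    intro φ
    rw [← L2.inner_indicatorConstLp_one (𝕜 := ℝ) hB (measure_ne_top P B) (W φ), hg,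
      ContinuousLinearMap.adjoint_inner_left]
    rfl
  have hgint : ∀ {f : β → ℝ} (hf : MemLp f 2 ν), inner ℝ g hf.toLp = ∫ p, g p * f p ∂ν := by
    intro f hf
    rw [L2.inner_def]
    refine integral_congr_ae (hf.coeFn_toLp.mono fun p hp => ?_)
    simp only [hp]
    simp [mul_comm]
  have hgi : Integrable g ν := (Lp.memLp g).integrable (by norm_num)
  have hprod : Integrable (fun z : α × β => g z.2 * k z.1 z.2) (ρ.prod ν) := by
    refine (hgi.comp_snd ρ).mul_bdd (c := C) hk.aestronglyMeasurable
      (Eventually.of_forall fun z => hC _ _)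
  have hswap : Integrable (fun z : α × Ω => D z.1 z.2) (ρ.prod (P.restrict B)) :=
    hDint.mono_measure (Measure.prod_mono le_rfl Measure.restrict_le_self)
  calc ∫ ω in B, ∫ a, D a ω ∂ρ ∂P = ∫ a, ∫ ω in B, D a ω ∂P ∂ρ :=
        (integral_integral_swap (f := D) hswap).symm
    _ = ∫ a, ∫ p, g p * k a p ∂ν ∂ρ := by
        refine integral_congr_ae ?_
        filter_upwards [hDk] with a ha
        rw [← hgint (hkL a), ← hadj]
        exact integral_congr_ae (ae_restrict_of_ae ha)
    _ = ∫ p, ∫ a, g p * k a p ∂ρ ∂ν := integral_integral_swap hprod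
    _ = ∫ p, g p * ∫ a, k a p ∂ρ ∂ν := by simp only [integral_const_mul]
    _ = ∫ ω in B, W hK.toLp ω ∂P := by rw [hadj, hgint]

/-! ### The martingale transform of the Wiener integral -/

section

variable {ι : Type*} [Fintype ι] [DecidableEq ι]

/-- The matrix `∫_{v ≥ t} q qᵀ dν`, as a function of all real `t`. -/
def tailInfo (ν : Measure (ℝ × ℝ)) (q : ι → ℝ × ℝ → ℝ) (t : ℝ) : Matrix ι ι ℝ :=
  Matrix.of fun i j => ∫ p, {p : ℝ × ℝ | t ≤ p.2}.indicator (q i) p * q j p ∂ν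

/-- The vector `I(t)⁻¹ q(s,t)` at `a = (s,t)`. The argument of the matrix is clamped to `[δ,y₀]`,
where it is invertible, so that the function is continuous and bounded on the plane. -/
def weight (ν : Measure (ℝ × ℝ)) (q : ι → ℝ × ℝ → ℝ) (δ y₀ : ℝ) (a : ℝ × ℝ) : ι → ℝ :=
  (tailInfo ν q (max δ (min a.2 y₀)))⁻¹ *ᵥ fun i => q i a

/-- The kernel `1_{t ≤ v} q(s,t)ᵀ I(t)⁻¹ q(u,v)`, at `a = (s,t)` and `p = (u,v)`, of the
compensator. -/
def transformKernel (ν : Measure (ℝ × ℝ)) (q : ι → ℝ × ℝ → ℝ) (δ y₀ : ℝ) (a p : ℝ × ℝ) : ℝ :=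
  {p : ℝ × ℝ | a.2 ≤ p.2}.indicator (fun p => weight ν q δ y₀ a ⬝ᵥ fun i => q i p) p

variable {ν : Measure (ℝ × ℝ)} [IsFiniteMeasure ν] {q : ι → ℝ × ℝ → ℝ} {δ y₀ T : ℝ}

omit [Fintype ι] [DecidableEq ι] [IsFiniteMeasure ν] in
theorem tailInfo_isSymm (t : ℝ) : (tailInfo ν q t)ᵀ = tailInfo ν q t := by
  ext i j
  simp only [tailInfo, Matrix.transpose_apply, Matrix.of_apply]
  congr 1
  ext p
  simp only [indicator_apply]
  split_ifs <;> ring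

omit [Fintype ι] [DecidableEq ι] in
theorem continuous_tailInfo (hν2 : ∀ c, ν {p | p.2 = c} = 0) (hq : ∀ k, Continuous (q k)) {C : ℝ}
    (hC : ∀ k p, |q k p| ≤ C) : Continuous (tailInfo ν q) := by
  refine continuous_matrix fun i j => ?_
  simp only [tailInfo, Matrix.of_apply]
  rw [continuous_iff_continuousAt]
  intro t
  refine tendsto_integral_filter_of_dominated_convergence (fun _ => C * C) ?_ ?_
    (integrable_const _) ?_
  · exact Eventually.of_forall fun s => (((hq i).measurable.indicator
      (measurableSet_le measurable_const measurable_snd)).mul (hq j).measurable).aestronglyMeasurable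
  · refine Eventually.of_forall fun s => Eventually.of_forall fun p => ?_
    rw [norm_mul]
    have h0 : 0 ≤ C := (abs_nonneg _).trans (hC i p)
    refine mul_le_mul ?_ (hC j p) (norm_nonneg _) h0
    exact (norm_indicator_le_norm_self _ _).trans (hC i p)
  · have h2 : ∀ᵐ p ∂ν, p.2 ≠ t := by
      rw [ae_iff]; simpa using hν2 t
    filter_upwards [h2] with p hp
    exact (continuousAt_indicator_ge hp).tendsto.mul_const _

theorem continuous_tailInfo_inv (hδ : δ ≤ y₀) (hν2 : ∀ c, ν {p | p.2 = c} = 0)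
    (hq : ∀ k, Continuous (q k)) {C : ℝ} (hC : ∀ k p, |q k p| ≤ C)
    (hI : ∀ t ∈ Icc δ y₀, IsUnit (tailInfo ν q t)) :
    Continuous fun t : ℝ => (tailInfo ν q (max δ (min t y₀)))⁻¹ := by
  have h1 : Continuous fun t : ℝ => tailInfo ν q (max δ (min t y₀)) :=
    (continuous_tailInfo hν2 hq hC).comp (by fun_prop)
  simp only [Matrix.inv_def, Ring.inverse_eq_inv']
  refine Continuous.smul (Continuous.inv₀ h1.matrix_det fun t => ?_) h1.matrix_adjugate
  have := hI (max δ (min t y₀)) ⟨le_max_left _ _, max_le hδ (min_le_right _ _)⟩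
  rw [Matrix.isUnit_iff_isUnit_det] at this
  exact this.ne_zero

theorem continuous_weight (hδ : δ ≤ y₀) (hν2 : ∀ c, ν {p | p.2 = c} = 0)
    (hq : ∀ k, Continuous (q k)) {C : ℝ} (hC : ∀ k p, |q k p| ≤ C)
    (hI : ∀ t ∈ Icc δ y₀, IsUnit (tailInfo ν q t)) : Continuous (weight ν q δ y₀) :=
  ((continuous_tailInfo_inv hδ hν2 hq hC hI).comp continuous_snd).matrix_mulVec (continuous_pi hq)

theorem exists_bound_weight (hδ : δ ≤ y₀) (hν2 : ∀ c, ν {p | p.2 = c} = 0)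
    (hq : ∀ k, Continuous (q k)) {C : ℝ} (hC : ∀ k p, |q k p| ≤ C)
    (hI : ∀ t ∈ Icc δ y₀, IsUnit (tailInfo ν q t)) :
    ∃ C', ∀ a i, |weight ν q δ y₀ a i| ≤ C' := by
  have h1 := continuous_tailInfo_inv hδ hν2 hq hC hI
  have h2 : ∀ i j, ∃ B, ∀ t : ℝ, |(tailInfo ν q (max δ (min t y₀)))⁻¹ i j| ≤ B := by
    intro i j
    have hc : ContinuousOn (fun t : ℝ => (tailInfo ν q (max δ (min t y₀)))⁻¹ i j) (Icc δ y₀) :=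
      (h1.matrix_elem i j).continuousOn
    obtain ⟨B, hB⟩ := isCompact_Icc.exists_bound_of_continuousOn hc
    refine ⟨B, fun t => ?_⟩
    have := hB (max δ (min t y₀)) ⟨le_max_left _ _, max_le hδ (min_le_right _ _)⟩
    -- Clamping is idempotent.
    have e : max δ (min (max δ (min t y₀)) y₀) = max δ (min t y₀) := by
      rw [min_eq_left (max_le hδ (min_le_right _ _)), max_eq_right (le_max_left _ _)]
    rw [e] at this
    exact this
  choose B hB using h2
  refine ⟨∑ i, ∑ j, |B i j| * |C|, fun a i => ?_⟩
  calc |weight ν q δ y₀ a i| ≤ ∑ j, |B i j| * |C| := by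
        rw [weight, Matrix.mulVec, dotProduct]
        refine (Finset.abs_sum_le_sum_abs _ _).trans (Finset.sum_le_sum fun j _ => ?_)
        rw [abs_mul]
        exact mul_le_mul ((hB i j _).trans (le_abs_self _)) ((hC j a).trans (le_abs_self _))
          (abs_nonneg _) (abs_nonneg _)
    _ ≤ _ := Finset.single_le_sum (f := fun i => ∑ j, |B i j| * |C|)
        (fun i _ => Finset.sum_nonneg fun j _ => by positivity) (Finset.mem_univ i)

omit [IsFiniteMeasure ν] in
theorem measurable_transformKernel (hw : Measurable (weight ν q δ y₀))
    (hq : ∀ k, Continuous (q k)) :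
    Measurable fun z : (ℝ × ℝ) × (ℝ × ℝ) => transformKernel ν q δ y₀ z.1 z.2 := by
  have e : (fun z : (ℝ × ℝ) × (ℝ × ℝ) => transformKernel ν q δ y₀ z.1 z.2)
      = {z : (ℝ × ℝ) × (ℝ × ℝ) | z.1.2 ≤ z.2.2}.indicator
        fun z => weight ν q δ y₀ z.1 ⬝ᵥ fun i => q i z.2 := by
    ext z
    simp [transformKernel, indicator_apply]
  rw [e]
  refine Measurable.indicator ?_ (measurableSet_le (by fun_prop) (by fun_prop))
  simp only [dotProduct]
  refine Finset.measurable_sum _ fun i _ => Measurable.mul ?_ ((hq i).measurable.comp measurable_snd)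
  exact (measurable_pi_apply i).comp (hw.comp measurable_fst)

omit [IsFiniteMeasure ν] in
theorem exists_bound_transformKernel {C C' : ℝ} (hC : ∀ k p, |q k p| ≤ C)
    (hw : ∀ a i, |weight ν q δ y₀ a i| ≤ C') :
    ∃ C'', ∀ a p, |transformKernel ν q δ y₀ a p| ≤ C'' := by
  refine ⟨∑ _i : ι, |C'| * |C|, fun a p => ?_⟩
  rw [transformKernel]
  refine (norm_indicator_le_norm_self (fun p => weight ν q δ y₀ a ⬝ᵥ fun i => q i p) p).trans ?_
  simp only [dotProduct, Real.norm_eq_abs]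
  refine (Finset.abs_sum_le_sum_abs _ _).trans (Finset.sum_le_sum fun j _ => ?_)
  rw [abs_mul]
  exact mul_le_mul ((hw _ _).trans (le_abs_self _)) ((hC _ _).trans (le_abs_self _))
    (abs_nonneg _) (abs_nonneg _)

omit [IsFiniteMeasure ν] in
theorem weight_dotProduct_tailInfo_mulVec (hI : ∀ t ∈ Icc δ y₀, IsUnit (tailInfo ν q t))
    {a : ℝ × ℝ} (ha : a.2 ∈ Icc δ y₀) (z : ι → ℝ) :
    weight ν q δ y₀ a ⬝ᵥ (tailInfo ν q a.2 *ᵥ z) = (fun i => q i a) ⬝ᵥ z := by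
  have hdet : IsUnit (tailInfo ν q a.2).det := (Matrix.isUnit_iff_isUnit_det _).1 (hI _ ha)
  rw [weight, min_eq_left ha.2, max_eq_right ha.1, Matrix.dotProduct_mulVec, Matrix.vecMul_mulVec,
    Matrix.transpose_nonsing_inv, tailInfo_isSymm, Matrix.nonsing_inv_mul _ hdet, Matrix.vecMul_one]

/-- The integral over `p` of the product of two kernels collapses: the matrix `I` of the larger
of the two second coordinates cancels against one of the two inverse matrices. -/
theorem integral_transformKernel_mul (hq : ∀ k, Continuous (q k)) {C : ℝ}
    (hC : ∀ k p, |q k p| ≤ C) (hI : ∀ t ∈ Icc δ y₀, IsUnit (tailInfo ν q t)) {a b : ℝ × ℝ}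
    (ha : a.2 ∈ Icc δ y₀) (hb : b.2 ∈ Icc δ y₀) (hab : a.2 ≠ b.2) :
    ∫ p, transformKernel ν q δ y₀ a p * transformKernel ν q δ y₀ b p ∂ν
      = transformKernel ν q δ y₀ a b + transformKernel ν q δ y₀ b a := by
  have key : ∀ a b : ℝ × ℝ, a.2 ∈ Icc δ y₀ → b.2 ∈ Icc δ y₀ → a.2 < b.2 →
      ∫ p, transformKernel ν q δ y₀ a p * transformKernel ν q δ y₀ b p ∂ν
      = transformKernel ν q δ y₀ a b + transformKernel ν q δ y₀ b a := by
    intro a b ha hb hab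
    -- The product of the kernels lives on `{p₂ ≥ b₂}`, so integrating it produces `I(b₂)`.
    have h1 : transformKernel ν q δ y₀ b a = 0 :=
      indicator_of_notMem (by simpa using hab) _
    have h2 : transformKernel ν q δ y₀ a b = weight ν q δ y₀ a ⬝ᵥ fun i => q i b :=
      indicator_of_mem (show b ∈ {p : ℝ × ℝ | a.2 ≤ p.2} from hab.le) _
    have h3 : ∀ p, transformKernel ν q δ y₀ a p * transformKernel ν q δ y₀ b p
        = ∑ i, ∑ j, weight ν q δ y₀ b i * weight ν q δ y₀ a j *
          ({p : ℝ × ℝ | b.2 ≤ p.2}.indicator (q i) p * q j p) := by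
      intro p
      by_cases hp : b.2 ≤ p.2
      · have hp' : p ∈ {p : ℝ × ℝ | b.2 ≤ p.2} := hp
        have hp'' : p ∈ {p : ℝ × ℝ | a.2 ≤ p.2} := hab.le.trans hp
        simp only [transformKernel, indicator_of_mem hp', indicator_of_mem hp'', dotProduct]
        rw [mul_comm, Finset.sum_mul_sum]
        refine Finset.sum_congr rfl fun i _ => Finset.sum_congr rfl fun j _ => ?_
        ring
      · have hp' : p ∉ {p : ℝ × ℝ | b.2 ≤ p.2} := hp
        simp [transformKernel, indicator_of_notMem hp']
    have hint : ∀ i j, Integrable (fun p => weight ν q δ y₀ b i * weight ν q δ y₀ a j *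
          ({p : ℝ × ℝ | b.2 ≤ p.2}.indicator (q i) p * q j p)) ν := by
      intro i j
      refine Integrable.const_mul ?_ _
      refine MemLp.integrable_mul (p := 2) (q := 2) ?_ ?_
      · exact memLp_two_of_bound ((hq i).measurable.indicator
          (measurableSet_le measurable_const measurable_snd)) (C := C)
          fun p => (norm_indicator_le_norm_self (q i) p).trans (hC i p)
      · exact memLp_two_of_bound (hq j).measurable (hC j)
    simp only [h3]
    rw [integral_finsetSum _ fun i _ => integrable_finsetSum _ fun j _ => hint i j]
    simp only [integral_finsetSum _ fun j _ => hint _ j, integral_const_mul]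
    have h4 := weight_dotProduct_tailInfo_mulVec hI hb (weight ν q δ y₀ a)
    rw [h1, h2, add_zero, dotProduct_comm, ← h4]
    simp only [dotProduct, Matrix.mulVec, tailInfo, Matrix.of_apply, Finset.mul_sum]
    refine Finset.sum_congr rfl fun i _ => Finset.sum_congr rfl fun j _ => ?_
    ring
  rcases lt_or_gt_of_ne hab with h | h
  · exact key a b ha hb h
  · rw [add_comm, ← key b a hb ha h]
    simp only [mul_comm]

/-- The function `1_A - ∫_A κ(a,·) dν(a)`, whose Wiener integral is the transformed process at the
set `A`. -/
def transformedIndicator (ν : Measure (ℝ × ℝ)) (q : ι → ℝ × ℝ → ℝ) (δ y₀ : ℝ) (A : Set (ℝ × ℝ))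
    (p : ℝ × ℝ) : ℝ :=
  A.indicator 1 p - ∫ a in A, transformKernel ν q δ y₀ a p ∂ν

/-- The map `1_A ↦ 1_A - ∫_A κ(a,·) dν(a)` preserves inner products: in the expansion of the product,
the two mixed terms cancel against the product of the two integrals. -/
theorem integral_transformedIndicator_mul (hδ : δ ≤ y₀) (hν2 : ∀ c, ν {p | p.2 = c} = 0)
    (hq : ∀ k, Continuous (q k)) {C : ℝ} (hC : ∀ k p, |q k p| ≤ C)
    (hI : ∀ t ∈ Icc δ y₀, IsUnit (tailInfo ν q t)) {A B : Set (ℝ × ℝ)} (hA : MeasurableSet A)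
    (hB : MeasurableSet B) (hA2 : ∀ a ∈ A, a.2 ∈ Icc δ y₀) (hB2 : ∀ a ∈ B, a.2 ∈ Icc δ y₀) :
    ∫ p, transformedIndicator ν q δ y₀ A p * transformedIndicator ν q δ y₀ B p ∂ν
      = ν.real (A ∩ B) := by
  obtain ⟨C', hC'⟩ := exists_bound_weight hδ hν2 hq hC hI
  obtain ⟨K, hK⟩ := exists_bound_transformKernel hC hC'
  have hm := measurable_transformKernel (continuous_weight hδ hν2 hq hC hI).measurable hq
  set κ := transformKernel ν q δ y₀ with hκ
  set kA : ℝ × ℝ → ℝ := fun p => ∫ a in A, κ a p ∂ν with hkA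
  set kB : ℝ × ℝ → ℝ := fun p => ∫ a in B, κ a p ∂ν with hkB
  have hkm : ∀ s : Set (ℝ × ℝ), AEStronglyMeasurable (fun p => ∫ a in s, κ a p ∂ν) ν := fun s =>
    (hm.comp measurable_swap).stronglyMeasurable.integral_prod_right'.aestronglyMeasurable
  have hkb : ∀ (s : Set (ℝ × ℝ)) p, ‖∫ a in s, κ a p ∂ν‖ ≤ K * (ν.restrict s).real univ := fun s p =>
    norm_integral_le_of_norm_le_const (Eventually.of_forall fun a => hK a p)
  have hkL : ∀ s : Set (ℝ × ℝ), MemLp (fun p => ∫ a in s, κ a p ∂ν) 2 ν := fun s =>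
    MemLp.of_bound (hkm s) _ (Eventually.of_forall (hkb s))
  have hone : ∀ {s : Set (ℝ × ℝ)}, MeasurableSet s → MemLp (s.indicator (1 : ℝ × ℝ → ℝ)) 2 ν :=
    fun hs => memLp_two_of_bound (measurable_one.indicator hs) (C := 1)
      fun p => by simpa using norm_indicator_le_norm_self (1 : ℝ × ℝ → ℝ) p (s := _)
  have hAB : ∫ p, A.indicator (1 : ℝ × ℝ → ℝ) p * B.indicator (1 : ℝ × ℝ → ℝ) p ∂ν
      = ν.real (A ∩ B) := by
    rw [← integral_indicator_one (hA.inter hB), inter_indicator_one]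
    rfl
  have h1 : ∀ {s : Set (ℝ × ℝ)} (hs : MeasurableSet s) (f : ℝ × ℝ → ℝ),
      ∫ p, s.indicator (1 : ℝ × ℝ → ℝ) p * f p ∂ν = ∫ p in s, f p ∂ν := by
    intro s hs f
    rw [← integral_indicator hs]
    congr 1; ext p
    by_cases hp : p ∈ s <;> simp [hp]
  have hkint : ∀ s s' : Set (ℝ × ℝ), Integrable (fun z : (ℝ × ℝ) × (ℝ × ℝ) => κ z.1 z.2)
      ((ν.restrict s).prod (ν.restrict s')) := fun s s' =>
    Integrable.of_bound hm.aestronglyMeasurable K (Eventually.of_forall fun z => hK _ _)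
  have hkint' : ∀ s s' : Set (ℝ × ℝ), Integrable (fun z : (ℝ × ℝ) × (ℝ × ℝ) => κ z.2 z.1)
      ((ν.restrict s).prod (ν.restrict s')) := fun s s' =>
    Integrable.of_bound (hm.comp measurable_swap).aestronglyMeasurable K
      (Eventually.of_forall fun z => hK _ _)
  -- The kernel identity fails only on `a₂ = b₂`, which is null since lines have measure zero.
  have hdiag : ∀ᵐ z ∂((ν.restrict A).prod (ν.restrict B)), z.1.2 ≠ z.2.2 := by
    have hms : MeasurableSet {z : (ℝ × ℝ) × (ℝ × ℝ) | z.1.2 = z.2.2} :=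
      measurableSet_eq_fun (by fun_prop) (by fun_prop)
    rw [ae_iff]
    simp only [ne_eq, not_not]
    rw [Measure.measure_prod_null hms]
    refine Eventually.of_forall fun a => ?_
    refine le_antisymm ((Measure.restrict_apply_le B _).trans ?_) zero_le
    refine le_of_eq ((congrArg ν ?_).trans (hν2 a.2))
    ext p
    exact eq_comm
  have hmemA : ∀ᵐ z ∂((ν.restrict A).prod (ν.restrict B)), z.1 ∈ A ∧ z.2 ∈ B := by
    rw [Measure.prod_restrict]
    exact ae_restrict_mem (hA.prod hB)
  have hKK : ∫ p, kA p * kB p ∂ν = ∫ p in B, kA p ∂ν + ∫ p in A, kB p ∂ν := by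
    have e1 : ∀ p, kA p * kB p
        = ∫ z, κ z.1 p * κ z.2 p ∂((ν.restrict A).prod (ν.restrict B)) := fun p =>
      (integral_prod_mul (fun a => κ a p) (fun b => κ b p)).symm
    have hint : Integrable (fun w : (ℝ × ℝ) × ((ℝ × ℝ) × (ℝ × ℝ)) => κ w.2.1 w.1 * κ w.2.2 w.1)
        (ν.prod ((ν.restrict A).prod (ν.restrict B))) := by
      refine Integrable.of_bound (C := K * K) ?_ (Eventually.of_forall fun w => ?_)
      · exact ((hm.comp (f := fun w : (ℝ × ℝ) × ((ℝ × ℝ) × (ℝ × ℝ)) => (w.2.1, w.1))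
          (by fun_prop)).mul (hm.comp (f := fun w : (ℝ × ℝ) × ((ℝ × ℝ) × (ℝ × ℝ)) => (w.2.2, w.1))
          (by fun_prop))).aestronglyMeasurable
      · rw [norm_mul]
        exact mul_le_mul (hK _ _) (hK _ _) (norm_nonneg _) ((abs_nonneg _).trans (hK w.2.1 w.1))
    simp only [e1]
    rw [integral_integral_swap (f := fun p (z : (ℝ × ℝ) × (ℝ × ℝ)) => κ z.1 p * κ z.2 p) hint]
    have e2 : ∫ z, ∫ p, κ z.1 p * κ z.2 p ∂ν ∂((ν.restrict A).prod (ν.restrict B))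
        = ∫ z, (κ z.1 z.2 + κ z.2 z.1) ∂((ν.restrict A).prod (ν.restrict B)) := by
      refine integral_congr_ae ?_
      filter_upwards [hdiag, hmemA] with z hz hz'
      exact integral_transformKernel_mul hq hC hI (hA2 _ hz'.1) (hB2 _ hz'.2) hz
    rw [e2, integral_add (hkint A B) (hkint' A B), integral_prod_symm _ (hkint A B),
      integral_prod _ (hkint' A B)]
  have hexp : ∀ p, transformedIndicator ν q δ y₀ A p * transformedIndicator ν q δ y₀ B p
      = A.indicator (1 : ℝ × ℝ → ℝ) p * B.indicator (1 : ℝ × ℝ → ℝ) p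
        - A.indicator (1 : ℝ × ℝ → ℝ) p * kB p - B.indicator (1 : ℝ × ℝ → ℝ) p * kA p
        + kA p * kB p := by
    intro p
    simp only [transformedIndicator, kA, kB, κ]
    ring
  simp only [hexp]
  have i1 : Integrable (fun p => A.indicator (1 : ℝ × ℝ → ℝ) p * B.indicator 1 p) ν :=
    (hone hA).integrable_mul (hone hB)
  have i2 : Integrable (fun p => A.indicator (1 : ℝ × ℝ → ℝ) p * kB p) ν :=
    (hone hA).integrable_mul (hkL B)
  have i3 : Integrable (fun p => B.indicator (1 : ℝ × ℝ → ℝ) p * kA p) ν :=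
    (hone hB).integrable_mul (hkL A)
  have i4 : Integrable (fun p => kA p * kB p) ν := (hkL A).integrable_mul (hkL B)
  have i5 : Integrable (fun p => A.indicator (1 : ℝ × ℝ → ℝ) p * B.indicator 1 p
      - A.indicator (1 : ℝ × ℝ → ℝ) p * kB p) ν := i1.sub i2
  have i6 : Integrable (fun p => A.indicator (1 : ℝ × ℝ → ℝ) p * B.indicator 1 p
      - A.indicator (1 : ℝ × ℝ → ℝ) p * kB p - B.indicator (1 : ℝ × ℝ → ℝ) p * kA p) ν := i5.sub i3
  rw [integral_add i6 i4, integral_sub i5 i3, integral_sub i1 i2,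
    hAB, h1 hA, h1 hB, hKK]
  ring

end

section

variable {ι : Type*} [Fintype ι] [DecidableEq ι] {ν : Measure (ℝ × ℝ)} [IsFiniteMeasure ν]
    {q : ι → ℝ × ℝ → ℝ} {δ y₀ T : ℝ} {P : Measure Ω}
    {V η : ℝ → ℝ → Ω → ℝ} {W : Lp ℝ 2 ν →ₗᵢ[ℝ] Lp ℝ 2 P} {Z : ι → Ω → ℝ}

omit [Fintype ι] [DecidableEq ι] in
theorem memLp_indicator_tail (hq : ∀ k, Continuous (q k)) {C : ℝ} (hC : ∀ k p, |q k p| ≤ C)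
    (t : ℝ) (i : ι) : MemLp ({p : ℝ × ℝ | t ≤ p.2}.indicator (q i)) 2 ν :=
  memLp_two_of_bound ((hq i).measurable.indicator
    (measurableSet_le measurable_const measurable_snd)) (C := C)
    fun p => (norm_indicator_le_norm_self (q i) p).trans (hC i p)

omit [DecidableEq ι] in
/-- The Wiener part depends continuously on `t` in `L²(P)`, since horizontal lines are null, and the
drift part is continuous in `t` for each `ω`. -/
theorem exists_measurable_limitIntegral [IsProbabilityMeasure P] (hν2 : ∀ c, ν {p | p.2 = c} = 0)
    (hq : ∀ k, Continuous (q k)) {C : ℝ} (hC : ∀ k p, |q k p| ≤ C) (hZ : ∀ k, Measurable (Z k))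
    (hψ : ∀ t i, MemLp ({p : ℝ × ℝ | t ≤ p.2}.indicator (q i)) 2 ν) :
    ∃ J : ℝ → Ω → ι → ℝ, Measurable (fun p : ℝ × Ω => J p.1 p.2) ∧
      ∀ t ∈ Icc δ T, ∀ i, (fun ω => J t ω i) =ᵐ[P] limitIntegral W q Z (hψ t i) := by
  have hcont : ∀ i, Continuous fun t => W (hψ t i).toLp := by
    intro i
    refine W.continuous.comp (continuous_toLp (C := C) (fun t => (hq i).measurable.indicator
      (measurableSet_le measurable_const measurable_snd)) (fun t p =>
        (norm_indicator_le_norm_self (q i) p).trans (hC i p)) (fun t => ?_) (fun t => hψ t i))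
    have h2 : ∀ᵐ p ∂ν, p.2 ≠ t := by
      rw [ae_iff]; simpa using hν2 t
    filter_upwards [h2] with p hp
    exact continuousAt_indicator_ge hp
  choose J hJm hJ using fun i => exists_measurable_version (P := P) (hcont i) δ T
  refine ⟨fun t ω i => J i t ω + ∑ k, Z k ω * tailInfo ν q t i k, ?_, fun t ht i => ?_⟩
  · refine measurable_pi_lambda _ fun i => (hJm i).add (Finset.measurable_sum _ fun k _ => ?_)
    refine ((hZ k).comp measurable_snd).mul ?_
    exact ((continuous_tailInfo hν2 hq hC).matrix_elem i k).measurable.comp measurable_fst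
  · filter_upwards [hJ i t ht] with ω hω
    rw [hω]
    rfl

/-- The inner integral `Y = W(q 1_{v ≥ t}) + I(t) Z`, multiplied by `qᵀ I⁻¹(t)`, is the Wiener integral
of the kernel plus `qᵀ Z`. -/
theorem wienerIntegral_transformKernel (hI : ∀ t ∈ Icc δ y₀, IsUnit (tailInfo ν q t))
    (hψ : ∀ t i, MemLp ({p : ℝ × ℝ | t ≤ p.2}.indicator (q i)) 2 ν) {a : ℝ × ℝ}
    (ha : a.2 ∈ Icc δ y₀) (hκ : MemLp (transformKernel ν q δ y₀ a) 2 ν) {Y : Ω → ι → ℝ}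
    (hY : ∀ i, (fun ω => Y ω i) =ᵐ[P] limitIntegral W q Z (hψ a.2 i)) :
    (fun ω => weight ν q δ y₀ a ⬝ᵥ Y ω - (fun i => q i a) ⬝ᵥ fun k => Z k ω)
      =ᵐ[P] W hκ.toLp := by
  have hdec : hκ.toLp = ∑ i, weight ν q δ y₀ a i • (hψ a.2 i).toLp := by
    refine Lp.ext ?_
    have h1 : ∀ᵐ p ∂ν, ∀ i, (weight ν q δ y₀ a i • (hψ a.2 i).toLp : Lp ℝ 2 ν) p
        = weight ν q δ y₀ a i * {p : ℝ × ℝ | a.2 ≤ p.2}.indicator (q i) p := by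
      rw [eventually_all]
      intro i
      filter_upwards [Lp.coeFn_smul (weight ν q δ y₀ a i) (hψ a.2 i).toLp, (hψ a.2 i).coeFn_toLp]
        with p h1 h2
      rw [h1, Pi.smul_apply, h2, smul_eq_mul]
    filter_upwards [hκ.coeFn_toLp, h1, Lp.coeFn_finsetSum Finset.univ
      (fun i => weight ν q δ y₀ a i • (hψ a.2 i).toLp)] with p h2 h1 h3
    rw [h2, h3, Finset.sum_apply, Finset.sum_congr rfl fun i _ => h1 i]
    by_cases hp : p ∈ {p : ℝ × ℝ | a.2 ≤ p.2}
    · simp [transformKernel, indicator_of_mem hp, dotProduct]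
    · simp [transformKernel, indicator_of_notMem hp]
  have h1 : ∀ᵐ ω ∂P, ∀ i, (weight ν q δ y₀ a i • W (hψ a.2 i).toLp : Lp ℝ 2 P) ω
      = weight ν q δ y₀ a i * W (hψ a.2 i).toLp ω := by
    rw [eventually_all]
    intro i
    filter_upwards [Lp.coeFn_smul (weight ν q δ y₀ a i) (W (hψ a.2 i).toLp)] with p h1
    rw [h1, Pi.smul_apply, smul_eq_mul]
  have hY' : ∀ᵐ ω ∂P, ∀ i, Y ω i = limitIntegral W q Z (hψ a.2 i) ω := eventually_all.2 hY
  rw [hdec, map_sum]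
  simp only [map_smul]
  filter_upwards [h1, hY', Lp.coeFn_finsetSum Finset.univ
      (fun i => weight ν q δ y₀ a i • W (hψ a.2 i).toLp)] with ω h1 h2 h3
  rw [h3, Finset.sum_apply, Finset.sum_congr rfl fun i _ => h1 i]
  have e : Y ω = (fun i => W (hψ a.2 i).toLp ω) + tailInfo ν q a.2 *ᵥ fun k => Z k ω := by
    ext i
    rw [h2 i, limitIntegral, Pi.add_apply]
    congr 1
    simp only [Matrix.mulVec, dotProduct, tailInfo, Matrix.of_apply]
    exact Finset.sum_congr rfl fun k _ => mul_comm _ _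
  rw [e, dotProduct_add, weight_dotProduct_tailInfo_mulVec hI ha, add_sub_cancel_right]
  rfl

theorem memLp_transformedIndicator (hδ : δ ≤ y₀) (hν2 : ∀ c, ν {p | p.2 = c} = 0)
    (hq : ∀ k, Continuous (q k)) {C : ℝ} (hC : ∀ k p, |q k p| ≤ C)
    (hI : ∀ t ∈ Icc δ y₀, IsUnit (tailInfo ν q t)) {A : Set (ℝ × ℝ)} (hA : MeasurableSet A) :
    MemLp (A.indicator (1 : ℝ × ℝ → ℝ)) 2 ν ∧
      MemLp (fun p => ∫ a in A, transformKernel ν q δ y₀ a p ∂ν) 2 ν ∧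
      MemLp (transformedIndicator ν q δ y₀ A) 2 ν := by
  obtain ⟨C', hC'⟩ := exists_bound_weight hδ hν2 hq hC hI
  obtain ⟨K, hK⟩ := exists_bound_transformKernel hC hC'
  have hm := measurable_transformKernel (continuous_weight hδ hν2 hq hC hI).measurable hq
  have h1 : MemLp (A.indicator (1 : ℝ × ℝ → ℝ)) 2 ν :=
    memLp_two_of_bound (measurable_one.indicator hA) (C := 1)
      fun p => by simpa using norm_indicator_le_norm_self (1 : ℝ × ℝ → ℝ) p (s := A)
  have h2 : MemLp (fun p => ∫ a in A, transformKernel ν q δ y₀ a p ∂ν) 2 ν :=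
    MemLp.of_bound
      (hm.comp measurable_swap).stronglyMeasurable.integral_prod_right'.aestronglyMeasurable _
      (Eventually.of_forall fun p =>
        norm_integral_le_of_norm_le_const (Eventually.of_forall fun a => hK a p))
  exact ⟨h1, h2, h1.sub h2⟩

/-- The drift `∑ Zᵢ ∫_A qᵢ dν` of `η` cancels against the part of the compensator that comes from
the drift of the inner integral, and the transformed process at a box `A` is the Wiener integral
of `1_A - ∫_A κ(a,·) dν(a)`. -/
theorem transformed_ae_eq [IsProbabilityMeasure P] (hδ : δ ≤ y₀) (hyT : y₀ < T)
    (hν1 : ∀ c, ν {p | p.1 = c} = 0) (hν2 : ∀ c, ν {p | p.2 = c} = 0)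
    (hW : ∀ x ∈ Icc δ T, ∀ y ∈ Icc δ T, W (boxLp ν δ (x, y)) =ᵐ[P] rectIncr V δ x δ y)
    (hq : ∀ k, Continuous (q k)) {C : ℝ} (hC : ∀ k p, |q k p| ≤ C)
    (hI : ∀ t ∈ Icc δ y₀, IsUnit (tailInfo ν q t)) (hZ : ∀ k, Measurable (Z k))
    (hη : ∀ a b c e, δ ≤ a → a ≤ b → b ≤ T → δ ≤ c → c ≤ e → e ≤ T → ∀ ω,
      rectIncr η a b c e ω = rectIncr V a b c e ω
        + ∑ k, Z k ω * ∫ p in Ioc a b ×ˢ Ioc c e, q k p ∂ν)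
    (hψ : ∀ t i, MemLp ({p : ℝ × ℝ | t ≤ p.2}.indicator (q i)) 2 ν)
    {J : ℝ → Ω → ι → ℝ} (hJm : Measurable (fun p : ℝ × Ω => J p.1 p.2))
    (hJ : ∀ t ∈ Ico δ T, ∀ i, (fun ω => J t ω i) =ᵐ[P] limitIntegral W q Z (hψ t i))
    {x y : ℝ} (hx : x ∈ Icc δ T) (hy : y ∈ Icc δ y₀)
    (hL : MemLp (transformedIndicator ν q δ y₀ (Icc δ x ×ˢ Icc δ y)) 2 ν) :
    (∀ᵐ ω ∂P, IntegrableOn (fun a => weight ν q δ y₀ a ⬝ᵥ J a.2 ω) (Icc δ x ×ˢ Icc δ y) ν) ∧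
    (fun ω => rectIncr η δ x δ y ω
      - ∫ a in Icc δ x ×ˢ Icc δ y, weight ν q δ y₀ a ⬝ᵥ J a.2 ω ∂ν) =ᵐ[P] W hL.toLp := by
  set A := Icc δ x ×ˢ Icc δ y with hAdef
  have hA : MeasurableSet A := measurableSet_Icc.prod measurableSet_Icc
  obtain ⟨C', hC'⟩ := exists_bound_weight hδ hν2 hq hC hI
  obtain ⟨K, hK⟩ := exists_bound_transformKernel hC hC'
  have hw := (continuous_weight hδ hν2 hq hC hI).measurable
  have hm := measurable_transformKernel hw hq
  obtain ⟨h1A, hKA, -⟩ := memLp_transformedIndicator hδ hν2 hq hC hI hA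
  have hκL : ∀ a, MemLp (transformKernel ν q δ y₀ a) 2 ν := fun a =>
    memLp_two_of_bound (hm.comp (measurable_const.prodMk measurable_id)) (hK a)
  have hA2 : ∀ a ∈ A, a.2 ∈ Icc δ y₀ := fun a ha => ⟨ha.2.1, ha.2.2.trans hy.2⟩
  have hD : Measurable fun z : (ℝ × ℝ) × Ω =>
      weight ν q δ y₀ z.1 ⬝ᵥ J z.1.2 z.2 - (fun i => q i z.1) ⬝ᵥ fun k => Z k z.2 := by
    simp only [dotProduct]
    refine (Finset.measurable_sum _ fun i _ => Measurable.mul ?_ ?_).sub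
      (Finset.measurable_sum _ fun i _ => Measurable.mul ?_ ?_)
    · exact (measurable_pi_apply i).comp (hw.comp measurable_fst)
    · exact (measurable_pi_apply i).comp (hJm.comp (f := fun z : (ℝ × ℝ) × Ω => (z.1.2, z.2))
        (by fun_prop))
    · exact (hq i).measurable.comp measurable_fst
    · exact (hZ i).comp measurable_snd
  -- Fubini applies to the integrand minus its drift `qᵀ Z`, for which no integrability in `ω` is
  -- available.
  obtain ⟨hint, heq⟩ := stochastic_fubini W (ρ := ν.restrict A) hm hK hκL hKA
    (D := fun a ω => weight ν q δ y₀ a ⬝ᵥ J a.2 ω - (fun i => q i a) ⬝ᵥ fun k => Z k ω) hD (by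
      filter_upwards [ae_restrict_mem hA] with a ha
      have ha2 := hA2 a ha
      exact wienerIntegral_transformKernel hI hψ ha2 (hκL a)
        (hJ a.2 ⟨ha2.1, ha2.2.trans_lt hyT⟩))
  have hqi : ∀ k, Integrable (q k) ν := fun k =>
    (memLp_two_of_bound (hq k).measurable (hC k)).integrable (by norm_num)
  have hqA : ∀ ω, Integrable (fun a => (fun i => q i a) ⬝ᵥ fun k => Z k ω) (ν.restrict A) := by
    intro ω
    simp only [dotProduct]
    exact integrable_finsetSum _ fun k _ => ((hqi k).mul_const _).restrict
  have hint' : ∀ᵐ ω ∂P, IntegrableOn (fun a => weight ν q δ y₀ a ⬝ᵥ J a.2 ω) A ν := by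
    filter_upwards [hint] with ω hω
    exact (hω.add (hqA ω)).congr (Eventually.of_forall fun a => by simp)
  refine ⟨hint', ?_⟩
  have hbox : h1A.toLp = boxLp ν δ (x, y) := by
    refine Lp.ext ?_
    filter_upwards [h1A.coeFn_toLp, indicatorConstLp_coeFn (p := 2) (μ := ν) (hs := hA)
      (hμs := measure_ne_top ν A) (c := (1 : ℝ))] with p h1 h2
    rw [h1]
    exact h2.symm
  have hdec : hL.toLp = h1A.toLp - hKA.toLp := rfl
  have hIoc : ∀ k, ∫ p in Ioc δ x ×ˢ Ioc δ y, q k p ∂ν = ∫ p in A, q k p ∂ν := by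
    intro k
    have h1 : ∀ᵐ p ∂ν, p.1 ≠ δ := by
      rw [ae_iff]; simpa using hν1 δ
    have h2 : ∀ᵐ p ∂ν, p.2 ≠ δ := by
      rw [ae_iff]; simpa using hν2 δ
    refine setIntegral_congr_set ?_
    filter_upwards [h1, h2] with p h1 h2
    exact propext ⟨fun h => ⟨⟨h.1.1.le, h.1.2⟩, h.2.1.le, h.2.2⟩, fun h =>
      ⟨⟨lt_of_le_of_ne h.1.1 (Ne.symm h1), h.1.2⟩, lt_of_le_of_ne h.2.1 (Ne.symm h2), h.2.2⟩⟩
  have hyT' : y ≤ T := hy.2.trans hyT.le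
  rw [hdec, map_sub]
  filter_upwards [Lp.coeFn_sub (W h1A.toLp) (W hKA.toLp), heq, hint', hbox ▸ hW x hx y ⟨hy.1, hyT'⟩]
    with ω h1 h2 h3 h4
  rw [h1, Pi.sub_apply, ← h2, integral_sub h3 (hqA ω), h4,
    hη δ x δ y le_rfl hx.1 hx.2 le_rfl hy.1 hyT']
  simp only [dotProduct, hIoc]
  rw [integral_finsetSum _ fun k _ => ((hqi k).mul_const _).restrict]
  simp only [integral_mul_const, mul_comm]
  ring

end

end

/-! ### Tail measures in the plane -/

/-- The singular part does not charge `[0,∞)²` and is lost in the restriction to the plane. -/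
theorem planar_eq_withDensity {μ : Measure (ℝ≥0∞ × ℝ≥0∞)} {r : ℝ → ℝ → ℝ}
    (h : HasPositiveTailDensity μ r) :
    planar μ = (volume.restrict (Ioi 0 ×ˢ Ioi 0)).withDensity
      fun p : ℝ × ℝ => ENNReal.ofReal (r p.1 p.2) := by
  obtain ⟨-, -, μc, μs, rfl, hs, hc⟩ := h
  have hE : MeasurableSet (Iio (⊤ : ℝ≥0∞) ×ˢ Iio (⊤ : ℝ≥0∞)) :=
    measurableSet_Iio.prod measurableSet_Iio
  have hg : Measurable fun p : ℝ × ℝ => (ENNReal.ofReal p.1, ENNReal.ofReal p.2) := by fun_prop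
  have hφ : Measurable fun p : ℝ≥0∞ × ℝ≥0∞ => (p.1.toReal, p.2.toReal) := by fun_prop
  rw [planar, Measure.restrict_add, Measure.restrict_eq_zero.2 hs, add_zero, hc,
    Measure.restrict_map hg hE, Measure.map_map hφ hg]
  have hpre : (fun p : ℝ × ℝ => (ENNReal.ofReal p.1, ENNReal.ofReal p.2)) ⁻¹'
      (Iio (⊤ : ℝ≥0∞) ×ˢ Iio (⊤ : ℝ≥0∞)) = univ := by
    ext p; simp
  rw [hpre, Measure.restrict_univ]
  conv_rhs => rw [← Measure.map_id (μ := (volume.restrict (Ioi 0 ×ˢ Ioi 0)).withDensity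
      fun p : ℝ × ℝ => ENNReal.ofReal (r p.1 p.2))]
  refine Measure.map_congr ?_
  refine (withDensity_absolutelyContinuous _ _).ae_le ?_
  filter_upwards [ae_restrict_mem (measurableSet_Ioi.prod measurableSet_Ioi)] with p hp
  have h1 : (0 : ℝ) < p.1 := hp.1
  have h2 : (0 : ℝ) < p.2 := hp.2
  simp [h1.le, h2.le]

theorem planar_Iic {R : ℝ≥0∞ → ℝ≥0∞ → ℝ≥0∞} {μ : Measure (ℝ≥0∞ × ℝ≥0∞)}
    (hμ : IsTailMeasure R μ) {x y : ℝ} (hx : 0 ≤ x) (hy : 0 ≤ y) :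
    planar μ (Iic x ×ˢ Iic y) = R (ENNReal.ofReal x) (ENNReal.ofReal y) := by
  have hφ : Measurable fun p : ℝ≥0∞ × ℝ≥0∞ => (p.1.toReal, p.2.toReal) := by fun_prop
  rw [planar, Measure.map_apply hφ (measurableSet_Iic.prod measurableSet_Iic),
    Measure.restrict_apply (hφ (measurableSet_Iic.prod measurableSet_Iic)),
    ← hμ.2 _ _ (by simp)]
  congr 1
  ext p
  simp only [mem_inter_iff, mem_preimage, mem_prod, mem_Iic, mem_Iio]
  constructor
  · rintro ⟨⟨h1, h2⟩, h3, h4⟩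
    exact ⟨(ENNReal.le_ofReal_iff_toReal_le h3.ne hx).2 h1,
      (ENNReal.le_ofReal_iff_toReal_le h4.ne hy).2 h2⟩
  · rintro ⟨h1, h2⟩
    have h3 := h1.trans_lt ENNReal.ofReal_lt_top
    have h4 := h2.trans_lt ENNReal.ofReal_lt_top
    exact ⟨⟨(ENNReal.le_ofReal_iff_toReal_le h3.ne hx).1 h1,
      (ENNReal.le_ofReal_iff_toReal_le h4.ne hy).1 h2⟩, h3, h4⟩

theorem planar_Iic_ne_top {R : ℝ≥0∞ → ℝ≥0∞ → ℝ≥0∞} {μ : Measure (ℝ≥0∞ × ℝ≥0∞)}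
    (hR : IsTailCopula R) (hμ : IsTailMeasure R μ) {x y : ℝ} (hx : 0 ≤ x) (hy : 0 ≤ y) :
    planar μ (Iic x ×ˢ Iic y) ≠ ⊤ := by
  obtain ⟨F, G, -, -, -, h⟩ := hR
  rw [planar_Iic hμ hx hy]
  exact (h _ _ (by simp)).1

/-- The increments of a tail copula over rectangles are given by the measure it generates. -/
theorem tailFun_increment {R : ℝ≥0∞ → ℝ≥0∞ → ℝ≥0∞} {μ : Measure (ℝ≥0∞ × ℝ≥0∞)}
    (hR : IsTailCopula R) (hμ : IsTailMeasure R μ) {a b c e : ℝ} (ha : 0 ≤ a) (hab : a ≤ b)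
    (hc : 0 ≤ c) (hce : c ≤ e) :
    tailFun R b e - tailFun R a e - tailFun R b c + tailFun R a c
      = (planar μ).real (Ioc a b ×ˢ Ioc c e) := by
  have hb := ha.trans hab
  have he := hc.trans hce
  have htf : ∀ {x y : ℝ}, 0 ≤ x → 0 ≤ y → tailFun R x y = (planar μ).real (Iic x ×ˢ Iic y) :=
    fun hx hy => by rw [tailFun, Measure.real, planar_Iic hμ hx hy]
  have hstrip : ∀ {y : ℝ}, 0 ≤ y → (planar μ).real (Ioc a b ×ˢ Iic y)
      = tailFun R b y - tailFun R a y := by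
    intro y hy
    rw [htf hb hy, htf ha hy, ← measureReal_sdiff (prod_mono (Iic_subset_Iic.2 hab) le_rfl)
      (measurableSet_Iic.prod measurableSet_Iic) (planar_Iic_ne_top hR hμ hb hy)]
    congr 1
    ext p
    simp only [mem_prod, mem_Ioc, mem_Iic, Set.mem_sdiff]
    constructor
    · rintro ⟨⟨h1, h2⟩, h3⟩
      exact ⟨⟨h2, h3⟩, fun h => absurd h.1 (not_le.2 h1)⟩
    · rintro ⟨⟨h1, h2⟩, h3⟩
      exact ⟨⟨not_le.1 fun h => h3 ⟨h, h2⟩, h1⟩, h2⟩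
  have hfin : planar μ (Ioc a b ×ˢ Iic e) ≠ ⊤ :=
    ne_top_of_le_ne_top (planar_Iic_ne_top hR hμ hb he)
      (measure_mono (prod_mono Ioc_subset_Iic_self le_rfl))
  have hd : Ioc a b ×ˢ Ioc c e = (Ioc a b ×ˢ Iic e) \ (Ioc a b ×ˢ Iic c) := by
    ext p
    simp only [mem_prod, mem_Ioc, mem_Iic, Set.mem_sdiff]
    constructor
    · rintro ⟨h1, h2, h3⟩
      exact ⟨⟨h1, h3⟩, fun h => absurd h.2 (not_le.2 h2)⟩
    · rintro ⟨⟨h1, h2⟩, h3⟩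
      exact ⟨h1, not_le.1 fun h => h3 ⟨h1, h⟩, h2⟩
  rw [hd, measureReal_sdiff (prod_mono le_rfl (Iic_subset_Iic.2 hce))
    (measurableSet_Ioc.prod measurableSet_Iic) hfin, hstrip he, hstrip hc]
  ring

theorem Ioc_prod_subset_quadrant {a b c e : ℝ} (ha : 0 ≤ a) (hc : 0 ≤ c) :
    Ioc a b ×ˢ Ioc c e ⊆ (Ioi 0 ×ˢ Ioi 0 : Set (ℝ × ℝ)) := fun _ hp =>
  ⟨ha.trans_lt hp.1.1, hc.trans_lt hp.2.1⟩

theorem setIntegral_planar {μ : Measure (ℝ≥0∞ × ℝ≥0∞)} {r : ℝ → ℝ → ℝ}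
    (h : HasPositiveTailDensity μ r) {s : Set (ℝ × ℝ)} (hs : MeasurableSet s)
    (hsub : s ⊆ Ioi 0 ×ˢ Ioi 0) (g : ℝ × ℝ → ℝ) :
    ∫ p in s, g p ∂(planar μ) = ∫ p in s, r p.1 p.2 * g p := by
  rw [planar_eq_withDensity h, setIntegral_withDensity_eq_setIntegral_toReal_smul₀ (s := s)
    (h.2.1.ennreal_ofReal.restrict) (Eventually.of_forall fun _ => ENNReal.ofReal_lt_top) g hs,
    Measure.restrict_restrict hs, inter_eq_self_of_subset_left hsub]
  refine setIntegral_congr_fun hs fun p hp => ?_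
  have := h.1 p.1 (hsub hp).1 p.2 (hsub hp).2
  simp [ENNReal.toReal_ofReal this.le]

theorem planar_real_eq_setIntegral {μ : Measure (ℝ≥0∞ × ℝ≥0∞)} {r : ℝ → ℝ → ℝ}
    (h : HasPositiveTailDensity μ r) {s : Set (ℝ × ℝ)} (hs : MeasurableSet s)
    (hsub : s ⊆ Ioi 0 ×ˢ Ioi 0) : (planar μ).real s = ∫ p in s, r p.1 p.2 := by
  have := setIntegral_planar h hs hsub (fun _ => 1)
  simpa using this

theorem integrableOn_tailDensity {R : ℝ≥0∞ → ℝ≥0∞ → ℝ≥0∞} {μ : Measure (ℝ≥0∞ × ℝ≥0∞)}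
    (hR : IsTailCopula R) (hμ : IsTailMeasure R μ) {r : ℝ → ℝ → ℝ}
    (h : HasPositiveTailDensity μ r) {a b c e : ℝ} (ha : 0 ≤ a) (hb : 0 ≤ b)
    (hc : 0 ≤ c) (he : 0 ≤ e) :
    IntegrableOn (fun p : ℝ × ℝ => r p.1 p.2) (Ioc a b ×ˢ Ioc c e) := by
  have hs : MeasurableSet (Ioc a b ×ˢ Ioc c e) := measurableSet_Ioc.prod measurableSet_Ioc
  have hsub := Ioc_prod_subset_quadrant (b := b) (e := e) ha hc
  have hfin : planar μ (Ioc a b ×ˢ Ioc c e) ≠ ⊤ :=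
    ne_top_of_le_ne_top (planar_Iic_ne_top hR hμ hb he)
      (measure_mono (prod_mono Ioc_subset_Iic_self Ioc_subset_Iic_self))
  rw [planar_eq_withDensity h, withDensity_apply _ hs, Measure.restrict_restrict hs,
    inter_eq_self_of_subset_left hsub] at hfin
  refine ⟨(h.2.1.mono_measure (Measure.restrict_mono hsub le_rfl)).aestronglyMeasurable, ?_⟩
  rw [hasFiniteIntegral_iff_enorm]
  refine lt_of_le_of_lt (le_of_eq ?_) (lt_top_iff_ne_top.2 hfin)
  refine setLIntegral_congr_fun hs fun p hp => ?_
  exact Real.enorm_of_nonneg (h.1 p.1 (hsub hp).1 p.2 (hsub hp).2).le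

theorem planar_line_eq_zero {μ : Measure (ℝ≥0∞ × ℝ≥0∞)} {r : ℝ → ℝ → ℝ}
    (h : HasPositiveTailDensity μ r) (c : ℝ) :
    planar μ {p | p.1 = c} = 0 ∧ planar μ {p | p.2 = c} = 0 := by
  rw [planar_eq_withDensity h]
  have hac := (withDensity_absolutelyContinuous (volume.restrict (Ioi 0 ×ˢ Ioi 0))
    (fun p : ℝ × ℝ => ENNReal.ofReal (r p.1 p.2))).trans Measure.restrict_le_self.absolutelyContinuous
  constructor
  · refine hac ?_
    have : {p : ℝ × ℝ | p.1 = c} = {c} ×ˢ univ := by ext p; simp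
    rw [this, Measure.volume_eq_prod, Measure.prod_prod]
    simp
  · refine hac ?_
    have : {p : ℝ × ℝ | p.2 = c} = univ ×ˢ {c} := by ext p; simp
    rw [this, Measure.volume_eq_prod, Measure.prod_prod]
    simp

/-! ### Increments of the drift functions -/

theorem continuous_clamp {ρ : ℝ → ℝ → ℝ}
    (hρ : ContinuousOn (fun p : ℝ × ℝ => ρ p.1 p.2) (Ioi 0 ×ˢ Ioi 0)) {l c : ℝ} (hl : 0 < l)
    (hc : 0 < c) : Continuous fun p : ℝ × ℝ => ρ (max p.1 l) (max p.2 c) :=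
  hρ.comp_continuous (f := fun p : ℝ × ℝ => (max p.1 l, max p.2 c)) (by fun_prop)
    fun _ => ⟨lt_max_of_lt_right hl, lt_max_of_lt_right hc⟩

theorem integrableOn_Ioc_prod_of_continuousOn {ρ : ℝ → ℝ → ℝ}
    (hρ : ContinuousOn (fun p : ℝ × ℝ => ρ p.1 p.2) (Ioi 0 ×ˢ Ioi 0)) {a b c e : ℝ} (ha : 0 < a)
    (hc : 0 < c) : IntegrableOn (fun p : ℝ × ℝ => ρ p.1 p.2) (Ioc a b ×ˢ Ioc c e) := by
  refine IntegrableOn.mono_set (t := Icc a b ×ˢ Icc c e) ?_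
    (prod_mono Ioc_subset_Icc_self Ioc_subset_Icc_self)
  refine (hρ.mono fun p hp => ?_).integrableOn_compact (isCompact_Icc.prod isCompact_Icc)
  exact ⟨ha.trans_le hp.1.1, hc.trans_le hp.2.1⟩

theorem setIntegral_Ioc_prod_eq {ρ : ℝ → ℝ → ℝ}
    (hρ : ContinuousOn (fun p : ℝ × ℝ => ρ p.1 p.2) (Ioi 0 ×ˢ Ioi 0)) {a b c e : ℝ} (ha : 0 < a)
    (hab : a ≤ b) (hc : 0 < c) (hce : c ≤ e) :
    ∫ p in Ioc a b ×ˢ Ioc c e, ρ p.1 p.2 = ∫ s in a..b, ∫ v in c..e, ρ s v := by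
  rw [Measure.volume_eq_prod, setIntegral_prod _ (integrableOn_Ioc_prod_of_continuousOn hρ ha hc),
    intervalIntegral.integral_of_le hab]
  simp only [intervalIntegral.integral_of_le hce]

theorem setIntegral_Ioc_prod_eq' {ρ : ℝ → ℝ → ℝ}
    (hρ : ContinuousOn (fun p : ℝ × ℝ => ρ p.1 p.2) (Ioi 0 ×ˢ Ioi 0)) {a b c e : ℝ} (ha : 0 < a)
    (hab : a ≤ b) (hc : 0 < c) (hce : c ≤ e) :
    ∫ p in Ioc a b ×ˢ Ioc c e, ρ p.1 p.2 = ∫ v in c..e, ∫ s in a..b, ρ s v := by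
  have hi := integrableOn_Ioc_prod_of_continuousOn hρ (b := b) (e := e) ha hc
  rw [Measure.volume_eq_prod, ← Measure.prod_restrict, integral_prod_symm,
    intervalIntegral.integral_of_le hce]
  · simp only [intervalIntegral.integral_of_le hab]
  · rw [Measure.prod_restrict]; exact hi

/-- If `F` has mixed density `ρ`, the increments in `y` of `∂ₓF` are integrals of `ρ(x,·)`. -/
theorem dX_sub_dX_eq_integral {F ρ : ℝ → ℝ → ℝ}
    (hF : ∀ x > 0, ∀ y > 0, DifferentiableAt ℝ (fun s => F s y) x)
    (hinc : ∀ a b c e, 0 < a → a ≤ b → 0 < c → c ≤ e →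
      F b e - F a e - F b c + F a c = ∫ p in Ioc a b ×ˢ Ioc c e, ρ p.1 p.2)
    (hρ : ContinuousOn (fun p : ℝ × ℝ => ρ p.1 p.2) (Ioi 0 ×ˢ Ioi 0)) {x c e : ℝ} (hx : 0 < x)
    (hc : 0 < c) (hce : c ≤ e) : dX F x e - dX F x c = ∫ v in c..e, ρ x v := by
  -- Near `x`, the increment of `F` is the integral of the continuous function `k` from `l`; the
  -- clamping makes `k` continuous on the whole line.
  set l := x / 2 with hl
  have hl0 : 0 < l := by positivity
  have hlx : l < x := by linarith
  set k : ℝ → ℝ := fun s => ∫ v in c..e, ρ (max s l) (max v c) with hk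
  have hkc : Continuous k :=
    intervalIntegral.continuous_parametric_intervalIntegral_of_continuous'
      (f := fun s v => ρ (max s l) (max v c)) (continuous_clamp hρ hl0 hc) c e
  have hk_eq : ∀ s, l ≤ s → k s = ∫ v in c..e, ρ s v := by
    intro s hs
    refine intervalIntegral.integral_congr fun v hv => ?_
    rw [uIcc_of_le hce] at hv
    simp only [max_eq_left hs, max_eq_left hv.1]
  have h1 : HasDerivAt (fun s => ∫ u in l..s, k u) (k x) x :=
    intervalIntegral.integral_hasDerivAt_right (hkc.intervalIntegrable _ _)
      (hkc.stronglyMeasurableAtFilter _ _) hkc.continuousAt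
  have h2 : HasDerivAt (fun s => F s e - F s c) (k x) x := by
    have h3 := h1.add_const (F l e - F l c)
    refine h3.congr_of_eventuallyEq ?_
    filter_upwards [lt_mem_nhds hlx] with s hs
    have h4 := hinc l s c e hl0 hs.le hc hce
    rw [setIntegral_Ioc_prod_eq hρ hl0 hs.le hc hce] at h4
    have h5 : ∫ u in l..s, k u = ∫ u in l..s, ∫ v in c..e, ρ u v := by
      refine intervalIntegral.integral_congr fun u hu => ?_
      rw [uIcc_of_le hs.le] at hu
      exact hk_eq u hu.1
    rw [h5, ← h4]
    ring
  have h3 := (hF x hx e (hc.trans_le hce)).hasDerivAt.sub (hF x hx c hc).hasDerivAt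
  rw [← hk_eq x hlx.le]
  exact h3.unique h2

/-- The increments of `f ∂ₓF` over rectangles are the integrals of `∂ₓ(f ρ)`. -/
theorem increment_mul_dX {F ρ : ℝ → ℝ → ℝ}
    (hF : ∀ x > 0, ∀ y > 0, DifferentiableAt ℝ (fun s => F s y) x)
    (hinc : ∀ a b c e, 0 < a → a ≤ b → 0 < c → c ≤ e →
      F b e - F a e - F b c + F a c = ∫ p in Ioc a b ×ˢ Ioc c e, ρ p.1 p.2)
    (hρ : ContinuousOn (fun p : ℝ × ℝ => ρ p.1 p.2) (Ioi 0 ×ˢ Ioi 0))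
    (hρd : ∀ x > 0, ∀ y > 0, DifferentiableAt ℝ (fun s => ρ s y) x)
    (hρc : ContinuousOn (fun p : ℝ × ℝ => dX ρ p.1 p.2) (Ioi 0 ×ˢ Ioi 0))
    {f : ℝ → ℝ} (hf : ∀ x > 0, DifferentiableAt ℝ f x) (hfc : ContinuousOn (deriv f) (Ioi 0))
    {a b c e : ℝ} (ha : 0 < a) (hab : a ≤ b) (hc : 0 < c) (hce : c ≤ e) :
    dX F b e * f b - dX F a e * f a - dX F b c * f b + dX F a c * f a
      = ∫ p in Ioc a b ×ˢ Ioc c e, (deriv f p.1 * ρ p.1 p.2 + f p.1 * dX ρ p.1 p.2) := by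
  have hf0 : ContinuousOn f (Ioi 0) := fun x hx => (hf x hx).continuousAt.continuousWithinAt
  have hfst : MapsTo (Prod.fst : ℝ × ℝ → ℝ) (Ioi 0 ×ˢ Ioi 0) (Ioi 0) := fun p hp => hp.1
  have hcont : ContinuousOn (fun p : ℝ × ℝ => deriv f p.1 * ρ p.1 p.2 + f p.1 * dX ρ p.1 p.2)
      (Ioi 0 ×ˢ Ioi 0) :=
    ((hfc.comp continuousOn_fst hfst).mul hρ).add ((hf0.comp continuousOn_fst hfst).mul hρc)
  rw [setIntegral_Ioc_prod_eq' (ρ := fun x y => deriv f x * ρ x y + f x * dX ρ x y) hcont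
    ha hab hc hce]
  have hb := ha.trans_le hab
  have hinner : ∀ v ∈ uIcc c e, ∫ s in a..b, (deriv f s * ρ s v + f s * dX ρ s v)
      = f b * ρ b v - f a * ρ a v := by
    intro v hv
    rw [uIcc_of_le hce] at hv
    have hv0 : 0 < v := hc.trans_le hv.1
    refine intervalIntegral.integral_eq_sub_of_hasDerivAt (f := fun s => f s * ρ s v) ?_ ?_
    · intro s hs
      rw [uIcc_of_le hab] at hs
      have hs0 : 0 < s := ha.trans_le hs.1
      exact (hf s hs0).hasDerivAt.mul (hρd s hs0 v hv0).hasDerivAt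
    · refine ContinuousOn.intervalIntegrable ?_
      rw [uIcc_of_le hab]
      exact hcont.comp (f := fun s => (s, v)) (by fun_prop) fun s hs => ⟨ha.trans_le hs.1, hv0⟩
  rw [intervalIntegral.integral_congr hinner]
  have hsec : ∀ {x : ℝ}, 0 < x → IntervalIntegrable (fun v => ρ x v) volume c e := by
    intro x hx
    refine ContinuousOn.intervalIntegrable ?_
    rw [uIcc_of_le hce]
    exact hρ.comp (f := fun v => (x, v)) (by fun_prop) fun v hv => ⟨hx, hc.trans_le hv.1⟩
  rw [intervalIntegral.integral_sub ((hsec hb).const_mul _) ((hsec ha).const_mul _),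
    intervalIntegral.integral_const_mul, intervalIntegral.integral_const_mul,
    ← dX_sub_dX_eq_integral hF hinc hρ hb hc hce, ← dX_sub_dX_eq_integral hF hinc hρ ha hc hce]
  ring

theorem setIntegral_prod_swap_real (A B : Set ℝ) (g : ℝ × ℝ → ℝ) :
    ∫ p in A ×ˢ B, g p.swap = ∫ p in B ×ˢ A, g p := by
  rw [Measure.volume_eq_prod]
  exact setIntegral_prod_swap (μ := volume) (ν := volume) B A g

theorem increment_mul_dY {F ρ : ℝ → ℝ → ℝ}
    (hF : ∀ x > 0, ∀ y > 0, DifferentiableAt ℝ (fun s => F x s) y)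
    (hinc : ∀ a b c e, 0 < a → a ≤ b → 0 < c → c ≤ e →
      F b e - F a e - F b c + F a c = ∫ p in Ioc a b ×ˢ Ioc c e, ρ p.1 p.2)
    (hρ : ContinuousOn (fun p : ℝ × ℝ => ρ p.1 p.2) (Ioi 0 ×ˢ Ioi 0))
    (hρd : ∀ x > 0, ∀ y > 0, DifferentiableAt ℝ (fun s => ρ x s) y)
    (hρc : ContinuousOn (fun p : ℝ × ℝ => dY ρ p.1 p.2) (Ioi 0 ×ˢ Ioi 0))
    {f : ℝ → ℝ} (hf : ∀ x > 0, DifferentiableAt ℝ f x) (hfc : ContinuousOn (deriv f) (Ioi 0))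
    {a b c e : ℝ} (ha : 0 < a) (hab : a ≤ b) (hc : 0 < c) (hce : c ≤ e) :
    dY F b e * f e - dY F a e * f e - dY F b c * f c + dY F a c * f c
      = ∫ p in Ioc a b ×ˢ Ioc c e, (deriv f p.2 * ρ p.1 p.2 + f p.2 * dY ρ p.1 p.2) := by
  have hsw : MapsTo (Prod.swap : ℝ × ℝ → ℝ × ℝ) (Ioi 0 ×ˢ Ioi 0) (Ioi 0 ×ˢ Ioi 0) :=
    fun p hp => ⟨hp.2, hp.1⟩
  have h := increment_mul_dX (F := fun y x => F x y) (ρ := fun y x => ρ x y)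
    (fun x hx y hy => hF y hy x hx)
    (fun a b c e ha hab hc hce => by
      rw [← setIntegral_prod_swap_real (Ioc c e) (Ioc a b) (fun p => ρ p.2 p.1)]
      simp only [Prod.swap]
      rw [← hinc c e a b hc hce ha hab]
      ring)
    (hρ.comp continuous_swap.continuousOn hsw) (fun x hx y hy => hρd y hy x hx)
    (hρc.comp continuous_swap.continuousOn hsw) hf hfc hc hce ha hab
  rw [← setIntegral_prod_swap_real (Ioc a b) (Ioc c e)] at h
  change _ = ∫ p in Ioc a b ×ˢ Ioc c e, (deriv f p.2 * ρ p.1 p.2 + f p.2 * dY ρ p.1 p.2) at h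
  rw [← h]
  change _ = dY F b e * f e - dY F b c * f c - dY F a e * f e + dY F a c * f c
  ring

/-- Differentiation under the integral sign in a component of the parameter; the derivative of the
density is locally bounded uniformly over compact rectangles, by its joint continuity. -/
theorem increment_dTheta {d : ℕ} {F ρ : (Fin d → ℝ) → ℝ → ℝ → ℝ} {θ₀ : Fin d → ℝ} {i : Fin d}
    {N : Set (Fin d → ℝ)} (hN : N ∈ 𝓝 θ₀) {a b c e : ℝ} (ha : 0 < a) (hab : a ≤ b) (hc : 0 < c)
    (hce : c ≤ e)
    (hF : ∀ x > 0, ∀ y > 0, DifferentiableAt ℝ (fun s => F (Function.update θ₀ i s) x y) (θ₀ i))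
    (hinc : ∀ θ ∈ N, F θ b e - F θ a e - F θ b c + F θ a c
      = ∫ p in Ioc a b ×ˢ Ioc c e, ρ θ p.1 p.2)
    (hint : ∀ θ ∈ N, IntegrableOn (fun p : ℝ × ℝ => ρ θ p.1 p.2) (Ioc a b ×ˢ Ioc c e))
    (hρ : ∀ θ ∈ N, ∀ x > 0, ∀ y > 0,
      DifferentiableAt ℝ (fun s => ρ (Function.update θ i s) x y) (θ i))
    (hρc : ∀ x > 0, ∀ y > 0,
      ContinuousAt (fun p : ℝ × ℝ × (Fin d → ℝ) => dTheta ρ p.2.2 i p.1 p.2.1) (x, y, θ₀)) :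
    dTheta F θ₀ i b e - dTheta F θ₀ i a e - dTheta F θ₀ i b c + dTheta F θ₀ i a c
      = ∫ p in Ioc a b ×ˢ Ioc c e, dTheta ρ θ₀ i p.1 p.2 := by
  have hb := ha.trans_le hab
  have he := hc.trans_le hce
  have hup : Continuous fun s : ℝ => Function.update θ₀ i s := continuous_const.update i continuous_id
  have hup0 : Function.update θ₀ i (θ₀ i) = θ₀ := Function.update_eq_self i θ₀
  set Kc : Set (ℝ × ℝ) := Icc a b ×ˢ Icc c e with hKc
  have hKpos : ∀ p ∈ Kc, 0 < p.1 ∧ 0 < p.2 := fun p hp =>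
    ⟨ha.trans_le hp.1.1, hc.trans_le hp.2.1⟩
  have hcomp : IsCompact Kc := isCompact_Icc.prod isCompact_Icc
  have hcont0 : ContinuousOn (fun p : ℝ × ℝ => dTheta ρ θ₀ i p.1 p.2) Kc := by
    intro p hp
    have h := hρc p.1 (hKpos p hp).1 p.2 (hKpos p hp).2
    have h2 : ContinuousAt (fun p : ℝ × ℝ => (p.1, p.2, θ₀)) p := by fun_prop
    exact (ContinuousAt.comp (f := fun p : ℝ × ℝ => (p.1, p.2, θ₀)) h h2).continuousWithinAt
  obtain ⟨C, hC⟩ := hcomp.exists_bound_of_continuousOn hcont0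
  have hbound : ∀ᶠ θ in 𝓝 θ₀, ∀ p ∈ Kc, |dTheta ρ θ i p.1 p.2| ≤ C + 1 := by
    refine hcomp.eventually_forall_of_forall_eventually fun p hp => ?_
    have h := hρc p.1 (hKpos p hp).1 p.2 (hKpos p hp).2
    have h2 : Tendsto (fun z : (Fin d → ℝ) × (ℝ × ℝ) => (z.2.1, z.2.2, z.1)) (𝓝 (θ₀, p))
        (𝓝 (p.1, p.2, θ₀)) :=
      Continuous.tendsto' (by fun_prop) _ _ rfl
    have h3 := (h.tendsto.comp h2).norm
    have h4 := h3.eventually (gt_mem_nhds (lt_of_le_of_lt (hC p hp) (lt_add_one C)))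
    filter_upwards [h4] with z hz
    exact hz.le
  have hgood : ∀ᶠ s in 𝓝 (θ₀ i), Function.update θ₀ i s ∈ N ∧
      ∀ p ∈ Kc, |dTheta ρ (Function.update θ₀ i s) i p.1 p.2| ≤ C + 1 := by
    have : Tendsto (fun s => Function.update θ₀ i s) (𝓝 (θ₀ i)) (𝓝 θ₀) :=
      hup.tendsto' _ _ hup0
    exact this.eventually (Filter.Eventually.and hN hbound)
  have hderiv : ∀ s, Function.update θ₀ i s ∈ N → ∀ p ∈ Kc,
      HasDerivAt (fun s => ρ (Function.update θ₀ i s) p.1 p.2)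
        (dTheta ρ (Function.update θ₀ i s) i p.1 p.2) s := by
    intro s hs p hp
    have h := (hρ _ hs p.1 (hKpos p hp).1 p.2 (hKpos p hp).2).hasDerivAt
    rw [Function.update_self] at h
    have e1 : dTheta ρ (Function.update θ₀ i s) i p.1 p.2
        = deriv (fun s' => ρ (Function.update (Function.update θ₀ i s) i s') p.1 p.2) s := by
      rw [dTheta, Function.update_self]
    rw [e1]
    simpa only [Function.update_idem] using h
  have hmem : Ioc a b ×ˢ Ioc c e ⊆ Kc := prod_mono Ioc_subset_Icc_self Ioc_subset_Icc_self
  have hmeas : MeasurableSet (Ioc a b ×ˢ Ioc c e) := measurableSet_Ioc.prod measurableSet_Ioc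
  have hmain := hasDerivAt_integral_of_dominated_loc_of_deriv_le
    (μ := volume.restrict (Ioc a b ×ˢ Ioc c e))
    (F := fun s (p : ℝ × ℝ) => ρ (Function.update θ₀ i s) p.1 p.2)
    (F' := fun s (p : ℝ × ℝ) => dTheta ρ (Function.update θ₀ i s) i p.1 p.2)
    (bound := fun _ => C + 1) (x₀ := θ₀ i) hgood
    (hgood.mono fun s hs => (hint _ hs.1).aestronglyMeasurable)
    (by have h := hint θ₀ (mem_of_mem_nhds hN)
        rwa [← hup0] at h)
    (by
      simp only [hup0]
      exact (hcont0.mono hmem).aestronglyMeasurable hmeas)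
    (by
      filter_upwards [ae_restrict_mem hmeas] with p hp s hs
      exact hs.2 p (hmem hp))
    (integrableOn_const
      (hs := ((measure_mono hmem).trans_lt hcomp.measure_lt_top).ne))
    (by
      filter_upwards [ae_restrict_mem hmeas] with p hp s hs
      exact hderiv s hs.1 p (hmem hp))
  have h1 := hmain.2
  simp only [hup0] at h1
  have h2 := (((hF b hb e he).hasDerivAt.sub (hF a ha e he).hasDerivAt).sub
    (hF b hb c hc).hasDerivAt).add (hF a ha c hc).hasDerivAt
  refine h2.unique (h1.congr_of_eventuallyEq ?_)
  filter_upwards [hgood] with s hs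
  exact hinc _ hs.1

/-! ### The score functions -/

theorem differentiableAt_and_continuousOn_deriv {f : ℝ → ℝ} (hf : ContDiffOn ℝ 1 f (Ioi 0)) :
    (∀ x > 0, DifferentiableAt ℝ f x) ∧ ContinuousOn (deriv f) (Ioi 0) :=
  ⟨fun x hx => (hf.differentiableOn (by norm_num)).differentiableAt (Ioi_mem_nhds hx),
    hf.continuousOn_deriv_of_isOpen isOpen_Ioi le_rfl⟩

theorem contDiffOn_rpow_Ioi (γ : ℝ) : ContDiffOn ℝ 1 (fun x : ℝ => x ^ γ) (Ioi 0) := fun _ hx =>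
  (Real.contDiffAt_rpow_const_of_ne (ne_of_gt hx)).contDiffWithinAt

theorem contDiffOn_log_Ioi : ContDiffOn ℝ 1 Real.log (Ioi 0) := fun _ hx =>
  (Real.contDiffAt_log.2 (ne_of_gt hx)).contDiffWithinAt

theorem contDiffOn_fFun (γ : ℝ) : ContDiffOn ℝ 1 (fFun γ) (Ioi 0) := by
  have h1 := contDiffOn_rpow_Ioi γ
  have h2 := contDiffOn_log_Ioi
  unfold fFun
  split_ifs
  · exact contDiffOn_id.mul h2
  · exact (contDiffOn_id.mul (h1.sub contDiffOn_const)).div_const _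

theorem contDiffOn_gFun (γ : ℝ) : ContDiffOn ℝ 1 (gFun γ) (Ioi 0) :=
  (contDiffOn_rpow_Ioi (γ + 1)).neg

theorem contDiffOn_hFun (γ : ℝ) : ContDiffOn ℝ 1 (hFun γ) (Ioi 0) := by
  have h1 := contDiffOn_rpow_Ioi γ
  have h2 := contDiffOn_log_Ioi
  unfold hFun
  split_ifs
  · exact ((contDiffOn_id.mul (h2.pow 2)).neg).div_const _
  · exact ((contDiffOn_id.mul (contDiffOn_const.sub h1)).div_const _).add
      ((contDiffOn_id.mul h2).div_const _)

/-- A function on the quadrant whose first-order partial derivatives are continuous is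
continuous. -/
theorem C1InXY.continuousOn {F : ℝ → ℝ → ℝ} (h : C1InXY F) :
    ContinuousOn (fun p : ℝ × ℝ => F p.1 p.2) (Ioi 0 ×ˢ Ioi 0) := by
  intro p hp
  have hQ : Ioi 0 ×ˢ Ioi 0 ∈ 𝓝 p := (isOpen_Ioi.prod isOpen_Ioi).mem_nhds hp
  have hX : ContinuousAt (fun p : ℝ × ℝ => dX F p.1 p.2) p := h.2.1.continuousAt hQ
  have hY : ContinuousAt (fun p : ℝ × ℝ => dY F p.1 p.2) p := h.2.2.continuousAt hQ
  have hL : Continuous fun z : ℝ => ContinuousLinearMap.toSpanSingleton ℝ z :=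
    (ContinuousLinearMap.toSpanSingletonCLE (𝕜 := ℝ) (E := ℝ)).continuous
  have := hasStrictFDerivAt_uncurry_coprod (𝕜 := ℝ) (u := p) (f := F)
    (f₁ := fun x y => ContinuousLinearMap.toSpanSingleton ℝ (dX F x y))
    (f₂ := fun x y => ContinuousLinearMap.toSpanSingleton ℝ (dY F x y))
    (by filter_upwards [hQ] with v hv
        exact (h.1 v.1 hv.1 v.2 hv.2).1.hasDerivAt.hasFDerivAt)
    (by filter_upwards [hQ] with v hv
        exact (h.1 v.1 hv.1 v.2 hv.2).2.hasDerivAt.hasFDerivAt)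
    (hL.continuousAt.comp hX) (hL.continuousAt.comp hY)
  exact this.hasFDerivAt.continuousAt.continuousWithinAt

section

variable {d : ℕ} {r : (Fin d → ℝ) → ℝ → ℝ → ℝ} {θ₀ : Fin d → ℝ}

theorem dX_log {ρ : ℝ → ℝ → ℝ} {x y : ℝ} (hρ : 0 < ρ x y)
    (hd : DifferentiableAt ℝ (fun s => ρ s y) x) :
    dX (fun x y => Real.log (ρ x y)) x y = dX ρ x y / ρ x y :=
  deriv.log hd hρ.ne'

theorem dY_log {ρ : ℝ → ℝ → ℝ} {x y : ℝ} (hρ : 0 < ρ x y)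
    (hd : DifferentiableAt ℝ (fun s => ρ x s) y) :
    dY (fun x y => Real.log (ρ x y)) x y = dY ρ x y / ρ x y :=
  deriv.log hd hρ.ne'

theorem dTheta_log {x y : ℝ} {i : Fin d} (hρ : 0 < r θ₀ x y)
    (hd : DifferentiableAt ℝ (fun s => r (Function.update θ₀ i s) x y) (θ₀ i)) :
    dTheta (fun θ x y => Real.log (r θ x y)) θ₀ i x y = dTheta r θ₀ i x y / r θ₀ x y := by
  have := deriv.log hd (by rw [Function.update_eq_self]; exact hρ.ne')
  rw [Function.update_eq_self] at this
  exact this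

/-- The deterministic coefficient functions of the drift of `η̂`, in the order of the scores. -/
def driftFun (R : (Fin d → ℝ) → ℝ≥0∞ → ℝ≥0∞ → ℝ≥0∞) (θ₀ : Fin d → ℝ) (γ : Fin 2 → ℝ) :
    Fin 6 ⊕ Fin d → ℝ → ℝ → ℝ :=
  Sum.elim
    ![fun x y => dX (tailFun (R θ₀)) x y * fFun (γ 0) x,
      fun x y => dX (tailFun (R θ₀)) x y * gFun (γ 0) x,
      fun x y => dX (tailFun (R θ₀)) x y * hFun (γ 0) x,
      fun x y => dY (tailFun (R θ₀)) x y * fFun (γ 1) y,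
      fun x y => dY (tailFun (R θ₀)) x y * gFun (γ 1) y,
      fun x y => dY (tailFun (R θ₀)) x y * hFun (γ 1) y]
    (fun i x y => dTheta (fun θ => tailFun (R θ)) θ₀ i x y)

/-- The random coefficients of the drift of `η̂`, in the order of the scores. -/
def driftCoeff {Ω : Type*} (A B Γ : Fin 2 → Ω → ℝ) (ζ : Fin d → Ω → ℝ) : Fin 6 ⊕ Fin d → Ω → ℝ :=
  Sum.elim ![A 0, B 0, Γ 0, A 1, B 1, Γ 1] ζ

theorem etaHat_eq {Ω : Type*} (R : (Fin d → ℝ) → ℝ≥0∞ → ℝ≥0∞ → ℝ≥0∞)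
    (γ : Fin 2 → ℝ) (V : ℝ → ℝ → Ω → ℝ) (A B Γ : Fin 2 → Ω → ℝ) (ζ : Fin d → Ω → ℝ)
    (x y : ℝ) (ω : Ω) :
    etaHat R θ₀ γ V A B Γ ζ x y ω
      = V x y ω + ∑ k, driftCoeff A B Γ ζ k ω * driftFun R θ₀ γ k x y := by
  simp only [etaHat, driftCoeff, driftFun, Fintype.sum_sum_type, Fin.sum_univ_six, Sum.elim_inl,
    Sum.elim_inr, Matrix.cons_val]
  rw [Finset.sum_congr rfl fun i _ => mul_comm (ζ i ω) _]
  ring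

theorem continuousOn_dTheta {i : Fin d} (h : ∀ x > 0, ∀ y > 0,
      ContinuousAt (fun p : ℝ × ℝ × (Fin d → ℝ) => dTheta r p.2.2 i p.1 p.2.1) (x, y, θ₀)) :
    ContinuousOn (fun p : ℝ × ℝ => dTheta r θ₀ i p.1 p.2) (Ioi 0 ×ˢ Ioi 0) := fun p hp =>
  (ContinuousAt.comp (f := fun p : ℝ × ℝ => (p.1, p.2, θ₀)) (h p.1 hp.1 p.2 hp.2)
    (by fun_prop)).continuousWithinAt

theorem continuousOn_score_x {ρ : ℝ → ℝ → ℝ} (hC : C1InXY ρ) (hpos : ∀ x > 0, ∀ y > 0, 0 < ρ x y)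
    {f : ℝ → ℝ} (hf : ContDiffOn ℝ 1 f (Ioi 0)) :
    ContinuousOn (fun p : ℝ × ℝ =>
      deriv f p.1 + f p.1 * dX (fun x y => Real.log (ρ x y)) p.1 p.2) (Ioi 0 ×ˢ Ioi 0) := by
  have hfst : MapsTo (Prod.fst : ℝ × ℝ → ℝ) (Ioi 0 ×ˢ Ioi 0) (Ioi 0) := fun p hp => hp.1
  have h1 : ContinuousOn (fun p : ℝ × ℝ => dX (fun x y => Real.log (ρ x y)) p.1 p.2)
      (Ioi 0 ×ˢ Ioi 0) :=
    (hC.2.1.div hC.continuousOn fun p hp => (hpos _ hp.1 _ hp.2).ne').congr fun p hp =>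
      dX_log (hpos _ hp.1 _ hp.2) (hC.1 _ hp.1 _ hp.2).1
  exact ((differentiableAt_and_continuousOn_deriv hf).2.comp continuousOn_fst hfst).add
    ((hf.continuousOn.comp continuousOn_fst hfst).mul h1)

theorem continuousOn_score_y {ρ : ℝ → ℝ → ℝ} (hC : C1InXY ρ) (hpos : ∀ x > 0, ∀ y > 0, 0 < ρ x y)
    {f : ℝ → ℝ} (hf : ContDiffOn ℝ 1 f (Ioi 0)) :
    ContinuousOn (fun p : ℝ × ℝ =>
      deriv f p.2 + f p.2 * dY (fun x y => Real.log (ρ x y)) p.1 p.2) (Ioi 0 ×ˢ Ioi 0) := by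
  have hsnd : MapsTo (Prod.snd : ℝ × ℝ → ℝ) (Ioi 0 ×ˢ Ioi 0) (Ioi 0) := fun p hp => hp.2
  have h1 : ContinuousOn (fun p : ℝ × ℝ => dY (fun x y => Real.log (ρ x y)) p.1 p.2)
      (Ioi 0 ×ˢ Ioi 0) :=
    (hC.2.2.div hC.continuousOn fun p hp => (hpos _ hp.1 _ hp.2).ne').congr fun p hp =>
      dY_log (hpos _ hp.1 _ hp.2) (hC.1 _ hp.1 _ hp.2).2
  exact ((differentiableAt_and_continuousOn_deriv hf).2.comp continuousOn_snd hsnd).add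
    ((hf.continuousOn.comp continuousOn_snd hsnd).mul h1)

theorem continuousOn_q {γ : Fin 2 → ℝ} (hC : C1InXY (r θ₀))
    (hpos : ∀ x > 0, ∀ y > 0, 0 < r θ₀ x y)
    (hd : ∀ i : Fin d, ∀ x > 0, ∀ y > 0,
      DifferentiableAt ℝ (fun s => r (Function.update θ₀ i s) x y) (θ₀ i))
    (hc : ∀ i : Fin d, ∀ x > 0, ∀ y > 0,
      ContinuousAt (fun p : ℝ × ℝ × (Fin d → ℝ) => dTheta r p.2.2 i p.1 p.2.1) (x, y, θ₀))
    (k : Fin 6 ⊕ Fin d) :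
    ContinuousOn (fun p : ℝ × ℝ => q r θ₀ γ k p.1 p.2) (Ioi 0 ×ˢ Ioi 0) := by
  rcases k with k | i
  · fin_cases k
    · exact continuousOn_score_x hC hpos (contDiffOn_fFun _)
    · exact continuousOn_score_x hC hpos (contDiffOn_gFun _)
    · exact continuousOn_score_x hC hpos (contDiffOn_hFun _)
    · exact continuousOn_score_y hC hpos (contDiffOn_fFun _)
    · exact continuousOn_score_y hC hpos (contDiffOn_gFun _)
    · exact continuousOn_score_y hC hpos (contDiffOn_hFun _)
  · exact ((continuousOn_dTheta (hc i)).div hC.continuousOn fun p hp =>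
      (hpos _ hp.1 _ hp.2).ne').congr fun p hp =>
        dTheta_log (hpos _ hp.1 _ hp.2) (hd i _ hp.1 _ hp.2)

/-- The scores are the densities, with respect to the tail measure, of the increments of the drift
functions. -/
theorem driftFun_increment {Θ : Set (Fin d → ℝ)} {R : (Fin d → ℝ) → ℝ≥0∞ → ℝ≥0∞ → ℝ≥0∞}
    (hR : ∀ θ ∈ Θ, IsTailCopula (R θ)) {μ : (Fin d → ℝ) → Measure (ℝ≥0∞ × ℝ≥0∞)}
    (hμ : ∀ θ ∈ Θ, IsTailMeasure (R θ) (μ θ)) (hB2 : AssumptionB2 R θ₀)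
    (hB4 : AssumptionB4 Θ μ r θ₀) (γ : Fin 2 → ℝ) (k : Fin 6 ⊕ Fin d) {a b c e : ℝ} (ha : 0 < a)
    (hab : a ≤ b) (hc : 0 < c) (hce : c ≤ e) :
    driftFun R θ₀ γ k b e - driftFun R θ₀ γ k a e - driftFun R θ₀ γ k b c
      + driftFun R θ₀ γ k a c = ∫ p in Ioc a b ×ˢ Ioc c e, q r θ₀ γ k p.1 p.2 ∂(planar (μ θ₀)) := by
  obtain ⟨hC, N, hN, hNΘ, hdens, hθ⟩ := hB4
  obtain ⟨hRC, hRθ⟩ := hB2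
  have hθ₀ := mem_of_mem_nhds hN
  have hpos := (hdens θ₀ hθ₀).1
  have hinc : ∀ θ ∈ N, ∀ a b c e, 0 < a → a ≤ b → 0 < c → c ≤ e →
      tailFun (R θ) b e - tailFun (R θ) a e - tailFun (R θ) b c + tailFun (R θ) a c
        = ∫ p in Ioc a b ×ˢ Ioc c e, r θ p.1 p.2 := fun θ hθ a b c e ha hab hc hce => by
    rw [tailFun_increment (hR θ (hNΘ hθ)) (hμ θ (hNΘ hθ)) ha.le hab hc.le hce,
      planar_real_eq_setIntegral (hdens θ hθ) (measurableSet_Ioc.prod measurableSet_Ioc)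
        (Ioc_prod_subset_quadrant ha.le hc.le)]
  have hsub := Ioc_prod_subset_quadrant (b := b) (e := e) ha.le hc.le
  have hms : MeasurableSet (Ioc a b ×ˢ Ioc c e) := measurableSet_Ioc.prod measurableSet_Ioc
  rw [setIntegral_planar (hdens θ₀ hθ₀) hms hsub]
  have hx : ∀ f : ℝ → ℝ, ContDiffOn ℝ 1 f (Ioi 0) →
      dX (tailFun (R θ₀)) b e * f b - dX (tailFun (R θ₀)) a e * f a
        - dX (tailFun (R θ₀)) b c * f b + dX (tailFun (R θ₀)) a c * f a
      = ∫ p in Ioc a b ×ˢ Ioc c e, r θ₀ p.1 p.2 *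
        (deriv f p.1 + f p.1 * dX (fun x y => Real.log (r θ₀ x y)) p.1 p.2) := by
    intro f hf
    obtain ⟨hf1, hf2⟩ := differentiableAt_and_continuousOn_deriv hf
    rw [increment_mul_dX (fun x hx y hy => (hRC.1 x hx y hy).1) (hinc θ₀ hθ₀) hC.continuousOn
      (fun x hx y hy => (hC.1 x hx y hy).1) hC.2.1 hf1 hf2 ha hab hc hce]
    refine setIntegral_congr_fun hms fun p hp => ?_
    have h0 := hpos _ (hsub hp).1 _ (hsub hp).2
    simp only [dX_log h0 (hC.1 _ (hsub hp).1 _ (hsub hp).2).1]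
    field_simp
  have hy : ∀ f : ℝ → ℝ, ContDiffOn ℝ 1 f (Ioi 0) →
      dY (tailFun (R θ₀)) b e * f e - dY (tailFun (R θ₀)) a e * f e
        - dY (tailFun (R θ₀)) b c * f c + dY (tailFun (R θ₀)) a c * f c
      = ∫ p in Ioc a b ×ˢ Ioc c e, r θ₀ p.1 p.2 *
        (deriv f p.2 + f p.2 * dY (fun x y => Real.log (r θ₀ x y)) p.1 p.2) := by
    intro f hf
    obtain ⟨hf1, hf2⟩ := differentiableAt_and_continuousOn_deriv hf
    rw [increment_mul_dY (fun x hx y hy => (hRC.1 x hx y hy).2) (hinc θ₀ hθ₀) hC.continuousOn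
      (fun x hx y hy => (hC.1 x hx y hy).2) hC.2.2 hf1 hf2 ha hab hc hce]
    refine setIntegral_congr_fun hms fun p hp => ?_
    have h0 := hpos _ (hsub hp).1 _ (hsub hp).2
    simp only [dY_log h0 (hC.1 _ (hsub hp).1 _ (hsub hp).2).2]
    field_simp
  rcases k with k | i
  · fin_cases k
    · exact hx _ (contDiffOn_fFun _)
    · exact hx _ (contDiffOn_gFun _)
    · exact hx _ (contDiffOn_hFun _)
    · exact hy _ (contDiffOn_fFun _)
    · exact hy _ (contDiffOn_gFun _)
    · exact hy _ (contDiffOn_hFun _)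
  · have h := increment_dTheta (F := fun θ => tailFun (R θ)) (ρ := r) hN ha hab hc hce
      (hRθ i).1 (fun θ hθ => hinc θ hθ a b c e ha hab hc hce)
      (fun θ hθ => integrableOn_tailDensity (hR θ (hNΘ hθ)) (hμ θ (hNΘ hθ)) (hdens θ hθ) ha.le
        (ha.trans_le hab).le hc.le (hc.trans_le hce).le) (hθ i).1 (hθ i).2
    refine h.trans (setIntegral_congr_fun hms fun p hp => ?_)
    have h0 := hpos _ (hsub hp).1 _ (hsub hp).2
    have h1 := dTheta_log h0 ((hθ i).1 θ₀ hθ₀ _ (hsub hp).1 _ (hsub hp).2)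
    change _ = r θ₀ p.1 p.2 * dTheta (fun θ x y => Real.log (r θ x y)) θ₀ i p.1 p.2
    rw [h1]
    field_simp

end

/-! ### Extension of the scores to the plane -/

/-- The nearest-point projection of the plane onto the square `[δ,T]²`. -/
def clampSquare (δ T : ℝ) (p : ℝ × ℝ) : ℝ × ℝ := (max δ (min p.1 T), max δ (min p.2 T))

theorem clampSquare_mem {δ T : ℝ} (h : δ ≤ T) (p : ℝ × ℝ) :
    clampSquare δ T p ∈ Icc δ T ×ˢ Icc δ T :=
  ⟨⟨le_max_left _ _, max_le h (min_le_right _ _)⟩, le_max_left _ _, max_le h (min_le_right _ _)⟩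

theorem clampSquare_eq_self {δ T : ℝ} {p : ℝ × ℝ} (hp : p ∈ Icc δ T ×ˢ Icc δ T) :
    clampSquare δ T p = p := by
  obtain ⟨⟨h1, h2⟩, h3, h4⟩ := hp
  simp [clampSquare, h1, h2, h3, h4]

theorem uniformContinuous_clampSquare (δ T : ℝ) : UniformContinuous (clampSquare δ T) := by
  have h : UniformContinuous fun z : ℝ => max δ (min z T) :=
    ((LipschitzWith.id.min_const T).const_max δ).uniformContinuous
  exact (h.comp uniformContinuous_fst).prodMk (h.comp uniformContinuous_snd)

theorem uniformContinuous_and_bounded_comp_clampSquare {δ T : ℝ} (h : δ ≤ T) {g : ℝ × ℝ → ℝ}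
    (hg : ContinuousOn g (Icc δ T ×ˢ Icc δ T)) :
    UniformContinuous (fun p => g (clampSquare δ T p)) ∧ ∃ C, ∀ p, |g (clampSquare δ T p)| ≤ C := by
  have hK : IsCompact (Icc δ T ×ˢ Icc δ T) := isCompact_Icc.prod isCompact_Icc
  constructor
  · rw [Metric.uniformContinuous_iff]
    intro ε hε
    obtain ⟨ρ, hρ, H⟩ := Metric.uniformContinuousOn_iff.1
      (hK.uniformContinuousOn_of_continuous hg) ε hε
    obtain ⟨ρ', hρ', H'⟩ := Metric.uniformContinuous_iff.1 (uniformContinuous_clampSquare δ T) ρ hρ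
    exact ⟨ρ', hρ', fun {a b} hab => H _ (clampSquare_mem h a) _ (clampSquare_mem h b) (H' hab)⟩
  · obtain ⟨C, hC⟩ := hK.exists_bound_of_continuousOn hg
    exact ⟨C, fun p => hC _ (clampSquare_mem h p)⟩

theorem infoMatrix_eq_tailInfo {ι : Type*} {q : ι → ℝ → ℝ → ℝ} {m : Measure (ℝ × ℝ)}
    {δ T t : ℝ} (ht : δ ≤ t) :
    infoMatrix q m δ T t = tailInfo (m.restrict (Icc δ T ×ˢ Icc δ T))
      (fun i p => q i (clampSquare δ T p).1 (clampSquare δ T p).2) t := by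
  ext i j
  simp only [infoMatrix, tailInfo, Matrix.of_apply]
  have hms : MeasurableSet {p : ℝ × ℝ | t ≤ p.2} :=
    measurableSet_le measurable_const measurable_snd
  have hset : Icc δ T ×ˢ Icc t T = Icc δ T ×ˢ Icc δ T ∩ {p : ℝ × ℝ | t ≤ p.2} := by
    ext p
    simp only [mem_prod, mem_Icc, mem_inter_iff, mem_ofPred_eq]
    constructor
    · rintro ⟨h1, h2, h3⟩
      exact ⟨⟨h1, ht.trans h2, h3⟩, h2⟩
    · rintro ⟨⟨h1, h2, h3⟩, h4⟩
      exact ⟨h1, h4, h3⟩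
  have e : ∀ p : ℝ × ℝ, {p : ℝ × ℝ | t ≤ p.2}.indicator
      (fun p => q i (clampSquare δ T p).1 (clampSquare δ T p).2) p
        * q j (clampSquare δ T p).1 (clampSquare δ T p).2
      = {p : ℝ × ℝ | t ≤ p.2}.indicator
        (fun p => q i (clampSquare δ T p).1 (clampSquare δ T p).2
          * q j (clampSquare δ T p).1 (clampSquare δ T p).2) p := by
    intro p
    by_cases hp : p ∈ {p : ℝ × ℝ | t ≤ p.2}
    · simp only [indicator_of_mem hp]
    · simp only [indicator_of_notMem hp, zero_mul]
  simp only [e]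
  rw [setIntegral_indicator hms, hset]
  refine setIntegral_congr_fun ((measurableSet_Icc.prod measurableSet_Icc).inter hms) fun p hp => ?_
  simp only [clampSquare_eq_self hp.1]

theorem compensatorIntegrand_eq {Ω ι : Type*} [Fintype ι] [DecidableEq ι]
    [MeasurableSpace Ω] {q : ι → ℝ → ℝ → ℝ} {m : Measure (ℝ × ℝ)} {δ T y₀ : ℝ} (hyT : y₀ ≤ T)
    (J : ℝ → Ω → ι → ℝ) (ω : Ω) {p : ℝ × ℝ} (hp : p ∈ Icc δ T ×ˢ Icc δ y₀) :
    compensatorIntegrand q m δ T J ω p = weight (m.restrict (Icc δ T ×ˢ Icc δ T))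
      (fun i p => q i (clampSquare δ T p).1 (clampSquare δ T p).2) δ y₀ p ⬝ᵥ J p.2 ω := by
  have hpS : p ∈ Icc δ T ×ˢ Icc δ T := ⟨hp.1, hp.2.1, hp.2.2.trans hyT⟩
  rw [compensatorIntegrand, infoMatrix_eq_tailInfo hp.2.1, weight, min_eq_left hp.2.2,
    max_eq_right hp.2.1, clampSquare_eq_self hpS, Matrix.dotProduct_mulVec, ← Matrix.mulVec_transpose,
    Matrix.transpose_nonsing_inv, tailInfo_isSymm]

theorem rectIncr_etaHat {Ω : Type*} {d : ℕ} {θ₀ : Fin d → ℝ}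
    (R : (Fin d → ℝ) → ℝ≥0∞ → ℝ≥0∞ → ℝ≥0∞)
    (γ : Fin 2 → ℝ) (V : ℝ → ℝ → Ω → ℝ) (A B Γ : Fin 2 → Ω → ℝ) (ζ : Fin d → Ω → ℝ)
    (a b c e : ℝ) (ω : Ω) :
    rectIncr (etaHat R θ₀ γ V A B Γ ζ) a b c e ω = rectIncr V a b c e ω
      + ∑ k, driftCoeff A B Γ ζ k ω * (driftFun R θ₀ γ k b e - driftFun R θ₀ γ k a e
        - driftFun R θ₀ γ k b c + driftFun R θ₀ γ k a c) := by
  have h : ∀ k, driftCoeff A B Γ ζ k ω * (driftFun R θ₀ γ k b e - driftFun R θ₀ γ k a e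
        - driftFun R θ₀ γ k b c + driftFun R θ₀ γ k a c)
      = driftCoeff A B Γ ζ k ω * driftFun R θ₀ γ k b e
        - driftCoeff A B Γ ζ k ω * driftFun R θ₀ γ k a e
        - driftCoeff A B Γ ζ k ω * driftFun R θ₀ γ k b c
        + driftCoeff A B Γ ζ k ω * driftFun R θ₀ γ k a c := fun k => by ring
  rw [rectIncr, rectIncr, etaHat_eq, etaHat_eq, etaHat_eq, etaHat_eq,
    Finset.sum_congr rfl fun k _ => h k, Finset.sum_add_distrib, Finset.sum_sub_distrib,
    Finset.sum_sub_distrib]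
  abel

/-! ### The transformed process -/

theorem real_inner_eq_integral_mul {α : Type*} [MeasurableSpace α] {μ : Measure α}
    (f g : Lp ℝ 2 μ) : inner ℝ f g = ∫ a, f a * g a ∂μ := by
  simp_rw [L2.inner_def, RCLike.inner_apply, conj_trivial, mul_comm]

/-- The martingale transform of a process that differs from a Wiener process with time `m` by a
random linear combination of the drifts with densities `q i` is again a Wiener process. -/
theorem isWienerProcessOn_transformed {ι Ω : Type*} [Fintype ι] [DecidableEq ι]
    [MeasurableSpace Ω] {P : Measure Ω} [IsProbabilityMeasure P] {m : Measure (ℝ × ℝ)}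
    {τ : ℝ → ℝ → ℝ} {q : ι → ℝ → ℝ → ℝ} {δ T : ℝ} (hδT : δ < T) {V η : ℝ → ℝ → Ω → ℝ}
    {Z : ι → Ω → ℝ} (hfin : m (Icc δ T ×ˢ Icc δ T) ≠ ⊤)
    (hm1 : ∀ c, m {p | p.1 = c} = 0) (hm2 : ∀ c, m {p | p.2 = c} = 0)
    (hτ : ∀ x ∈ Icc δ T, ∀ y ∈ Icc δ T, m.real (Ioc δ x ×ˢ Ioc δ y)
      = τ x y - τ δ y - τ x δ + τ δ δ)
    (hV : IsWienerProcessOn (Icc δ T ×ˢ Icc δ T) τ V P)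
    (hqcont : ∀ k, ContinuousOn (fun p : ℝ × ℝ => q k p.1 p.2) (Icc δ T ×ˢ Icc δ T))
    (hI : ∀ t ∈ Ico δ T, IsUnit (infoMatrix q m δ T t)) (hZ : ∀ k, Measurable (Z k))
    (hinc : ∀ a b c e, δ ≤ a → a ≤ b → b ≤ T → δ ≤ c → c ≤ e → e ≤ T → ∀ ω,
      rectIncr η a b c e ω = rectIncr V a b c e ω
        + ∑ k, Z k ω * ∫ p in Ioc a b ×ˢ Ioc c e, q k p.1 p.2 ∂m) :
    (∃ J : ℝ → Ω → ι → ℝ, IsTailIntegralVersion P q η δ T J) ∧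
    ∀ J : ℝ → Ω → ι → ℝ, IsTailIntegralVersion P q η δ T J →
      (∀ x ∈ Icc δ T, ∀ y ∈ Ico δ T, ∀ᵐ ω ∂P,
        IntegrableOn (compensatorIntegrand q m δ T J ω) (Icc δ x ×ˢ Icc δ y) m) ∧
      IsWienerProcessOn (Icc δ T ×ˢ Ico δ T) (fun x y => m.real (Icc δ x ×ˢ Icc δ y))
        (transformed q m δ T η J) P := by
  set S : Set (ℝ × ℝ) := Icc δ T ×ˢ Icc δ T with hS
  set ν := m.restrict S with hνdef
  set qc : ι → ℝ × ℝ → ℝ :=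
    fun i p => q i (clampSquare δ T p).1 (clampSquare δ T p).2 with hqc
  have hSm : MeasurableSet S := measurableSet_Icc.prod measurableSet_Icc
  have hνS : ν Sᶜ = 0 := by rw [hνdef, Measure.restrict_apply hSm.compl]; simp
  have hνfin : IsFiniteMeasure ν := ⟨by
    rw [hνdef, Measure.restrict_apply_univ]; exact lt_top_iff_ne_top.2 hfin⟩
  have hν1 : ∀ c, ν {p | p.1 = c} = 0 := fun c =>
    Measure.absolutelyContinuous_of_le Measure.restrict_le_self (hm1 c)
  have hν2 : ∀ c, ν {p | p.2 = c} = 0 := fun c =>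
    Measure.absolutelyContinuous_of_le Measure.restrict_le_self (hm2 c)
  -- The measure of a box agrees with the rectangle increment of `τ`.
  have hτν : ∀ x ∈ Icc δ T, ∀ y ∈ Icc δ T, ν.real (Icc δ x ×ˢ Icc δ y)
      = τ x y - τ δ y - τ x δ + τ δ δ := by
    intro x hx y hy
    rw [← hτ x hx y hy, hνdef,
      measureReal_restrict_apply (measurableSet_Icc.prod measurableSet_Icc),
      inter_eq_self_of_subset_left (prod_mono (Icc_subset_Icc_right hx.2)
        (Icc_subset_Icc_right hy.2))]
    refine measureReal_congr ?_
    have h1 : ∀ᵐ p ∂m, p.1 ≠ δ := by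
      rw [ae_iff]; simpa using hm1 δ
    have h2 : ∀ᵐ p ∂m, p.2 ≠ δ := by
      rw [ae_iff]; simpa using hm2 δ
    filter_upwards [h1, h2] with p h1 h2
    exact propext ⟨fun h => ⟨⟨lt_of_le_of_ne h.1.1 (Ne.symm h1), h.1.2⟩,
      lt_of_le_of_ne h.2.1 (Ne.symm h2), h.2.2⟩, fun h => ⟨⟨h.1.1.le, h.1.2⟩, h.2.1.le, h.2.2⟩⟩
  obtain ⟨W, hW, hWG, hW0⟩ := exists_wienerIntegral hδT.le hνS hτν hV
  have hqu : ∀ k, UniformContinuous (qc k) := fun k =>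
    (uniformContinuous_and_bounded_comp_clampSquare hδT.le (hqcont k)).1
  have hq : ∀ k, Continuous (qc k) := fun k => (hqu k).continuous
  obtain ⟨C, hC⟩ : ∃ C, ∀ k p, |qc k p| ≤ C := by
    choose C hC using fun k =>
      (uniformContinuous_and_bounded_comp_clampSquare hδT.le (hqcont k)).2
    exact ⟨∑ k, |C k|, fun k p => ((hC k p).trans (le_abs_self _)).trans
      (Finset.single_le_sum (f := fun k => |C k|) (fun k _ => abs_nonneg _) (Finset.mem_univ k))⟩
  have hIν : ∀ t ∈ Ico δ T, IsUnit (tailInfo ν qc t) := fun t ht => by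
    have := hI t ht
    rwa [infoMatrix_eq_tailInfo ht.1] at this
  have hinc' : ∀ a b c e, δ ≤ a → a ≤ b → b ≤ T → δ ≤ c → c ≤ e → e ≤ T → ∀ ω,
      rectIncr η a b c e ω = rectIncr V a b c e ω
        + ∑ k, Z k ω * ∫ p in Ioc a b ×ˢ Ioc c e, qc k p ∂ν := by
    intro a b c e ha hab hb hc hce he ω
    have hsub : Ioc a b ×ˢ Ioc c e ⊆ S := fun p hp =>
      ⟨⟨ha.trans hp.1.1.le, hp.1.2.trans hb⟩, hc.trans hp.2.1.le, hp.2.2.trans he⟩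
    have hms : MeasurableSet (Ioc a b ×ˢ Ioc c e) := measurableSet_Ioc.prod measurableSet_Ioc
    rw [hinc a b c e ha hab hb hc hce he, hνdef, Measure.restrict_restrict hms,
      inter_eq_self_of_subset_left hsub]
    congr! 3 with k
    refine setIntegral_congr_fun (μ := m) hms fun p hp => ?_
    simp only [hqc, clampSquare_eq_self (hsub hp)]
  have hψ : ∀ t i, MemLp ({p : ℝ × ℝ | t ≤ p.2}.indicator (qc i)) 2 ν :=
    memLp_indicator_tail hq hC
  have hint : ∀ t ∈ Ico δ T, ∀ i,
      IsStochasticIntegral P (q i) η δ T t T (limitIntegral W qc Z (hψ t i)) := by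
    intro t ht i
    refine (isStochasticIntegral_limitIntegral hνS hν1 hν2 hW hq hC hZ hinc' (hqu i) ht.1
      (hψ t i)).congr fun x hx y hy => ?_
    simp only [hqc]
    rw [clampSquare_eq_self ⟨hx, ht.1.trans hy.1, hy.2⟩]
  refine ⟨?_, fun J hJ => ?_⟩
  · obtain ⟨J, hJm, hJ⟩ := exists_measurable_limitIntegral (δ := δ) (T := T) (P := P) (W := W) hν2
      hq hC hZ hψ
    exact ⟨J, hJm, fun t ht i =>
      (hint t ht i).congr_ae (hJ t (Ico_subset_Icc_self ht) i).symm⟩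
  obtain ⟨hJm, hJI⟩ := hJ
  have hJ : ∀ t ∈ Ico δ T, ∀ i, (fun ω => J t ω i) =ᵐ[P] limitIntegral W qc Z (hψ t i) :=
    fun t ht i => (hJI t ht i).unique hδT.le ht.2.le (hint t ht i)
  have hbox : ∀ {x y : ℝ}, x ≤ T → y ≤ T → Icc δ x ×ˢ Icc δ y ⊆ S := fun hx hy =>
    prod_mono (Icc_subset_Icc_right hx) (Icc_subset_Icc_right hy)
  have hbm : ∀ x y : ℝ, MeasurableSet (Icc δ x ×ˢ Icc δ y) := fun x y =>
    measurableSet_Icc.prod measurableSet_Icc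
  have hνbox : ∀ {x y : ℝ}, x ≤ T → y ≤ T →
      ν.restrict (Icc δ x ×ˢ Icc δ y) = m.restrict (Icc δ x ×ˢ Icc δ y) := fun hx hy => by
    rw [hνdef, Measure.restrict_restrict (hbm _ _), inter_eq_self_of_subset_left (hbox hx hy)]
  have hIy : ∀ {y₀ : ℝ}, y₀ < T → ∀ t ∈ Icc δ y₀, IsUnit (tailInfo ν qc t) :=
    fun hy t ht => hIν t ⟨ht.1, ht.2.trans_lt hy⟩
  have hL : ∀ (x y : ℝ) {y₀ : ℝ}, δ ≤ y₀ → y₀ < T →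
      MemLp (transformedIndicator ν qc δ y₀ (Icc δ x ×ˢ Icc δ y)) 2 ν := fun x y _ hy₀ hyT =>
    (memLp_transformedIndicator hy₀ hν2 hq hC (hIy hyT) (hbm x y)).2.2
  have hmain : ∀ {x y y₀ : ℝ} (_ : x ∈ Icc δ T) (hy : y ∈ Icc δ y₀) (hyT : y₀ < T),
      (∀ᵐ ω ∂P, IntegrableOn (compensatorIntegrand q m δ T J ω)
        (Icc δ x ×ˢ Icc δ y) m) ∧
      transformed q m δ T η J x y
        =ᵐ[P] W (hL x y (hy.1.trans hy.2) hyT).toLp := by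
    intro x y y₀ hx hy hyT
    obtain ⟨h1, h2⟩ := transformed_ae_eq (hy.1.trans hy.2) hyT hν1 hν2 hW hq hC (hIy hyT) hZ hinc' hψ
      hJm hJ hx hy (hL x y (hy.1.trans hy.2) hyT)
    have hyT' : y ≤ T := hy.2.trans hyT.le
    have hcomp : ∀ ω, EqOn (compensatorIntegrand q m δ T J ω)
        (fun a => weight ν qc δ y₀ a ⬝ᵥ J a.2 ω) (Icc δ x ×ˢ Icc δ y) := fun ω p hp =>
      compensatorIntegrand_eq hyT.le J ω ⟨⟨hp.1.1, hp.1.2.trans hx.2⟩, hp.2.1, hp.2.2.trans hy.2⟩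
    constructor
    · filter_upwards [h1] with ω hω
      rw [integrableOn_congr_fun (hcomp ω) (hbm x y), IntegrableOn, ← hνbox hx.2 hyT']
      exact hω
    · filter_upwards [h2] with ω hω
      rw [← hω, transformed, setIntegral_congr_fun (hbm x y) (hcomp ω), hνbox hx.2 hyT']
  refine ⟨fun x hx y hy => (hmain hx ⟨hy.1, le_rfl⟩ hy.2).1, ?_, ?_, ?_⟩
  · have hG := hWG.comp_right (fun p : (Icc δ T ×ˢ Ico δ T : Set (ℝ × ℝ)) =>
      (hL p.1.1 p.1.2 p.2.2.1 p.2.2.2).toLp)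
    exact hG.congr fun p => (hmain p.2.1 ⟨p.2.2.1, le_rfl⟩ p.2.2.2).2.symm
  · intro p hp
    rw [integral_congr_ae (hmain hp.1 ⟨hp.2.1, le_rfl⟩ hp.2.2).2, hW0]
  · rintro ⟨x, y⟩ ⟨hx, hy⟩ ⟨x', y'⟩ ⟨hx', hy'⟩
    dsimp only at hx hy hx' hy' ⊢
    -- Both variables are written with matrices clamped at the same level `max y y'`.
    have hy₀ : max y y' < T := max_lt hy.2 hy'.2
    have hδ₀ : δ ≤ max y y' := hy.1.trans (le_max_left _ _)
    have h1 := (hmain hx ⟨hy.1, le_max_left y y'⟩ hy₀).2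
    have h2 := (hmain hx' ⟨hy'.1, le_max_right y y'⟩ hy₀).2
    have h3 : ∫ ω, transformed q m δ T η J x y ω
          * transformed q m δ T η J x' y' ω ∂P
        = inner ℝ (W (hL x y hδ₀ hy₀).toLp) (W (hL x' y' hδ₀ hy₀).toLp) := by
      rw [real_inner_eq_integral_mul]
      refine integral_congr_ae ?_
      filter_upwards [h1, h2] with ω h1 h2
      rw [h1, h2]
    have h4 : inner ℝ (hL x y hδ₀ hy₀).toLp (hL x' y' hδ₀ hy₀).toLp
        = ∫ p, transformedIndicator ν qc δ (max y y') (Icc δ x ×ˢ Icc δ y) p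
          * transformedIndicator ν qc δ (max y y') (Icc δ x' ×ˢ Icc δ y') p ∂ν := by
      rw [real_inner_eq_integral_mul]
      refine integral_congr_ae ?_
      filter_upwards [(hL x y hδ₀ hy₀).coeFn_toLp, (hL x' y' hδ₀ hy₀).coeFn_toLp] with p h1 h2
      rw [h1, h2]
    rw [h3, W.inner_map_map, h4, integral_transformedIndicator_mul hδ₀ hν2 hq hC (hIy hy₀)
      (hbm x y) (hbm x' y') (fun a ha => ⟨ha.2.1, ha.2.2.trans (le_max_left _ _)⟩)
      (fun a ha => ⟨ha.2.1, ha.2.2.trans (le_max_right _ _)⟩), prod_inter_prod, Icc_inter_Icc,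
      Icc_inter_Icc, sup_idem, hνdef, measureReal_restrict_apply (hbm _ _),
      inter_eq_self_of_subset_left (hbox ((min_le_left _ _).trans hx.2)
        ((min_le_left _ _).trans hy.2.le))]

end TailGoF

end

theorem corollary2 {d : ℕ}
    (Θ : Set (Fin d → ℝ)) (hΘ : IsOpen Θ) (θ₀ : Fin d → ℝ) (hθ₀ : θ₀ ∈ Θ)
    (R : (Fin d → ℝ) → ℝ≥0∞ → ℝ≥0∞ → ℝ≥0∞) (hR : ∀ θ ∈ Θ, TailGoF.IsTailCopula (R θ))
    (μ : (Fin d → ℝ) → Measure (ℝ≥0∞ × ℝ≥0∞))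
    (hμ : ∀ θ ∈ Θ, TailGoF.IsTailMeasure (R θ) (μ θ))
    (r : (Fin d → ℝ) → ℝ → ℝ → ℝ)
    (hB2 : TailGoF.AssumptionB2 R θ₀) (hB4 : TailGoF.AssumptionB4 Θ μ r θ₀)
    (δ T : ℝ) (hδ : 0 < δ) (hδT : δ < T) (γ : Fin 2 → ℝ)
    (hI : ∀ t ∈ Ico δ T,
      IsUnit (TailGoF.infoMatrix (TailGoF.q r θ₀ γ) (TailGoF.planar (μ θ₀)) δ T t))
    {Ω : Type*} [MeasurableSpace Ω] (P : Measure Ω) [IsProbabilityMeasure P]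
    (V : ℝ → ℝ → Ω → ℝ)
    (hV : TailGoF.IsWienerProcessOn (Icc δ T ×ˢ Icc δ T) (TailGoF.tailFun (R θ₀)) V P)
    (A B Γ : Fin 2 → Ω → ℝ) (ζ : Fin d → Ω → ℝ)
    (hA : ∀ j, Measurable (A j)) (hB : ∀ j, Measurable (B j)) (hΓ : ∀ j, Measurable (Γ j))
    (hζ : ∀ i, Measurable (ζ i)) :
    (∃ J : ℝ → Ω → Fin 6 ⊕ Fin d → ℝ,
      TailGoF.IsTailIntegralVersion P (TailGoF.q r θ₀ γ)
        (TailGoF.etaHat R θ₀ γ V A B Γ ζ) δ T J) ∧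
    ∀ J : ℝ → Ω → Fin 6 ⊕ Fin d → ℝ,
      TailGoF.IsTailIntegralVersion P (TailGoF.q r θ₀ γ)
        (TailGoF.etaHat R θ₀ γ V A B Γ ζ) δ T J →
      (∀ x ∈ Icc δ T, ∀ y ∈ Ico δ T, ∀ᵐ ω ∂P,
        IntegrableOn
          (TailGoF.compensatorIntegrand (TailGoF.q r θ₀ γ) (TailGoF.planar (μ θ₀)) δ T J ω)
          (Icc δ x ×ˢ Icc δ y) (TailGoF.planar (μ θ₀))) ∧
      TailGoF.IsWienerProcessOn (Icc δ T ×ˢ Ico δ T)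
        (fun x y => (TailGoF.planar (μ θ₀)).real (Icc δ x ×ˢ Icc δ y))
        (TailGoF.transformed (TailGoF.q r θ₀ γ) (TailGoF.planar (μ θ₀)) δ T
          (TailGoF.etaHat R θ₀ γ V A B Γ ζ) J) P := by
  have hpos : Icc δ T ×ˢ Icc δ T ⊆ Ioi (0 : ℝ) ×ˢ Ioi (0 : ℝ) := fun p hp =>
    ⟨hδ.trans_le hp.1.1, hδ.trans_le hp.2.1⟩
  obtain ⟨hC, N, hN, -, hr, hθ⟩ := id hB4
  have hdens : TailGoF.HasPositiveTailDensity (μ θ₀) (r θ₀) := hr θ₀ (mem_of_mem_nhds hN)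
  refine TailGoF.isWienerProcessOn_transformed (Z := TailGoF.driftCoeff A B Γ ζ) hδT ?_
    (fun c => (TailGoF.planar_line_eq_zero hdens c).1)
    (fun c => (TailGoF.planar_line_eq_zero hdens c).2)
    (fun x hx y hy => (TailGoF.tailFun_increment (hR θ₀ hθ₀) (hμ θ₀ hθ₀) hδ.le hx.1 hδ.le hy.1).symm)
    hV (fun k => (TailGoF.continuousOn_q hC hdens.1 (fun i => (hθ i).1 θ₀ (mem_of_mem_nhds hN))
      (fun i => (hθ i).2) k).mono hpos) hI ?_ ?_
  · exact measure_ne_top_of_subset (prod_mono Icc_subset_Iic_self Icc_subset_Iic_self)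
      (TailGoF.planar_Iic_ne_top (hR θ₀ hθ₀) (hμ θ₀ hθ₀) (hδ.trans hδT).le (hδ.trans hδT).le)
  · rintro (k | i)
    · fin_cases k
      exacts [hA 0, hB 0, hΓ 0, hA 1, hB 1, hΓ 1]
    · exact hζ i
  · intro a b c e ha hab _ hc hce _ ω
    rw [TailGoF.rectIncr_etaHat]
    congr! 3 with k
    exact TailGoF.driftFun_increment hR hμ hB2 hB4 γ k (hδ.trans_le ha) hab (hδ.trans_le hc) hce
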